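/- Let $F$ be a non-Archimedean local field, let $E'/E/F$ be a tower of finite tamely ramified field extensions (the ramification indices are prime to the residue characteristic), and let $V$ be a finite-dimensional $E'$-vector space. For a field $K\in\{F,E,E'\}$ let $\underline{\mathrm{Aut}}_K(V)$ be the $K$-group scheme $A\mapsto \mathrm{Aut}_A(A\otimes_K V)$, and put $$H'=\mathrm{Res}_{E'/F}\,\underline{\mathrm{Aut}}_{E'}(V),\qquad H=\mathrm{Res}_{E/F}\,\underline{\mathrm{Aut}}_{E}(V),\qquad G=\underline{\mathrm{Aut}}_F(V),$$ where $H'$ and $H$ are identified with their images in $G$ under the canonical monomorphisms. Then: (1) $H'\subset H\subset G$ is a tamely ramified twisted Levi sequence in $G$; that is, $H'$, $H$ and $G$ are closed connected reductive $F$-subgroups of $G$ with $H'\subset H\subset G$, and there is a finite tamely ramified Galois extension $L/F$ such that $H'\times_F L$, $H\times_F L$ and $G\times_F L$ are split Levi subgroups of $G\times_F L$ (a split Levi subgroup is a Levi factor of a parabolic $L$-subgroup which has a split maximal torus). (2) Let $Z(\cdot)$ denote the scheme-theoretic center. Then $Z(G)\subset Z(H')$, the quotient algebraic group $Z(H')/Z(G)$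 exists, and it is anisotropic over $F$, i.e. it has no nontrivial $F$-split subtorus. -/

import Mathlib

open CategoryTheory TensorProduct Opposite

universe u

noncomputable section

/-! ### Tame ramification -/

/-- `L` is tamely ramified over `A`, where `A` is the ring of integers of a non-archimedean local
field `K` and `L` is a finite extension of `K`: the ramification index of the maximal ideal of the
ring of integers of `L` (the integral closure of `A` in `L`) is not divisible by the residue
characteristic. The residue fields are finite, so their extension is automatically separable. -/
def IsTamelyRamified (A L : Type*) [CommRing A] [Field L] [Algebra A L] : Prop :=
  ∀ P : Ideal (integralClosure A L), P.IsPrime → P ≠ ⊥ →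
    ((P.ramificationIdx A : ℕ) : integralClosure A L ⧸ P) ≠ 0

/-! ### Group functors -/

/-- Functors from commutative `k`-algebras to groups; group schemes over `k` are treated through
their functors of points. -/
abbrev GroupFunctor (k : Type u) [CommRing k] := CommAlgCat.{u} k ⥤ GrpCat.{u}

/-- An `L`-algebra viewed as a `k`-algebra. -/
def restrictAlg (k L : Type u) [CommRing k] [CommRing L] [Algebra k L] :
    CommAlgCat.{u} L ⥤ CommAlgCat.{u} k where
  obj B := letI := Algebra.compHom B (algebraMap k L); CommAlgCat.of k B
  map {B C} f :=
    letI := Algebra.compHom B (algebraMap k L)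
    letI := Algebra.compHom C (algebraMap k L)
    CommAlgCat.ofHom
      { f.hom.toRingHom with commutes' := fun r => f.hom.commutes (algebraMap k L r) }

/-- The functor `A ↦ E ⊗ A` from `F`-algebras to `E`-algebras. -/
def extendAlg (F E : Type u) [CommRing F] [CommRing E] [Algebra F E] :
    CommAlgCat.{u} F ⥤ CommAlgCat.{u} E where
  obj A := CommAlgCat.of E (E ⊗[F] A)
  map f := CommAlgCat.ofHom (Algebra.TensorProduct.map (AlgHom.id E E) f.hom)
  map_id A := by ext : 1; exact Algebra.TensorProduct.map_id
  map_comp f g := by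
    ext : 1
    exact Algebra.TensorProduct.ext (by ext) (by ext x; simp)

namespace GroupFunctor

/-- Extension of scalars `G ×_k L` of a group functor. -/
def baseChange {k : Type u} [CommRing k] (G : GroupFunctor k) (L : Type u) [CommRing L]
    [Algebra k L] : GroupFunctor L := restrictAlg k L ⋙ G

/-- Weil restriction of scalars: `(Res_{E/F} X)(A) = X(E ⊗_F A)`. -/
def weilRestriction (F : Type u) {E : Type u} [CommRing F] [CommRing E] [Algebra F E]
    (X : GroupFunctor E) : GroupFunctor F := extendAlg F E ⋙ X

end GroupFunctor

/-! ### The group functor of automorphisms of a module -/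

section Aut

variable {k : Type u} [CommRing k] (V : Type u) [AddCommGroup V] [Module k V]

/-- Base change along `f : A → B` of an `A`-linear endomorphism of `A ⊗ V`: the `B`-linear
endomorphism of `B ⊗ V` sending `1 ⊗ v` to the image of `g (1 ⊗ v)`. -/
def endBaseChange {A B : Type u} [CommRing A] [Algebra k A] [CommRing B] [Algebra k B]
    (f : A →ₐ[k] B) (g : Module.End A (A ⊗[k] V)) : Module.End B (B ⊗[k] V) :=
  LinearMap.liftBaseChange B
    (f.toLinearMap.rTensor V ∘ₗ g.restrictScalars k ∘ₗ TensorProduct.mk k A V 1)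

variable {V}

theorem rTensor_smul {A B : Type u} [CommRing A] [Algebra k A] [CommRing B] [Algebra k B]
    (f : A →ₐ[k] B) (a : A) (x : A ⊗[k] V) :
    f.toLinearMap.rTensor V (a • x) = f a • f.toLinearMap.rTensor V x := by
  induction x with
  | zero => simp
  | tmul b v => simp [TensorProduct.smul_tmul']
  | add x y hx hy => simp [hx, hy]

theorem endBaseChange_rTensor {A B : Type u} [CommRing A] [Algebra k A] [CommRing B] [Algebra k B]
    (f : A →ₐ[k] B) (g : Module.End A (A ⊗[k] V)) (x : A ⊗[k] V) :
    endBaseChange V f g (f.toLinearMap.rTensor V x) = f.toLinearMap.rTensor V (g x) := by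
  induction x with
  | zero => simp
  | add x y hx hy => simp [hx, hy]
  | tmul a v =>
    have h : a ⊗ₜ[k] v = a • ((1 : A) ⊗ₜ[k] v) := by simp [TensorProduct.smul_tmul']
    rw [h, rTensor_smul, (endBaseChange V f g).map_smul, g.map_smul, rTensor_smul]
    congr 1
    simp [endBaseChange]

/-- Two `B`-linear endomorphisms of `B ⊗ V` agreeing on the image of `A ⊗ V` are equal. -/
theorem end_ext_rTensor {A B : Type u} [CommRing A] [Algebra k A] [CommRing B] [Algebra k B]
    (f : A →ₐ[k] B) {g h : Module.End B (B ⊗[k] V)}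
    (H : ∀ x, g (f.toLinearMap.rTensor V x) = h (f.toLinearMap.rTensor V x)) : g = h := by
  ext v
  simpa using H (1 ⊗ₜ v)

variable (V)

/-- Base change of endomorphisms as a monoid homomorphism. -/
def endBaseChangeHom {A B : Type u} [CommRing A] [Algebra k A] [CommRing B] [Algebra k B]
    (f : A →ₐ[k] B) : Module.End A (A ⊗[k] V) →* Module.End B (B ⊗[k] V) where
  toFun := endBaseChange V f
  map_one' := end_ext_rTensor f fun x => by rw [endBaseChange_rTensor]; rfl
  map_mul' g h := end_ext_rTensor f fun x => by
    rw [endBaseChange_rTensor, Module.End.mul_apply, Module.End.mul_apply,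
      endBaseChange_rTensor, endBaseChange_rTensor]

/-- The group functor `Aut_k(V) : A ↦ Aut_A (A ⊗_k V)`. -/
def autFunctor (k : Type u) [CommRing k] (V : Type u) [AddCommGroup V] [Module k V] :
    GroupFunctor k where
  obj A := GrpCat.of (LinearMap.GeneralLinearGroup A (A ⊗[k] V))
  map f := GrpCat.ofHom (Units.map (endBaseChangeHom V f.hom))
  map_id A := by
    refine GrpCat.hom_ext (MonoidHom.ext fun g => Units.ext (LinearMap.ext fun x => ?_))
    have h := endBaseChange_rTensor (AlgHom.id k A) g.1 x
    have e : ∀ y, (AlgHom.id k A).toLinearMap.rTensor V y = y := fun y => by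
      rw [AlgHom.toLinearMap_id, LinearMap.rTensor_id, LinearMap.id_apply]
    rwa [e, e] at h
  map_comp {A B C} f g := by
    refine GrpCat.hom_ext (MonoidHom.ext fun h => ?_)
    refine Units.ext (end_ext_rTensor (g.hom.comp f.hom) fun x => ?_)
    have e : ∀ y, (g.hom.comp f.hom).toLinearMap.rTensor V y =
        g.hom.toLinearMap.rTensor V (f.hom.toLinearMap.rTensor V y) := fun y => by
      rw [AlgHom.comp_toLinearMap, LinearMap.rTensor_comp, LinearMap.comp_apply]
    have h1 := endBaseChange_rTensor (g.hom.comp f.hom) h.1 x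
    have h2 := endBaseChange_rTensor g.hom (endBaseChange V f.hom h.1)
      (f.hom.toLinearMap.rTensor V x)
    refine h1.trans ?_
    rw [e, e]
    refine Eq.trans ?_ h2.symm
    rw [endBaseChange_rTensor]

end Aut

/-! ### The morphism `Res_{E/F} Aut_E(V) → Aut_F(V)` -/

section ResAut

variable (F E : Type u) [CommRing F] [CommRing E] [Algebra F E]
  (V : Type u) [AddCommGroup V] [Module E V] [Module F V] [IsScalarTower F E V]

/-- The group functor `Res_{E/F} Aut_E(V) : A ↦ Aut_{E ⊗_F A} ((E ⊗_F A) ⊗_E V)`. -/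
abbrev resAut : GroupFunctor F := GroupFunctor.weilRestriction F (autFunctor E V)

/-- The canonical isomorphism `(E ⊗_F A) ⊗_E V ≃ A ⊗_F V`, `(e ⊗ a) ⊗ v ↦ a ⊗ e v`. -/
def resEquiv (A : Type u) [CommRing A] [Algebra F A] :
    (E ⊗[F] A) ⊗[E] V ≃+ A ⊗[F] V :=
  (TensorProduct.comm E (E ⊗[F] A) V).toAddEquiv.trans
    ((AlgebraTensorModule.cancelBaseChange F E E V A).toAddEquiv.trans
      (TensorProduct.comm F V A).toAddEquiv)

variable {F E V}

@[simp]
theorem resEquiv_tmul {A : Type u} [CommRing A] [Algebra F A] (e : E) (a : A) (v : V) :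
    resEquiv F E V A ((e ⊗ₜ a) ⊗ₜ v) = a ⊗ₜ (e • v) := by
  simp [resEquiv]

theorem resEquiv_smul {A : Type u} [CommRing A] [Algebra F A] (a : A) (x : (E ⊗[F] A) ⊗[E] V) :
    resEquiv F E V A (((1 : E) ⊗ₜ[F] a) • x) = a • resEquiv F E V A x := by
  induction x with
  | zero => simp
  | add x y hx hy => simp [hx, hy]
  | tmul y v =>
    induction y with
    | zero => simp
    | add y z hy hz => simp only [add_tmul, smul_add, map_add, hy, hz]
    | tmul e b => simp [TensorProduct.smul_tmul']

theorem resEquiv_symm_smul {A : Type u} [CommRing A] [Algebra F A] (a : A) (x : A ⊗[F] V) :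
    (resEquiv F E V A).symm (a • x) = ((1 : E) ⊗ₜ[F] a) • (resEquiv F E V A).symm x := by
  rw [AddEquiv.symm_apply_eq, resEquiv_smul, AddEquiv.apply_symm_apply]

variable (F E V)

/-- An `E ⊗_F A`-linear endomorphism of `(E ⊗_F A) ⊗_E V`, viewed as an `A`-linear endomorphism
of `A ⊗_F V`. -/
def resEnd (A : Type u) [CommRing A] [Algebra F A] :
    Module.End (E ⊗[F] A) ((E ⊗[F] A) ⊗[E] V) →* Module.End A (A ⊗[F] V) where
  toFun g :=
    { toFun := fun x => resEquiv F E V A (g ((resEquiv F E V A).symm x))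
      map_add' := fun x y => by simp
      map_smul' := fun a x => by
        rw [resEquiv_symm_smul, map_smul, resEquiv_smul, RingHom.id_apply] }
  map_one' := by ext x; simp
  map_mul' g h := by ext x; simp

theorem resEnd_injective (A : Type u) [CommRing A] [Algebra F A] :
    Function.Injective (resEnd F E V A) := by
  intro g h H
  refine LinearMap.ext fun x => ?_
  have := LinearMap.congr_fun H (resEquiv F E V A x)
  simpa [resEnd] using this

variable {F E V} in
theorem resEquiv_rTensor {A B : Type u} [CommRing A] [Algebra F A] [CommRing B] [Algebra F B]
    (f : A →ₐ[F] B) (x : (E ⊗[F] A) ⊗[E] V) :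
    resEquiv F E V B
      ((Algebra.TensorProduct.map (AlgHom.id E E) f).toLinearMap.rTensor V x) =
      f.toLinearMap.rTensor V (resEquiv F E V A x) := by
  induction x with
  | zero => simp
  | add x y hx hy => simp only [map_add, hx, hy]
  | tmul y v =>
    induction y with
    | zero => simp
    | add y z hy hz => simp only [add_tmul, map_add, hy, hz]
    | tmul e b => simp

/-- The canonical morphism `Res_{E/F} Aut_E(V) → Aut_F(V)`. -/
def resAutToAut : resAut F E V ⟶ autFunctor F V where
  app A := GrpCat.ofHom (Units.map (resEnd F E V A))
  naturality {A B} f := by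
    refine GrpCat.hom_ext (MonoidHom.ext fun g => ?_)
    refine Units.ext (end_ext_rTensor f.hom fun x => ?_)
    obtain ⟨y, rfl⟩ := (resEquiv F E V A).surjective x
    have h1 := endBaseChange_rTensor f.hom (resEnd F E V A g.1) (resEquiv F E V A y)
    have h2 := endBaseChange_rTensor (Algebra.TensorProduct.map (AlgHom.id E E) f.hom) g.1 y
    have h3 : resEnd F E V A g.1 (resEquiv F E V A y) = resEquiv F E V A (g.1 y) :=
      congrArg (fun z => resEquiv F E V A (g.1 z)) (AddEquiv.symm_apply_apply _ y)
    refine Eq.trans ?_ h1.symm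
    rw [h3]
    refine Eq.trans ?_ ((congrArg (resEquiv F E V B) h2).trans (resEquiv_rTensor f.hom (g.1 y)))
    rw [← resEquiv_rTensor]
    exact congrArg (fun z => resEquiv F E V B
      (endBaseChange V (Algebra.TensorProduct.map (AlgHom.id E E) f.hom) g.1 z))
      (AddEquiv.symm_apply_apply _ _)

/-- The canonical morphism is a monomorphism, so `Res_{E/F} Aut_E(V)` is identified with its
image in `Aut_F(V)`. -/
theorem resAutToAut_injective (A : CommAlgCat.{u} F) :
    Function.Injective ((resAutToAut F E V).app A) := by
  intro g h H
  exact Units.ext (resEnd_injective F E V A (congrArg Units.val H))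

end ResAut

/-! ### Subgroup functors -/

/-- A subgroup functor of a group functor. -/
@[ext]
structure SubgroupFunctor {k : Type u} [CommRing k] (G : GroupFunctor k) where
  /-- the subgroup of `A`-points -/
  obj : ∀ A : CommAlgCat.{u} k, Subgroup (G.obj A)
  map_mem : ∀ {A B : CommAlgCat.{u} k} (f : A ⟶ B) {g : G.obj A}, g ∈ obj A → G.map f g ∈ obj B

namespace SubgroupFunctor

variable {k : Type u} [CommRing k] {G H : GroupFunctor k}

instance : PartialOrder (SubgroupFunctor G) :=
  PartialOrder.lift SubgroupFunctor.obj fun _ _ h => SubgroupFunctor.ext h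

instance : Top (SubgroupFunctor G) := ⟨⟨fun _ => ⊤, fun _ _ _ => trivial⟩⟩

instance : Bot (SubgroupFunctor G) :=
  ⟨⟨fun _ => ⊥, fun f g hg => by
    rw [Subgroup.mem_bot] at hg ⊢
    rw [hg, map_one]⟩⟩

/-- A subgroup functor as a group functor. -/
def toFunctor (S : SubgroupFunctor G) : GroupFunctor k where
  obj A := GrpCat.of (S.obj A)
  map {A B} f := GrpCat.ofHom
    (((G.map f).hom.comp (S.obj A).subtype).codRestrict (S.obj B) fun g => S.map_mem f g.2)
  map_id A := GrpCat.hom_ext (MonoidHom.ext fun g =>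
    Subtype.ext (congrArg (fun φ => φ.hom g.1) (G.map_id A)))
  map_comp f g := GrpCat.hom_ext (MonoidHom.ext fun x =>
    Subtype.ext (congrArg (fun φ => φ.hom x.1) (G.map_comp f g)))

/-- The inclusion of a subgroup functor. -/
def subtype (S : SubgroupFunctor G) : S.toFunctor ⟶ G where
  app A := GrpCat.ofHom (S.obj A).subtype
  naturality _ _ _ := rfl

/-- Image of a subgroup functor under a morphism. -/
def map (φ : H ⟶ G) (S : SubgroupFunctor H) : SubgroupFunctor G where
  obj A := (S.obj A).map (φ.app A).hom
  map_mem {A B} f g := by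
    rintro ⟨h, hh, rfl⟩
    exact ⟨H.map f h, S.map_mem f hh, NatTrans.naturality_apply φ f h⟩

/-- Preimage of a subgroup functor under a morphism. -/
def comap (φ : H ⟶ G) (S : SubgroupFunctor G) : SubgroupFunctor H where
  obj A := (S.obj A).comap (φ.app A).hom
  map_mem {A B} f g hg := by
    have h := S.map_mem f (g := φ.app A g) hg
    rw [← NatTrans.naturality_apply φ f g] at h
    exact h

/-- The image of a morphism, as a subgroup functor. -/
def range (φ : H ⟶ G) : SubgroupFunctor G := map φ ⊤

/-- Extension of scalars of a subgroup functor. -/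
def baseChange (S : SubgroupFunctor G) (L : Type u) [CommRing L] [Algebra k L] :
    SubgroupFunctor (G.baseChange L) where
  obj A := S.obj ((restrictAlg k L).obj A)
  map_mem f _ hg := S.map_mem ((restrictAlg k L).map f) hg

/-- The (scheme-theoretic) center: `Z(G)(A)` consists of the `g ∈ G(A)` that are central in `G(B)`
for every `A`-algebra `B`. -/
def center (G : GroupFunctor k) : SubgroupFunctor G where
  obj A :=
    { carrier := {z | ∀ (B : CommAlgCat.{u} k) (f : A ⟶ B) (h : G.obj B),
        G.map f z * h = h * G.map f z}
      one_mem' := fun B f h => by simp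
      mul_mem' := fun {x y} hx hy B f h => by
        rw [map_mul, mul_assoc, hy B f h, ← mul_assoc, hx B f h, mul_assoc]
      inv_mem' := fun {x} hx B f h => by
        rw [map_inv, inv_mul_eq_iff_eq_mul, ← mul_assoc, hx B f h, mul_assoc, mul_inv_cancel,
          mul_one] }
  map_mem {A B} f z hz C g h := by
    have := hz C (f ≫ g) h
    rwa [G.map_comp, GrpCat.comp_apply] at this

/-- `S` is a closed subfunctor: for every point `g ∈ G(A)` the condition that `g` lies in `S` is
a closed condition on `Spec A`, given by an ideal of `A`. -/
def IsClosed (S : SubgroupFunctor G) : Prop :=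
  ∀ (A : CommAlgCat.{u} k) (g : G.obj A), ∃ I : Ideal A,
    ∀ (B : CommAlgCat.{u} k) (f : A ⟶ B), G.map f g ∈ S.obj B ↔ ∀ a ∈ I, f.hom a = 0

/-- `S` is normal in `G`. -/
def IsNormal (S : SubgroupFunctor G) : Prop := ∀ A, (S.obj A).Normal

end SubgroupFunctor

/-! ### Algebraic groups over a field -/

namespace GroupFunctor

section

variable {k : Type u} [Field k]

/-- The functor `G` is represented by the affine scheme `Spec R`. -/
def IsRepresentedBy (G : GroupFunctor k) (R : CommAlgCat.{u} k) : Prop :=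
  Nonempty (coyoneda.obj (op R) ≅ G ⋙ forget GrpCat.{u})

/-- `G` is an affine algebraic group over `k`. -/
def IsAffineAlgebraic (G : GroupFunctor k) : Prop :=
  ∃ R : CommAlgCat.{u} k, Algebra.FiniteType k R ∧ G.IsRepresentedBy R

/-- `G` is a smooth affine algebraic group over `k`. -/
def IsSmooth (G : GroupFunctor k) : Prop :=
  ∃ R : CommAlgCat.{u} k, Algebra.Smooth k R ∧ G.IsRepresentedBy R

/-- `G` is a smooth connected affine algebraic group over `k`. -/
def IsSmoothConnected (G : GroupFunctor k) : Prop :=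
  ∃ R : CommAlgCat.{u} k,
    Algebra.Smooth k R ∧ ConnectedSpace (PrimeSpectrum R) ∧ G.IsRepresentedBy R

/-- `G` is unipotent: every nonzero finite-dimensional representation has a nonzero fixed
vector. -/
def IsUnipotent (G : GroupFunctor k) : Prop :=
  ∀ (W : Type u) [AddCommGroup W] [Module k W] [FiniteDimensional k W] [Nontrivial W]
    (ρ : G ⟶ autFunctor k W), ∃ w : W, w ≠ 0 ∧
      ∀ (A : CommAlgCat.{u} k) (g : G.obj A),
        (show LinearMap.GeneralLinearGroup A (A ⊗[k] W) from ρ.app A g).1 ((1 : A) ⊗ₜ[k] w) =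
          (1 : A) ⊗ₜ[k] w

/-- The split torus `G_m ^ n` over `k`. -/
def splitTorus (k : Type u) [Field k] (n : ℕ) : GroupFunctor k where
  obj A := GrpCat.of (Fin n → (A : Type u)ˣ)
  map f := GrpCat.ofHom
    (MonoidHom.pi fun i => (Units.map (f.hom : _ →* _)).comp (Pi.evalMonoidHom _ i))
  map_id _ := GrpCat.hom_ext (MonoidHom.ext fun _ => funext fun _ => Units.ext rfl)
  map_comp _ _ := GrpCat.hom_ext (MonoidHom.ext fun _ => funext fun _ => Units.ext rfl)

/-- `G` is a split torus over `k`. -/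
def IsSplitTorus (G : GroupFunctor k) : Prop := ∃ n : ℕ, Nonempty (G ≅ splitTorus k n)

/-- `G` is anisotropic: every split subtorus of `G` (over the ground field) is trivial. -/
def IsAnisotropic (G : GroupFunctor k) : Prop :=
  ∀ S : SubgroupFunctor G, S.IsClosed → S.toFunctor.IsSplitTorus → S = ⊥

/-- The morphism `π : G ⟶ Q` exhibits `Q` as the quotient algebraic group `G / N`: `Q` is an affine
algebraic group, the kernel of `π` is `N`, and `π` is an epimorphism of fppf sheaves. -/
def IsQuotient {G Q : GroupFunctor k} (N : SubgroupFunctor G) (π : G ⟶ Q) : Prop :=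
  Q.IsAffineAlgebraic ∧
    (∀ (A : CommAlgCat.{u} k) (g : G.obj A), π.app A g = 1 ↔ g ∈ N.obj A) ∧
    ∀ (A : CommAlgCat.{u} k) (q : Q.obj A), ∃ (B : CommAlgCat.{u} k) (f : A ⟶ B) (g : G.obj B),
      f.hom.toRingHom.FaithfullyFlat ∧ f.hom.toRingHom.FinitePresentation ∧
        π.app B g = Q.map f q

end

end GroupFunctor

namespace SubgroupFunctor

section

variable {k : Type u} [Field k] {G : GroupFunctor k}

/-- `U` is a smooth connected unipotent normal closed subgroup of `G`. -/
def IsUnipotentNormal (U : SubgroupFunctor G) : Prop :=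
  U.IsClosed ∧ U.toFunctor.IsSmoothConnected ∧ U.toFunctor.IsUnipotent ∧ U.IsNormal

/-- `U` is the unipotent radical of `G` (used over an algebraically closed field): the largest
smooth connected unipotent normal closed subgroup. -/
def IsUnipotentRadical (U : SubgroupFunctor G) : Prop :=
  U.IsUnipotentNormal ∧ ∀ U' : SubgroupFunctor G, U'.IsUnipotentNormal → U' ≤ U

/-- `B` is a smooth connected solvable closed subgroup of `G` (used over an algebraically closed
field, where solvability can be tested on the group of rational points). -/
def IsConnectedSolvable (B : SubgroupFunctor G) : Prop :=
  B.IsClosed ∧ B.toFunctor.IsSmoothConnected ∧ Group.IsSolvable (B.obj (CommAlgCat.of k k))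

/-- `B` is a Borel subgroup of `G` (used over an algebraically closed field): a maximal smooth
connected solvable closed subgroup. -/
def IsBorel (B : SubgroupFunctor G) : Prop := Maximal IsConnectedSolvable B

/-- `P` is a parabolic subgroup of `G`: a smooth closed subgroup which contains a Borel subgroup
over the algebraic closure. -/
def IsParabolic (P : SubgroupFunctor G) : Prop :=
  P.IsClosed ∧ P.toFunctor.IsSmooth ∧
    ∃ B : SubgroupFunctor (G.baseChange (AlgebraicClosure k)),
      B.IsBorel ∧ B ≤ P.baseChange (AlgebraicClosure k)

/-- `M` is a Levi subgroup of `G`: there is a parabolic subgroup `P` of `G` containing `M` such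
that, over the algebraic closure, `P` is the semidirect product of its unipotent radical and
`M`. -/
def IsLevi (M : SubgroupFunctor G) : Prop :=
  M.IsClosed ∧ ∃ P : SubgroupFunctor G, P.IsParabolic ∧ M ≤ P ∧
    ∃ U : SubgroupFunctor (P.toFunctor.baseChange (AlgebraicClosure k)), U.IsUnipotentRadical ∧
      ∀ A, Subgroup.IsComplement'
        (((comap P.subtype M).baseChange (AlgebraicClosure k)).obj A) (U.obj A)

/-- `T` is a closed subgroup of `G` which is a split torus. -/
def IsSplitSubtorus (T : SubgroupFunctor G) : Prop := T.IsClosed ∧ T.toFunctor.IsSplitTorus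

end

end SubgroupFunctor

namespace GroupFunctor

section

variable {k : Type u} [Field k]

/-- `G` is a (connected) reductive group over `k`: a smooth connected affine algebraic group such
that every smooth connected unipotent normal closed subgroup of `G` over the algebraic closure is
trivial. -/
def IsReductive (G : GroupFunctor k) : Prop :=
  G.IsSmoothConnected ∧
    ∀ U : SubgroupFunctor (G.baseChange (AlgebraicClosure k)), U.IsUnipotentNormal → U = ⊥

/-- `G` is split: it has a split subtorus that is a maximal torus, that is, one that stays maximal
among tori over the algebraic closure. -/
def IsSplit (G : GroupFunctor k) : Prop :=
  ∃ T : SubgroupFunctor G, T.IsSplitSubtorus ∧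
    Maximal SubgroupFunctor.IsSplitSubtorus (T.baseChange (AlgebraicClosure k))

end

/-- The sequence `S 0 ⊂ S 1 ⊂ ⋯ ⊂ S d = G` is a tamely ramified twisted Levi sequence in `G`: its
terms are (closed, connected) reductive `F`-subgroups of `G`, and for some finite tamely ramified
Galois extension `L/F` each `S i ×_F L` is a split Levi subgroup of `G ×_F L`. -/
def IsTameTwistedLeviSequence {F : Type u} [Field F] [ValuativeRel F] (G : GroupFunctor F) {d : ℕ}
    (S : Fin (d + 1) → SubgroupFunctor G) : Prop :=
  Monotone S ∧ S (Fin.last d) = ⊤ ∧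
    (∀ i, (S i).IsClosed ∧ (S i).toFunctor.IsReductive) ∧
    ∃ (L : Type u) (_ : Field L) (_ : Algebra F L),
      FiniteDimensional F L ∧ IsGalois F L ∧
      IsTamelyRamified (Valuation.integer (ValuativeRel.valuation F)) L ∧
      ∀ i, ((S i).baseChange L).IsLevi ∧ ((S i).toFunctor.baseChange L).IsSplit

end GroupFunctor

end

/-!
# Tamely ramified twisted Levi sequences of general linear groups

*The Levi sequence.* A tamely ramified finite extension `K / F` of local fields is separable: in
characteristic `p` a uniformizer `w` of `F` generates `F` over its subfield of `p`-th powers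
(`range_frobeniusSum_eq_top`), so that `w` becomes a `p`-th power in every inseparable extension
(`exists_pow_eq_of_not_isSeparable`) and `p` divides the ramification index. The Galois closure `L`
of `K` is again tamely ramified. Indeed, by tameness of `K`, the subgroup of `Gal(L/F)` fixing `K`
meets each inertia group in a subgroup of index prime to `p`, hence contains the wild inertia
groups; these are permuted by conjugation, so they lie in the normal core of that subgroup, which is
trivial (`not_dvd_card_inertia`, `isTamelyRamified_of_isNormalClosure`).

Let `α` generate `K` over `F`. The image of `Res_{K/F} Aut_K(V)` in `Aut_F(V)` is the centralizer of
multiplication by `α`. It is cut out by linear equations in the matrix entries; so it is an open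
subscheme of an affine space, and it is smooth and connected (`IsLinear.isSmoothConnected`). Over a
field in which the minimal polynomial of `α` splits, multiplication by `α` is diagonalizable, and
the centralizer becomes a group of block diagonal matrices for a suitable basis
(`exists_iso_baseChange_range_resAutToAut`). All that is needed about the latter is proved for the
groups of invertible matrices whose nonzero entries lie in the positions allowed by a preorder:

* block diagonal matrices have no nontrivial unipotent normal subgroup, because its fixed vectors in
  each block would form a subspace stable under a full general linear group
  (`eq_bot_of_isUnipotentNormal`);
* block diagonal matrices form a Levi factor of the block upper triangular ones
  (`patternGroup_isLevi`). Here the kernel of the projection to the diagonal blocks is unipotent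
  because it can be contracted to the identity by conjugation with diagonal matrices: along such a
  contraction a matrix representation becomes polynomial, and its leading coefficients provide fixed
  vectors (`Contraction.isUnipotent`). Block upper triangular matrices contain the upper triangular
  ones, which form a Borel subgroup, since a larger solvable group would contain all elementary
  matrices of some conjugate of `SL₂` (`patternGroup_le_isBorel`);
* the diagonal torus is a maximal split torus (`patternGroup_isSplit`).

*The centers.* If `V ≠ 0`, the center of `Res_{K/F} Aut_K(V)` is `Res_{K/F} G_m`, acting by scalars
(`scalarToCenter_bijective`), and the center of `Aut_F(V)` is the subgroup `G_m`. The quotient is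
represented by the Amitsur cocycles of `K / F`, that is, by the units `y` of `K ⊗ K ⊗ A` with
`y₁₂ y₂₃ = y₁₃`: the map `c ↦ c₁ c₂⁻¹` has kernel `G_m`, and every cocycle over `A` is the coboundary of
itself over `A ⊗ K` (`coboundary_eq_one_iff`, `exists_coboundary_eq`).

Let `Q` be any quotient and `n = [K : F]`. The element `cⁿ / N(c)` depends only on the class of `c`
modulo `G_m`, and by faithfully flat descent it defines a unit of `K ⊗ A` of norm one for every
point of `Q` over `A` (`exists_normRatio_descent`). For the universal point of a cocharacter of `Q`,
this is a unit of `K[T, T⁻¹]`, hence a monomial; having norm one it is constant, and its value at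
`T = 1` is `1`. So the `n`-th power of the cocharacter is trivial, and as the cocharacter is determined
after the substitution `T ↦ Tⁿ`, it is itself trivial (`cocharacter_eq_one`). Hence `Q` contains no
nontrivial split torus.
-/

noncomputable section

/-! ### Group functors: morphisms, representability and transport of structure -/

namespace GroupFunctor

section
variable {k : Type u} [CommRing k] {G H : GroupFunctor k}

theorem map_app_apply (φ : H ⟶ G) {A B : CommAlgCat.{u} k} (f : A ⟶ B) (h : H.obj A) :
    φ.app B (H.map f h) = G.map f (φ.app A h) := NatTrans.naturality_apply φ f h

/-- A morphism of group functors that is bijective on points is an isomorphism. -/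
def isoOfBijective (φ : H ⟶ G) (h : ∀ A, Function.Bijective (φ.app A)) : H ≅ G :=
  NatIso.ofComponents (fun A => (MulEquiv.ofBijective (φ.app A).hom (h A)).toGrpIso)
    fun {_ _} f => φ.naturality f

theorem iso_hom_bijective (e : H ≅ G) (A : CommAlgCat.{u} k) :
    Function.Bijective (e.hom.app A) := by
  have h1 : ∀ x, e.inv.app A (e.hom.app A x) = x := fun x =>
    congrArg (fun φ => φ.hom x) (e.hom_inv_id_app A)
  have h2 : ∀ x, e.hom.app A (e.inv.app A x) = x := fun x =>
    congrArg (fun φ => φ.hom x) (e.inv_hom_id_app A)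
  exact ⟨Function.LeftInverse.injective h1, Function.RightInverse.surjective h2⟩

theorem iso_hom_inv_apply (e : H ≅ G) (A : CommAlgCat.{u} k) (x : H.obj A) :
    e.inv.app A (e.hom.app A x) = x :=
  congrArg (fun φ => φ.hom x) (e.hom_inv_id_app A)

theorem iso_inv_hom_apply (e : H ≅ G) (A : CommAlgCat.{u} k) (x : G.obj A) :
    e.hom.app A (e.inv.app A x) = x :=
  congrArg (fun φ => φ.hom x) (e.inv_hom_id_app A)

/-- Extension of scalars of an isomorphism of group functors. -/
def baseChangeIso (e : H ≅ G) (L : Type u) [CommRing L] [Algebra k L] :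
    H.baseChange L ≅ G.baseChange L := Functor.isoWhiskerLeft (restrictAlg k L) e

end

section
variable {k : Type u} [Field k] {G H : GroupFunctor k}

theorem isRepresentedBy_of_universal {R : CommAlgCat.{u} k} (x : G.obj R)
    (hx : ∀ A, Function.Bijective fun f : R ⟶ A => G.map f x) : G.IsRepresentedBy R := by
  refine ⟨NatIso.ofComponents (fun A => (Equiv.ofBijective _ (hx A)).toIso) fun {A B} f => ?_⟩
  ext g
  exact congrArg (fun φ => φ.hom x) (G.map_comp g f)

theorem IsRepresentedBy.exists_universal {R : CommAlgCat.{u} k} (h : G.IsRepresentedBy R) :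
    ∃ x : G.obj R, ∀ A, Function.Bijective fun f : R ⟶ A => G.map f x := by
  obtain ⟨e⟩ := h
  refine ⟨e.hom.app R (𝟙 R), fun A => ?_⟩
  have key : (fun f : R ⟶ A => G.map f (e.hom.app R (𝟙 R))) = e.hom.app A := by
    funext f
    have := congrArg (fun φ => φ (𝟙 R)) (e.hom.naturality f)
    refine this.symm.trans ?_
    change e.hom.app A (𝟙 R ≫ f) = _
    rw [Category.id_comp]
  rw [key]
  exact (e.app A).toEquiv.bijective

theorem IsRepresentedBy.of_iso {R : CommAlgCat.{u} k} (h : H.IsRepresentedBy R) (e : H ≅ G) :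
    G.IsRepresentedBy R :=
  h.map fun i => i.trans (Functor.isoWhiskerRight e (forget GrpCat.{u}))

theorem IsSmooth.of_iso (h : H.IsSmooth) (e : H ≅ G) : G.IsSmooth := by
  obtain ⟨R, hR, h⟩ := h
  exact ⟨R, hR, h.of_iso e⟩

theorem IsSmoothConnected.of_iso (h : H.IsSmoothConnected) (e : H ≅ G) :
    G.IsSmoothConnected := by
  obtain ⟨R, hR, hc, h⟩ := h
  exact ⟨R, hR, hc, h.of_iso e⟩

theorem IsSmoothConnected.isSmooth (h : G.IsSmoothConnected) : G.IsSmooth := by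
  obtain ⟨R, hR, hc, h⟩ := h
  exact ⟨R, hR, h⟩

theorem IsUnipotent.of_iso (h : H.IsUnipotent) (e : H ≅ G) : G.IsUnipotent := by
  intro W _ _ _ _ ρ
  obtain ⟨w, hw, H⟩ := h W (e.hom ≫ ρ)
  refine ⟨w, hw, fun A g => ?_⟩
  obtain ⟨g, rfl⟩ := (iso_hom_bijective e A).2 g
  exact H A g

theorem IsSplitTorus.of_iso (h : H.IsSplitTorus) (e : H ≅ G) : G.IsSplitTorus := by
  obtain ⟨n, ⟨i⟩⟩ := h
  exact ⟨n, ⟨e.symm.trans i⟩⟩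

end

end GroupFunctor

namespace SubgroupFunctor

open GroupFunctor

section
variable {k : Type u} [CommRing k] {G H : GroupFunctor k}

theorem mem_comap {φ : H ⟶ G} {S : SubgroupFunctor G} {A : CommAlgCat.{u} k} {h : H.obj A} :
    h ∈ (comap φ S).obj A ↔ φ.app A h ∈ S.obj A := Iff.rfl

theorem mem_range {φ : H ⟶ G} {A : CommAlgCat.{u} k} {g : G.obj A} :
    g ∈ (range φ).obj A ↔ ∃ h, φ.app A h = g := by
  constructor
  · rintro ⟨h, -, rfl⟩
    exact ⟨h, rfl⟩
  · rintro ⟨h, rfl⟩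
    exact ⟨h, trivial, rfl⟩

theorem comap_mono (φ : H ⟶ G) {S T : SubgroupFunctor G} (h : S ≤ T) : comap φ S ≤ comap φ T :=
  fun A _ hx => h A hx

theorem comap_hom_comap_inv (e : H ≅ G) (S : SubgroupFunctor H) :
    comap e.hom (comap e.inv S) = S := by
  ext A x
  rw [mem_comap, mem_comap, iso_hom_inv_apply]

theorem comap_inv_comap_hom (e : H ≅ G) (S : SubgroupFunctor G) :
    comap e.inv (comap e.hom S) = S := comap_hom_comap_inv e.symm S

theorem comap_bot (e : H ≅ G) : comap e.hom ⊥ = ⊥ := by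
  ext A x
  exact map_eq_one_iff (e.hom.app A).hom (iso_hom_bijective e A).1

theorem comap_baseChange (φ : H ⟶ G) (S : SubgroupFunctor G) (L : Type u) [CommRing L]
    [Algebra k L] : (comap φ S).baseChange L =
      comap (Functor.whiskerLeft (restrictAlg k L) φ) (S.baseChange L) := rfl

theorem IsClosed.comap {S : SubgroupFunctor G} (hS : S.IsClosed) (φ : H ⟶ G) :
    (comap φ S).IsClosed := by
  intro A g
  obtain ⟨I, hI⟩ := hS A (φ.app A g)
  refine ⟨I, fun B f => ?_⟩
  rw [← hI, mem_comap, map_app_apply]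

theorem IsNormal.comap {S : SubgroupFunctor G} (hS : S.IsNormal) (φ : H ⟶ G) :
    (comap φ S).IsNormal := fun A => (hS A).comap (φ.app A).hom

/-- A morphism that is injective on points restricts to an isomorphism from the preimage of a
subgroup functor contained in its image. -/
def comapIso (φ : H ⟶ G) (hφ : ∀ A, Function.Injective (φ.app A)) (S : SubgroupFunctor G)
    (hS : S ≤ range φ) : (comap φ S).toFunctor ≅ S.toFunctor :=
  isoOfBijective
    { app := fun A => GrpCat.ofHom
        (((φ.app A).hom.comp ((comap φ S).obj A).subtype).codRestrict (S.obj A) fun g => g.2)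
      naturality := fun {A B} f => GrpCat.hom_ext (MonoidHom.ext fun g =>
        Subtype.ext (map_app_apply φ f g.1)) }
    fun A => by
      constructor
      · intro x y hxy
        exact Subtype.ext (hφ A (congrArg Subtype.val hxy))
      · rintro ⟨y, hy⟩
        obtain ⟨x, rfl⟩ := mem_range.mp (hS A hy)
        exact ⟨⟨x, hy⟩, rfl⟩

theorem le_range_iso (e : H ≅ G) (S : SubgroupFunctor G) : S ≤ range e.hom :=
  fun A y _ => mem_range.mpr ((iso_hom_bijective e A).2 y)

/-- An isomorphism of group functors restricts to an isomorphism of subgroup functors. -/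
def comapIso' (e : H ≅ G) (S : SubgroupFunctor G) : (comap e.hom S).toFunctor ≅ S.toFunctor :=
  comapIso e.hom (fun A => (iso_hom_bijective e A).1) S (le_range_iso e S)

theorem maximal_comap {p : SubgroupFunctor G → Prop} {q : SubgroupFunctor H → Prop} (e : H ≅ G)
    (hp : ∀ S, p S → q (comap e.hom S)) (hq : ∀ S, q S → p (comap e.inv S))
    {S : SubgroupFunctor G} (hS : Maximal p S) : Maximal q (comap e.hom S) := by
  refine ⟨hp _ hS.1, fun T hT hle => ?_⟩
  have h1 := hS.2 (hq T hT) (by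
    have := comap_mono e.inv hle
    rwa [comap_inv_comap_hom] at this)
  have h2 := comap_mono e.hom h1
  rwa [comap_hom_comap_inv] at h2

end

section
variable {k : Type u} [Field k] {G H : GroupFunctor k}

theorem IsUnipotentNormal.comap_iso {U : SubgroupFunctor G} (hU : U.IsUnipotentNormal)
    (e : H ≅ G) : (comap e.hom U).IsUnipotentNormal :=
  ⟨hU.1.comap _, hU.2.1.of_iso (comapIso' e U).symm, hU.2.2.1.of_iso (comapIso' e U).symm,
    hU.2.2.2.comap _⟩

theorem IsUnipotentRadical.comap_iso {U : SubgroupFunctor G} (hU : U.IsUnipotentRadical)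
    (e : H ≅ G) : (comap e.hom U).IsUnipotentRadical := by
  refine ⟨hU.1.comap_iso e, fun U' hU' => ?_⟩
  have h := comap_mono e.hom (hU.2 _ (hU'.comap_iso e.symm))
  rwa [Iso.symm_hom, comap_hom_comap_inv] at h

theorem IsConnectedSolvable.comap_iso {B : SubgroupFunctor G} (hB : B.IsConnectedSolvable)
    (e : H ≅ G) : (comap e.hom B).IsConnectedSolvable := by
  refine ⟨hB.1.comap _, hB.2.1.of_iso (comapIso' e B).symm, ?_⟩
  have : Group.IsSolvable (B.toFunctor.obj (CommAlgCat.of k k)) := hB.2.2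
  exact Group.isSolvable_of_isSolvable_injective
    (f := ((comapIso' e B).hom.app (CommAlgCat.of k k)).hom) (iso_hom_bijective (comapIso' e B) _).1

theorem IsBorel.comap_iso {B : SubgroupFunctor G} (hB : B.IsBorel) (e : H ≅ G) :
    (comap e.hom B).IsBorel :=
  maximal_comap e (fun _ h => h.comap_iso e) (fun _ h => h.comap_iso e.symm) hB

theorem IsSplitSubtorus.comap_iso {T : SubgroupFunctor G} (hT : T.IsSplitSubtorus) (e : H ≅ G) :
    (comap e.hom T).IsSplitSubtorus :=
  ⟨hT.1.comap _, hT.2.of_iso (comapIso' e T).symm⟩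

theorem IsParabolic.comap_iso {P : SubgroupFunctor G} (hP : P.IsParabolic) (e : H ≅ G) :
    (comap e.hom P).IsParabolic := by
  obtain ⟨hc, hs, B, hB, hBP⟩ := hP
  refine ⟨hc.comap _, hs.of_iso (comapIso' e P).symm,
    comap (baseChangeIso e (AlgebraicClosure k)).hom B, hB.comap_iso _, ?_⟩
  exact comap_mono (baseChangeIso e (AlgebraicClosure k)).hom hBP

end

end SubgroupFunctor

theorem Subgroup.IsComplement'.comap_of_bijective {G H : Type*} [Group G] [Group H]
    {M U : Subgroup G}
    (h : Subgroup.IsComplement' M U) (f : H →* G) (hf : Function.Bijective f) :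
    Subgroup.IsComplement' (M.comap f) (U.comap f) := by
  refine Subgroup.isComplement'_of_disjoint_and_mul_eq_univ ?_ ?_
  · rw [Subgroup.disjoint_def]
    intro x hx hy
    have := Subgroup.disjoint_def.mp h.disjoint hx hy
    exact (map_eq_one_iff f hf.1).mp this
  · rw [Set.eq_univ_iff_forall]
    intro x
    obtain ⟨⟨m, u⟩, hmu⟩ := h.2 (f x)
    obtain ⟨m', hm⟩ := hf.2 m
    obtain ⟨u', hu⟩ := hf.2 u
    refine ⟨m', ?_, u', ?_, ?_⟩
    · simp [hm]
    · simp [hu]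
    · apply hf.1
      simpa [hm, hu] using hmu

namespace SubgroupFunctor

open GroupFunctor

section
variable {k : Type u} [Field k] {G H : GroupFunctor k}

theorem IsLevi.comap_iso {M : SubgroupFunctor G} (hM : M.IsLevi) (e : H ≅ G) :
    (comap e.hom M).IsLevi := by
  obtain ⟨hc, P, hP, hMP, U, hU, hcompl⟩ := hM
  let i := baseChangeIso (comapIso' e P) (AlgebraicClosure k)
  refine ⟨hc.comap _, comap e.hom P, hP.comap_iso e, comap_mono _ hMP, comap i.hom U,
    hU.comap_iso i, fun A => ?_⟩
  exact (hcompl A).comap_of_bijective (i.hom.app A).hom (iso_hom_bijective i A)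

end

end SubgroupFunctor

theorem GroupFunctor.IsSplit.of_iso {k : Type u} [Field k] {G H : GroupFunctor k}
    (hG : G.IsSplit) (e : H ≅ G) : H.IsSplit := by
  obtain ⟨T, hT, hmax⟩ := hG
  refine ⟨SubgroupFunctor.comap e.hom T, hT.comap_iso e, ?_⟩
  exact SubgroupFunctor.maximal_comap (baseChangeIso e (AlgebraicClosure k))
    (fun _ h => h.comap_iso _) (fun _ h => h.comap_iso (baseChangeIso e (AlgebraicClosure k)).symm)
    hmax

/-! ### Matrix groups cut out by linear equations -/

/-- The general linear group `A ↦ GL_ι(A)` in terms of matrices. -/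
def glFunctor (k : Type u) [CommRing k] (ι : Type) [Fintype ι] [DecidableEq ι] :
    GroupFunctor k where
  obj A := GrpCat.of (Matrix.GeneralLinearGroup ι A)
  map f := GrpCat.ofHom (Matrix.GeneralLinearGroup.map f.hom.toRingHom)
  map_id _ := GrpCat.hom_ext (MonoidHom.ext fun _ => Units.ext rfl)
  map_comp _ _ := GrpCat.hom_ext (MonoidHom.ext fun _ => Units.ext rfl)

section LinearFunctional

variable {k : Type u} [Field k] {ι : Type} [Fintype ι] [DecidableEq ι]

/-- The matrix underlying a point of `glFunctor`. -/
def glMat {A : CommAlgCat.{u} k} (g : (glFunctor k ι).obj A) : Matrix ι ι A :=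
  (show Matrix.GeneralLinearGroup ι A from g).1

theorem glMat_injective {A : CommAlgCat.{u} k} :
    Function.Injective (glMat : (glFunctor k ι).obj A → Matrix ι ι A) :=
  fun _ _ h => Units.ext h

@[simp] theorem glMat_one {A : CommAlgCat.{u} k} :
    glMat (1 : (glFunctor k ι).obj A) = 1 := rfl

@[simp] theorem glMat_mul {A : CommAlgCat.{u} k} (g h : (glFunctor k ι).obj A) :
    glMat (g * h) = glMat g * glMat h := rfl

@[simp] theorem glMat_map {A B : CommAlgCat.{u} k} (f : A ⟶ B) (g : (glFunctor k ι).obj A)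
    (i j : ι) : glMat ((glFunctor k ι).map f g) i j = f.hom (glMat g i j) := rfl

theorem glMat_mul_inv {A : CommAlgCat.{u} k} (g : (glFunctor k ι).obj A) :
    glMat g * glMat g⁻¹ = 1 := by rw [← glMat_mul, mul_inv_cancel, glMat_one]

theorem glMat_inv_mul {A : CommAlgCat.{u} k} (g : (glFunctor k ι).obj A) :
    glMat g⁻¹ * glMat g = 1 := by rw [← glMat_mul, inv_mul_cancel, glMat_one]

/-- A point of `glFunctor` from a matrix with unit determinant. -/
def glMk {A : CommAlgCat.{u} k} (M : Matrix ι ι A) (h : IsUnit M.det) :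
    (glFunctor k ι).obj A := Matrix.GeneralLinearGroup.mk'' M h

@[simp] theorem glMat_glMk {A : CommAlgCat.{u} k} (M : Matrix ι ι A) (h : IsUnit M.det) :
    glMat (k := k) (glMk M h) = M := rfl

theorem isUnit_det_glMat {A : CommAlgCat.{u} k} (g : (glFunctor k ι).obj A) :
    IsUnit (glMat g).det := by
  refine IsUnit.of_mul_eq_one (glMat g⁻¹).det ?_
  rw [← Matrix.det_mul, glMat_mul_inv, Matrix.det_one]

/-- The `A`-linear extension to `Matrix ι ι A` of a linear functional on `Matrix ι ι k`. -/
def functionalExt (A : Type u) [CommRing A] [Algebra k A] :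
    Module.Dual k (Matrix ι ι k) →ₗ[k] Matrix ι ι A →ₗ[A] A where
  toFun f :=
    { toFun := fun Y => ∑ i, ∑ j, algebraMap k A (f (Matrix.single i j 1)) * Y i j
      map_add' := fun X Y => by simp [mul_add, Finset.sum_add_distrib]
      map_smul' := fun a X => by
        simp only [Matrix.smul_apply, smul_eq_mul, RingHom.id_apply, Finset.mul_sum]
        exact Finset.sum_congr rfl fun _ _ => Finset.sum_congr rfl fun _ _ => by ring }
  map_add' f g := by
    ext Y
    simp [add_mul, Finset.sum_add_distrib]
  map_smul' c f := by
    ext Y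
    simp [Algebra.smul_def, mul_assoc, Finset.mul_sum]

theorem functionalExt_apply {A : Type u} [CommRing A] [Algebra k A]
    (f : Module.Dual k (Matrix ι ι k)) (Y : Matrix ι ι A) :
    functionalExt A f Y = ∑ i, ∑ j, algebraMap k A (f (Matrix.single i j 1)) * Y i j := rfl

theorem functionalExt_map {A : Type u} [CommRing A] [Algebra k A]
    (f : Module.Dual k (Matrix ι ι k)) (X : Matrix ι ι k) :
    functionalExt A f (X.map (algebraMap k A)) = algebraMap k A (f X) := by
  conv_rhs => rw [Matrix.matrix_eq_sum_single X]
  simp only [functionalExt_apply, map_sum, Matrix.map_apply]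
  refine Finset.sum_congr rfl fun i _ => Finset.sum_congr rfl fun j _ => ?_
  have : Matrix.single i j (X i j) = X i j • Matrix.single i j (1 : k) := by simp
  rw [this, map_smul, smul_eq_mul, map_mul, mul_comm]

theorem functionalExt_algHom {A B : Type u} [CommRing A] [Algebra k A] [CommRing B] [Algebra k B]
    (φ : A →ₐ[k] B) (f : Module.Dual k (Matrix ι ι k)) (Y : Matrix ι ι A) :
    functionalExt B f (Y.map φ) = φ (functionalExt A f Y) := by
  simp [functionalExt_apply, map_sum]

theorem functionalExt_entry {A : Type u} [CommRing A] [Algebra k A] (i j : ι) (Y : Matrix ι ι A) :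
    functionalExt A (Matrix.entryLinearMap k k i j) Y = Y i j := by
  rw [functionalExt_apply, Finset.sum_eq_single i, Finset.sum_eq_single j]
  · simp
  · intro b _ hb
    simp [hb]
  · simp
  · intro b _ hb
    simp [hb]
  · simp

end LinearFunctional

namespace SubgroupFunctor

open GroupFunctor

variable {k : Type u} [Field k] {ι : Type} [Fintype ι] [DecidableEq ι]

/-- A subgroup functor of the general linear group is linear if it is the set of invertible
matrices `g` such that `g - 1` satisfies a set of homogeneous linear equations with coefficients
in the ground field. -/
def IsLinear (S : SubgroupFunctor (glFunctor k ι)) : Prop :=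
  ∃ s : Set (Module.Dual k (Matrix ι ι k)), ∀ (A : CommAlgCat.{u} k) (g : (glFunctor k ι).obj A),
    g ∈ S.obj A ↔ ∀ f ∈ s, functionalExt A f (glMat g - 1) = 0

theorem IsLinear.isClosed {S : SubgroupFunctor (glFunctor k ι)} (hS : S.IsLinear) :
    S.IsClosed := by
  obtain ⟨s, hs⟩ := hS
  intro A g
  refine ⟨Ideal.span ((fun f : Module.Dual k (Matrix ι ι k) => functionalExt A f (glMat g - 1)) '' s),
    fun B φ => ?_⟩
  have key : ∀ f : Module.Dual k (Matrix ι ι k),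
      functionalExt B f (glMat ((glFunctor k ι).map φ g) - 1) =
      φ.hom (functionalExt A f (glMat g - 1)) := by
    intro f
    rw [← functionalExt_algHom]
    congr 1
    ext i j
    by_cases h : i = j <;> simp [h]
  rw [hs]
  constructor
  · intro h a ha
    have : Ideal.span
        ((fun f : Module.Dual k (Matrix ι ι k) => functionalExt A f (glMat g - 1)) '' s) ≤
        RingHom.ker φ.hom.toRingHom := by
      rw [Ideal.span_le]
      rintro _ ⟨f, hf, rfl⟩
      exact (key f).symm.trans (h f hf)
    exact this ha
  · intro h f hf
    rw [key]
    exact h _ (Ideal.subset_span ⟨f, hf, rfl⟩)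

/-- A solution space of homogeneous linear equations over a field has a basis that remains a basis
of the solution space after any extension of scalars. -/
theorem exists_solution_basis (s : Set (Module.Dual k (Matrix ι ι k))) :
    ∃ (m : ℕ) (d : Fin m → Matrix ι ι k) (c : Fin m → Module.Dual k (Matrix ι ι k)),
      (∀ l l', c l (d l') = if l = l' then 1 else 0) ∧
      (∀ f ∈ s, ∀ l, f (d l) = 0) ∧
      ∀ (A : Type u) [CommRing A] [Algebra k A] (Y : Matrix ι ι A),
        (∀ f ∈ s, functionalExt A f Y = 0) →
          Y = ∑ l, functionalExt A (c l) Y • (d l).map (algebraMap k A) := by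
  let W : Submodule k (Module.Dual k (Matrix ι ι k)) := Submodule.span k s
  let D := W.dualCoannihilator
  obtain ⟨p, hp'⟩ := D.subtype.exists_leftInverse_of_injective D.ker_subtype
  have hp : ∀ X : D, p X = X := fun X => LinearMap.congr_fun hp' X
  let β := Module.finBasis k D
  refine ⟨_, fun l => (β l : Matrix ι ι k), fun l => β.coord l ∘ₗ p, ?_, ?_, ?_⟩
  · intro l l'
    simp [hp, Finsupp.single_apply, eq_comm]
  · intro f hf l
    exact (Submodule.mem_dualCoannihilator _).mp (β l).2 f (Submodule.subset_span hf)
  · intro A _ _ Y hY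
    have hW : ∀ f ∈ W, functionalExt A f Y = 0 := by
      intro f hf
      induction hf using Submodule.span_induction with
      | mem f hf => exact hY f hf
      | zero => simp
      | add f g _ _ hf hg => simp [hf, hg]
      | smul a f _ hf => simp [hf]
    ext i j
    -- the functional `X ↦ X i j - ∑ l, c l X * d l i j` vanishes on all solutions
    let f : Module.Dual k (Matrix ι ι k) := Matrix.entryLinearMap k k i j -
      ∑ l, (β l : Matrix ι ι k) i j • (β.coord l ∘ₗ p)
    have hf : f ∈ W := by
      rw [← Subspace.dualCoannihilator_dualAnnihilator_eq (W := W), Submodule.mem_dualAnnihilator]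
      intro X hX
      have h1 := congrArg (fun Z : D => (Z : Matrix ι ι k) i j) (β.sum_repr ⟨X, hX⟩)
      simp only [Submodule.coe_sum, Submodule.coe_smul, Matrix.sum_apply, Matrix.smul_apply,
        smul_eq_mul] at h1
      simp only [f, LinearMap.sub_apply, LinearMap.sum_apply, LinearMap.smul_apply,
        LinearMap.comp_apply, Matrix.entryLinearMap_apply, smul_eq_mul, Module.Basis.coord_apply]
      rw [hp ⟨X, hX⟩, sub_eq_zero]
      exact h1.symm.trans (Finset.sum_congr rfl fun l _ => mul_comm _ _)
    have h2 := hW f hf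
    simp only [f, map_sub, map_sum, map_smul, LinearMap.sub_apply, LinearMap.sum_apply,
      LinearMap.smul_apply, functionalExt_entry, sub_eq_zero] at h2
    rw [h2, Matrix.sum_apply]
    exact Finset.sum_congr rfl fun l _ => by
      rw [Matrix.smul_apply, Matrix.map_apply, Algebra.smul_def, smul_eq_mul, mul_comm]

theorem IsLinear.isSmoothConnected {S : SubgroupFunctor (glFunctor k ι)} (hS : S.IsLinear) :
    S.toFunctor.IsSmoothConnected := by
  obtain ⟨s, hs⟩ := hS
  obtain ⟨m, d, c, hcd, hsd, hd⟩ := exists_solution_basis s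
  let M : ∀ (A : Type u) [CommRing A] [Algebra k A] (y : Fin m → A), Matrix ι ι A :=
    fun A _ _ y => 1 + ∑ l, y l • (d l).map (algebraMap k A)
  have hMap : ∀ {A B : Type u} [CommRing A] [Algebra k A] [CommRing B] [Algebra k B]
      (φ : A →ₐ[k] B) (y : Fin m → A), (M A y).map φ = M B (φ ∘ y) := by
    intro A B _ _ _ _ φ y
    ext i j
    by_cases h : i = j <;> simp [M, h, Matrix.sum_apply]
  have hMs : ∀ {A : Type u} [CommRing A] [Algebra k A] (y : Fin m → A), ∀ f ∈ s,
      functionalExt A f (M A y - 1) = 0 := by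
    intro A _ _ y f hf
    simp only [M, add_sub_cancel_left, map_sum, map_smul, functionalExt_map, hsd f hf, map_zero,
      smul_zero, Finset.sum_const_zero]
  have hMc : ∀ {A : Type u} [CommRing A] [Algebra k A] (y : Fin m → A) (l),
      functionalExt A (c l) (M A y - 1) = y l := by
    intro A _ _ y l
    simp only [M, add_sub_cancel_left, map_sum, map_smul, functionalExt_map, hcd]
    simp
  have hM : ∀ {A : CommAlgCat.{u} k} (g : (glFunctor k ι).obj A), g ∈ S.obj A →
      glMat g = M A fun l => functionalExt A (c l) (glMat g - 1) := by
    intro A g hg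
    have := hd A _ ((hs A g).mp hg)
    simp only [M]
    rw [← this]
    abel
  let P := MvPolynomial (Fin m) k
  let δ : P := (M P MvPolynomial.X).det
  have hδ : δ ≠ 0 := by
    intro h
    have h2 : (MvPolynomial.aeval (fun _ => (0 : k)) : P →ₐ[k] k) δ = 1 := by
      simp only [δ]
      rw [AlgHom.map_det, AlgHom.mapMatrix_apply, hMap]
      have : (M k ((MvPolynomial.aeval (fun _ => (0 : k)) : P →ₐ[k] k) ∘ MvPolynomial.X)) = 1 := by
        simp [M]
      rw [this, Matrix.det_one]
    rw [h, map_zero] at h2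
    exact zero_ne_one h2
  let R := Localization.Away δ
  have : IsDomain R :=
    IsLocalization.isDomain_localization (powers_le_nonZeroDivisors_of_noZeroDivisors hδ)
  have : Algebra.Smooth k P := ⟨inferInstance, inferInstance⟩
  have : Algebra.Smooth P R := Algebra.Smooth.of_isLocalization_Away δ
  have : Algebra.Smooth k R := Algebra.Smooth.comp k P R
  let y₀ : Fin m → R := fun l => algebraMap P R (MvPolynomial.X l)
  have hy₀ : (M R y₀) = (M P MvPolynomial.X).map (IsScalarTower.toAlgHom k P R) := by
    rw [hMap]; rfl
  have hunit : IsUnit (M R y₀).det := by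
    have h1 : (M R y₀).det = algebraMap P R δ := by
      rw [hy₀, ← AlgHom.mapMatrix_apply, ← AlgHom.map_det]; rfl
    rw [h1]
    exact IsLocalization.Away.algebraMap_isUnit δ
  let RC : CommAlgCat.{u} k := CommAlgCat.of k R
  let x : S.toFunctor.obj RC := ⟨glMk (A := RC) (M R y₀) hunit, (hs RC _).mpr (hMs y₀)⟩
  have hx : ∀ {A : CommAlgCat.{u} k} (f : RC ⟶ A), glMat (S.toFunctor.map f x).1 =
      M A (f.hom ∘ y₀) := fun f => hMap f.hom y₀
  refine ⟨RC, ‹_›, inferInstance, isRepresentedBy_of_universal x fun A => ⟨?_, ?_⟩⟩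
  · intro f f' hff
    have h1 : M A (f.hom ∘ y₀) = M A (f'.hom ∘ y₀) := by
      rw [← hx, ← hx]; exact congrArg (fun z => glMat z.1) hff
    have h2 : f.hom ∘ y₀ = f'.hom ∘ y₀ := by
      funext l
      rw [← hMc (f.hom ∘ y₀), h1, hMc]
    refine CommAlgCat.hom_ext ?_
    refine IsLocalization.algHom_ext (R := k) (A := P) (Submonoid.powers δ) ?_
    refine MvPolynomial.algHom_ext fun l => ?_
    exact congrFun h2 l
  · rintro ⟨g, hg⟩
    let y : Fin m → A := fun l => functionalExt A (c l) (glMat g - 1)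
    have hgy : glMat g = M A y := hM g hg
    let φ : P →ₐ[k] A := MvPolynomial.aeval y
    have hφ : φ δ = (glMat g).det := by
      simp only [δ]
      rw [AlgHom.map_det, AlgHom.mapMatrix_apply, hMap, hgy]
      congr 2
      funext l
      exact MvPolynomial.aeval_X y l
    have hu : ∀ z : Submonoid.powers δ, IsUnit (φ z) := by
      rintro ⟨_, n, rfl⟩
      simp only [map_pow, hφ]
      exact (isUnit_det_glMat g).pow n
    let ψ : R →ₐ[k] A := IsLocalization.liftAlgHom (M := Submonoid.powers δ) hu
    refine ⟨CommAlgCat.ofHom ψ, Subtype.ext (glMat_injective ?_)⟩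
    refine (hx (CommAlgCat.ofHom ψ)).trans ?_
    rw [hgy]
    congr 1
    funext l
    have : ψ (algebraMap P R (MvPolynomial.X l)) = φ (MvPolynomial.X l) :=
      IsLocalization.lift_eq _ _
    exact this.trans (MvPolynomial.aeval_X y l)

end SubgroupFunctor

/-! ### Smooth algebras over a field are reduced -/

/-- If `s` is nilpotent, then `s ⊗ X` is integral over `S`, but it only lies in
`S ⊗ k = S ⊗ (integral closure of k in k[X])` if `s = 0`. -/
theorem Algebra.Smooth.isReduced (k S : Type u) [Field k] [CommRing S] [Algebra k S]
    [Algebra.Smooth k S] : IsReduced S := by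
  refine ⟨fun s hs => ?_⟩
  have hint : IsIntegral S (s ⊗ₜ[k] (Polynomial.X : Polynomial k)) := by
    obtain ⟨n, hn⟩ := hs
    refine IsIntegral.of_pow (n := n + 1) n.succ_pos ?_
    rw [Algebra.TensorProduct.tmul_pow, pow_succ, hn, zero_mul, zero_tmul]
    exact isIntegral_zero
  obtain ⟨y, hy⟩ := (TensorProduct.toIntegralClosure_bijective_of_smooth (R := k) (S := S)
    (B := Polynomial k)).2 ⟨_, hint⟩
  have hy' : (Algebra.TensorProduct.map (AlgHom.id S S) (integralClosure k (Polynomial k)).val) y =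
      s ⊗ₜ[k] (Polynomial.X : Polynomial k) := congrArg Subtype.val hy
  -- the coefficient of `X`, as a linear map
  let φ : S ⊗[k] Polynomial k →ₗ[k] S :=
    (_root_.TensorProduct.rid k S).toLinearMap ∘ₗ (Polynomial.lcoeff k 1).lTensor S
  have h0 : ∀ z, φ (Algebra.TensorProduct.map (AlgHom.id S S)
      (integralClosure k (Polynomial k)).val z) = 0 := by
    intro z
    induction z with
    | zero => simp
    | add a b ha hb => rw [map_add, map_add, ha, hb, add_zero]
    | tmul a b =>
      have hb : IsIntegral k (b : Polynomial k) := b.2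
      have hC : (b : Polynomial k).natDegree = 0 := by
        by_contra hne
        obtain ⟨p, hp, hpb⟩ := hb
        have hp0 : p.comp (b : Polynomial k) = 0 := by
          rw [Polynomial.comp, ← hpb]
          rfl
        have hdeg : (p.comp (b : Polynomial k)).natDegree =
            p.natDegree * (b : Polynomial k).natDegree :=
          Polynomial.natDegree_comp
        rw [hp0, Polynomial.natDegree_zero] at hdeg
        have hpn : p.natDegree = 0 := by
          rcases Nat.mul_eq_zero.mp hdeg.symm with h | h
          · exact h
          · exact absurd h hne
        have hp1 : p = 1 := hp.natDegree_eq_zero.mp hpn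
        rw [hp1] at hp0
        simp at hp0
      have : (b : Polynomial k).coeff 1 = 0 :=
        Polynomial.coeff_eq_zero_of_natDegree_lt (by omega)
      simp [φ, this]
  have := h0 y
  rw [hy'] at this
  simpa [φ] using this

/-! ### Coordinates on the automorphism group of a vector space -/

theorem basis_repr_rTensor {k : Type u} [Field k] {ι : Type} {V : Type u} [AddCommGroup V]
    [Module k V] (b : Module.Basis ι k V) {A B : Type u} [CommRing A] [Algebra k A]
    [CommRing B] [Algebra k B] (f : A →ₐ[k] B) (x : A ⊗[k] V) (i : ι) :
    (Algebra.TensorProduct.basis B b).repr (f.toLinearMap.rTensor V x) i =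
      f ((Algebra.TensorProduct.basis A b).repr x i) := by
  induction x with
  | zero => simp
  | add x y hx hy => simp [hx, hy]
  | tmul a v => simp

section AutGl

variable {k : Type u} [Field k] {ι : Type} [Fintype ι] [DecidableEq ι]
  {V : Type u} [AddCommGroup V] [Module k V]

/-- The matrices of automorphisms with respect to a basis. -/
def autToGl (b : Module.Basis ι k V) : autFunctor k V ⟶ glFunctor k ι where
  app A := GrpCat.ofHom (Units.map
    (LinearMap.toMatrixAlgEquiv (Algebra.TensorProduct.basis A b) : _ →* Matrix ι ι A))
  naturality {A B} f := by
    refine GrpCat.hom_ext (MonoidHom.ext fun g => Units.ext (Matrix.ext fun i j => ?_))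
    have h := endBaseChange_rTensor f.hom g.1 (1 ⊗ₜ b j)
    have h1 : (f.hom.toLinearMap.rTensor V) ((1 : A) ⊗ₜ[k] b j) = (1 : B) ⊗ₜ b j := by simp
    rw [h1] at h
    refine (LinearMap.toMatrixAlgEquiv_apply _ _ _ _).trans ?_
    rw [Algebra.TensorProduct.basis_apply]
    refine (congrArg (fun z => (Algebra.TensorProduct.basis B b).repr z i) h).trans ?_
    rw [basis_repr_rTensor]
    refine congrArg f.hom (Eq.trans ?_ (LinearMap.toMatrixAlgEquiv_apply _ _ _ _).symm)
    rw [Algebra.TensorProduct.basis_apply]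

theorem autToGl_bijective (b : Module.Basis ι k V) (A : CommAlgCat.{u} k) :
    Function.Bijective ((autToGl b).app A) :=
  (Units.mapEquiv (LinearMap.toMatrixAlgEquiv
    (Algebra.TensorProduct.basis A b)).toMulEquiv).bijective

/-- A basis identifies the automorphism group functor with a general linear group. -/
def autGlIso (b : Module.Basis ι k V) : autFunctor k V ≅ glFunctor k ι :=
  GroupFunctor.isoOfBijective (autToGl b) (autToGl_bijective b)

theorem glMat_autToGl (b : Module.Basis ι k V) (A : CommAlgCat.{u} k)
    (g : (autFunctor k V).obj A) : glMat ((autToGl b).app A g) =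
      LinearMap.toMatrixAlgEquiv (Algebra.TensorProduct.basis A b)
        (show LinearMap.GeneralLinearGroup A (A ⊗[k] V) from g).1 := rfl

theorem autToGl_fixes_iff (b : Module.Basis ι k V) (A : CommAlgCat.{u} k)
    (g : (autFunctor k V).obj A) (v : V) :
    (show LinearMap.GeneralLinearGroup A (A ⊗[k] V) from g).1 ((1 : A) ⊗ₜ[k] v) =
      (1 : A) ⊗ₜ[k] v ↔
    (glMat ((autToGl b).app A g)).mulVec (fun i => algebraMap k A (b.repr v i)) =
      fun i => algebraMap k A (b.repr v i) := by
  have h1 : ∀ v : V, (fun i => algebraMap k A (b.repr v i)) =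
      ⇑((Algebra.TensorProduct.basis A b).repr ((1 : A) ⊗ₜ[k] v)) := by
    intro v
    funext i
    simp
  rw [h1, glMat_autToGl]
  have h2 := LinearMap.toMatrix_mulVec_repr (Algebra.TensorProduct.basis A b)
    (Algebra.TensorProduct.basis A b)
    (show LinearMap.GeneralLinearGroup A (A ⊗[k] V) from g).1 ((1 : A) ⊗ₜ[k] v)
  constructor
  · intro h
    rw [h] at h2
    exact h2
  · intro h
    apply (Algebra.TensorProduct.basis A b).repr.injective
    exact DFunLike.coe_injective (h2.symm.trans h)

end AutGl

/-! ### Unipotent groups -/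

namespace GroupFunctor

variable {k : Type u} [Field k]

theorem IsUnipotent.exists_fixed {U : GroupFunctor k} (hU : U.IsUnipotent) {κ : Type} [Fintype κ]
    [DecidableEq κ] [Nonempty κ] (ρ : U ⟶ glFunctor k κ) :
    ∃ w : κ → k, w ≠ 0 ∧ ∀ (A : CommAlgCat.{u} k) (g : U.obj A),
      (glMat (ρ.app A g)).mulVec (fun i => algebraMap k A (w i)) =
        fun i => algebraMap k A (w i) := by
  let b := Pi.basisFun k κ
  obtain ⟨w, hw, h⟩ := hU (κ → k) (ρ ≫ (autGlIso b).inv)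
  refine ⟨w, hw, fun A g => ?_⟩
  have h1 := (autToGl_fixes_iff b A _ w).mp (h A g)
  have h2 : (autToGl b).app A ((ρ ≫ (autGlIso b).inv).app A g) = ρ.app A g :=
    iso_inv_hom_apply (autGlIso b) A (ρ.app A g)
  rw [h2] at h1
  simpa [b] using h1

theorem isUnipotent_of_exists_fixed {U : GroupFunctor k}
    (h : ∀ (κ : Type) [Fintype κ] [DecidableEq κ] [Nonempty κ] (ρ : U ⟶ glFunctor k κ),
      ∃ w : κ → k, w ≠ 0 ∧ ∀ (A : CommAlgCat.{u} k) (g : U.obj A),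
        (glMat (ρ.app A g)).mulVec (fun i => algebraMap k A (w i)) =
          fun i => algebraMap k A (w i)) : U.IsUnipotent := by
  intro W _ _ _ _ ρ
  let b := Module.finBasis k W
  have : Nonempty (Fin (Module.finrank k W)) := ⟨⟨0, Module.finrank_pos⟩⟩
  obtain ⟨w, hw, hfix⟩ := h _ (ρ ≫ autToGl b)
  refine ⟨b.equivFun.symm w, (map_ne_zero_iff _ b.equivFun.symm.injective).mpr hw, fun A g => ?_⟩
  rw [autToGl_fixes_iff b]
  have : ∀ i, b.repr (b.equivFun.symm w) i = w i := fun i => by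
    rw [← Module.Basis.equivFun_apply, LinearEquiv.apply_symm_apply]
  simp only [this]
  exact hfix A g

end GroupFunctor

namespace SubgroupFunctor

open GroupFunctor

variable {k : Type u} [Field k]

/-- A normal unipotent subgroup acts trivially in every representation whose image contains all
rational points of the general linear group, because its fixed vectors form an invariant
subspace. -/
theorem IsNormal.map_eq_one_of_isUnipotent {G : GroupFunctor k} {U : SubgroupFunctor G}
    (hn : U.IsNormal) (hu : U.toFunctor.IsUnipotent) {κ : Type} [Fintype κ] [DecidableEq κ]
    (ρ : G ⟶ glFunctor k κ) (hρ : Function.Surjective (ρ.app (CommAlgCat.of k k)))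
    (A : CommAlgCat.{u} k) {g : G.obj A} (hg : g ∈ U.obj A) : ρ.app A g = 1 := by
  cases isEmpty_or_nonempty κ with
  | inl h => exact glMat_injective (Subsingleton.elim _ _)
  | inr h =>
    obtain ⟨w, hw, hfix⟩ := hu.exists_fixed (U.subtype ≫ ρ)
    -- the rational vectors fixed by `U`; they are stable under `GL(k)`, because `U` is normal
    let P : (κ → k) → Prop := fun v =>
      ∀ g ∈ U.obj A, (glMat (ρ.app A g)).mulVec (fun i => algebraMap k A (v i)) =
        fun i => algebraMap k A (v i)
    have hadd : ∀ (v v' : κ → k) (c : k), P v → P v' → P (v + c • v') := by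
      intro v v' c hv hv' g hg
      have h1 : (fun i => algebraMap k A ((v + c • v') i)) =
          (fun i => algebraMap k A (v i)) + algebraMap k A c • fun i => algebraMap k A (v' i) := by
        funext i
        simp [Algebra.smul_def]
      rw [h1, Matrix.mulVec_add, Matrix.mulVec_smul, hv g hg, hv' g hg]
    have hgl : ∀ (M : (glFunctor k κ).obj (CommAlgCat.of k k)) (v : κ → k), P v →
        P ((glMat M).mulVec v) := by
      intro M v hv g hg
      obtain ⟨h, hh⟩ := hρ M
      let ι₀ : CommAlgCat.of k k ⟶ A := CommAlgCat.ofHom (Algebra.ofId k A)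
      let hA : G.obj A := G.map ι₀ h
      have hconj : hA⁻¹ * g * hA ∈ U.obj A := by
        simpa using (hn A).conj_mem g hg hA⁻¹
      have h2 : glMat (ρ.app A hA) = (glMat M).map (algebraMap k A) := by
        rw [← hh]
        ext i j
        rw [map_app_apply]
        rfl
      have h3 : (glMat (ρ.app A hA)).mulVec (fun i => algebraMap k A (v i)) =
          fun i => algebraMap k A ((glMat M).mulVec v i) := by
        rw [h2]
        funext i
        exact (RingHom.map_mulVec (algebraMap k A) (glMat M) v i).symm
      have h4 : ρ.app A (hA⁻¹ * g * hA) = (ρ.app A hA)⁻¹ * ρ.app A g * ρ.app A hA := by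
        simp
      have h1 := hv _ hconj
      rw [h4, glMat_mul, glMat_mul, ← Matrix.mulVec_mulVec, ← Matrix.mulVec_mulVec, h3] at h1
      have h5 := congrArg (fun z => (glMat (ρ.app A hA)).mulVec z) h1
      simp only [Matrix.mulVec_mulVec, ← glMat_mul, ← mul_assoc, mul_inv_cancel, one_mul] at h5
      rw [h5, h3]
    have hzero : P 0 := fun g _ => by
      have h1 : (fun i => algebraMap k A ((0 : κ → k) i)) = 0 := by
        funext i
        simp
      rw [h1, Matrix.mulVec_zero]
    have hw' : P w := fun g hg => hfix A ⟨g, hg⟩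
    obtain ⟨i, hi⟩ := Function.ne_iff.mp hw
    -- subtracting `w` from its image under a transvection gives a multiple of a basis vector
    have hne : ∀ j, j ≠ i → P (Pi.single j 1) := by
      intro j hj
      have hdet : IsUnit (Matrix.transvection j i (1 : k)).det := by
        rw [Matrix.det_transvection_of_ne _ _ hj]
        exact isUnit_one
      have h1 := hgl (glMk (A := CommAlgCat.of k k) (Matrix.transvection j i (1 : k)) hdet) w hw'
      have h2 := hadd 0 _ (w i)⁻¹ hzero (hadd _ _ (-1) h1 hw')
      have h3 : 0 + (w i)⁻¹ • ((glMat (glMk (A := CommAlgCat.of k k)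
          (Matrix.transvection j i (1 : k)) hdet)).mulVec w + (-1 : k) • w) = Pi.single j 1 := by
        rw [glMat_glMk, Matrix.transvection, Matrix.add_mulVec, Matrix.one_mulVec,
          Matrix.single_mulVec]
        funext l
        by_cases h : l = j
        · subst h
          simpa using inv_mul_cancel₀ hi
        · simp [h]
      rwa [h3] at h2
    have hall : ∀ j, P (Pi.single j 1) := by
      intro j
      by_cases hj : j = i
      · subst hj
        have hsum : ∀ s : Finset κ, j ∉ s → P (w + ∑ l ∈ s, (-w l) • Pi.single l 1) := by
          intro s
          induction s using Finset.induction_on with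
          | empty => simpa using hw'
          | insert a s ha ih =>
            intro hjs
            rw [Finset.mem_insert, not_or] at hjs
            rw [Finset.sum_insert ha, add_comm ((-w a) • _), ← add_assoc]
            exact hadd _ _ _ (ih hjs.2) (hne a (Ne.symm hjs.1))
        have h1 := hadd 0 _ (w j)⁻¹ hzero (hsum (Finset.univ.erase j) (by simp))
        have h2 : 0 + (w j)⁻¹ • (w + ∑ l ∈ Finset.univ.erase j, (-w l) • Pi.single l (1 : k)) =
            Pi.single j 1 := by
          funext l
          by_cases h : l = j
          · subst h
            simpa [Finset.sum_apply, Pi.single_apply] using inv_mul_cancel₀ hi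
          · simp [Finset.sum_apply, Pi.single_apply, h]
        rwa [h2] at h1
      · exact hne j hj
    have key := fun j => hall j g hg
    apply glMat_injective
    ext i j
    have h1 := congrFun (key j) i
    have h2 : (fun i => algebraMap k A ((Pi.single j 1 : κ → k) i)) = Pi.single j 1 := by
      funext l
      by_cases h : l = j
      · subst h; simp
      · simp [h]
    rw [h2, Matrix.mulVec_single_one] at h1
    rw [glMat_one, Matrix.one_apply]
    refine h1.trans ?_
    by_cases h : i = j
    · subst h; simp
    · simp [h]

end SubgroupFunctor

/-! ### Contractions of group functors -/

namespace GroupFunctor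

variable {k : Type u} [Field k]

/-- A contraction of a group functor to its identity element: a natural action of the
multiplicative monoid of `A` on the group of `A`-points by endomorphisms, in which `0` acts as the
trivial endomorphism. -/
structure Contraction (U : GroupFunctor k) where
  /-- the action of the multiplicative monoid -/
  act : ∀ {A : CommAlgCat.{u} k}, A → U.obj A → U.obj A
  act_mul_right : ∀ {A : CommAlgCat.{u} k} (a : A) (g h : U.obj A),
    act a (g * h) = act a g * act a h
  map_act : ∀ {A B : CommAlgCat.{u} k} (f : A ⟶ B) (a : A) (g : U.obj A),
    U.map f (act a g) = act (f.hom a) (U.map f g)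
  act_one : ∀ {A : CommAlgCat.{u} k} (g : U.obj A), act 1 g = g
  act_zero : ∀ {A : CommAlgCat.{u} k} (g : U.obj A), act 0 g = 1
  act_act : ∀ {A : CommAlgCat.{u} k} (a b : A) (g : U.obj A), act a (act b g) = act (a * b) g

namespace Contraction

variable {U : GroupFunctor k} (δ : Contraction U) {κ : Type} [Fintype κ] [DecidableEq κ]
  (ρ : U ⟶ glFunctor k κ)

/-- The polynomial ring over `A` as a `k`-algebra. -/
abbrev poly (A : CommAlgCat.{u} k) : CommAlgCat.{u} k := CommAlgCat.of k (Polynomial A)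

/-- The inclusion of constants into the polynomial ring. -/
def polyC (A : CommAlgCat.{u} k) : A ⟶ poly A :=
  CommAlgCat.ofHom ((Polynomial.CAlgHom : A →ₐ[A] Polynomial A).restrictScalars k)

/-- The value of a matrix representation along the contraction, as a matrix of polynomials in the
contraction parameter. -/
def orbit {A : CommAlgCat.{u} k} (g : U.obj A) : Matrix κ κ (Polynomial A) :=
  glMat (ρ.app (poly A) (δ.act (A := poly A) Polynomial.X (U.map (polyC A) g)))

theorem eval₂_orbit {A B : CommAlgCat.{u} k} (f : A ⟶ B) (b : B) (g : U.obj A) (p q : κ) :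
    (δ.orbit ρ g p q).eval₂ (f.hom : A →+* B) b = glMat (ρ.app B (δ.act b (U.map f g))) p q := by
  let φ : poly A ⟶ B := CommAlgCat.ofHom (Polynomial.eval₂AlgHom f.hom b fun _ => mul_comm _ _)
  have h1 : φ.hom (δ.orbit ρ g p q) = (δ.orbit ρ g p q).eval₂ (f.hom : A →+* B) b := rfl
  rw [← h1, orbit, ← glMat_map, ← map_app_apply, δ.map_act]
  have h2 : φ.hom Polynomial.X = b := Polynomial.eval₂_X _ _
  have h3 : polyC A ≫ φ = f := by
    ext a
    exact Polynomial.eval₂_C _ _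
  have h4 : U.map φ (U.map (polyC A) g) = U.map f g := by
    rw [← h3, U.map_comp]
    rfl
  rw [h2, h4]

theorem orbit_map {A B : CommAlgCat.{u} k} (f : A ⟶ B) (g : U.obj A) (p q : κ) :
    δ.orbit ρ (U.map f g) p q = (δ.orbit ρ g p q).map (f.hom : A →+* B) := by
  have h := δ.eval₂_orbit ρ (f ≫ polyC B) Polynomial.X g p q
  rw [Polynomial.map, orbit]
  refine Eq.trans ?_ h.symm
  rw [U.map_comp]
  rfl

theorem orbit_mul {A : CommAlgCat.{u} k} (g h : U.obj A) :
    δ.orbit ρ (g * h) = δ.orbit ρ g * δ.orbit ρ h := by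
  simp only [orbit, map_mul, δ.act_mul_right, glMat_mul]

theorem coeff_orbit_act {A : CommAlgCat.{u} k} (a : A) (g : U.obj A) (p q : κ) (n : ℕ) :
    (δ.orbit ρ (δ.act a g) p q).coeff n = (δ.orbit ρ g p q).coeff n * a ^ n := by
  have h := δ.eval₂_orbit ρ (polyC A) (Polynomial.C a * Polynomial.X) g p q
  have h1 : δ.orbit ρ (δ.act a g) p q = (δ.orbit ρ g p q).comp (Polynomial.C a * Polynomial.X) := by
    refine Eq.trans ?_ h.symm
    rw [orbit, δ.map_act, δ.act_act, mul_comm]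
    rfl
  rw [h1, Polynomial.comp_C_mul_X_coeff]

theorem eval_one_orbit {A : CommAlgCat.{u} k} (g : U.obj A) (p q : κ) :
    (δ.orbit ρ g p q).eval 1 = glMat (ρ.app A g) p q := by
  have h := δ.eval₂_orbit ρ (𝟙 A) 1 g p q
  rw [δ.act_one, U.map_id] at h
  exact h

theorem coeff_zero_orbit {A : CommAlgCat.{u} k} (g : U.obj A) (p q : κ) :
    (δ.orbit ρ g p q).coeff 0 = (1 : Matrix κ κ A) p q := by
  have h := δ.eval₂_orbit ρ (𝟙 A) 0 g p q
  rw [δ.act_zero, map_one, glMat_one] at h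
  rw [Polynomial.coeff_zero_eq_eval_zero]
  exact h

/-- The coefficients of top degree `d` of an orbit are killed by all coefficients of positive
degree, as the product would contribute to an orbit a term of degree more than `d`. -/
theorem sum_coeff_mul_coeff_eq_zero {d : ℕ}
    (hd : ∀ (A : CommAlgCat.{u} k) (g : U.obj A) (p q : κ), (δ.orbit ρ g p q).natDegree ≤ d)
    {A : CommAlgCat.{u} k} (g h : U.obj A) {i : ℕ} (hi : i ≠ 0) (p q : κ) :
    ∑ l, (δ.orbit ρ g p l).coeff i * (δ.orbit ρ h l q).coeff d = 0 := by
  let z : U.obj (poly A) :=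
    δ.act (A := poly A) Polynomial.X (U.map (polyC A) g) * U.map (polyC A) h
  have h1 : (δ.orbit ρ z p q).coeff (i + d) = 0 :=
    Polynomial.coeff_eq_zero_of_natDegree_lt
      ((hd _ z p q).trans_lt (Nat.lt_add_of_pos_left (Nat.pos_of_ne_zero hi)))
  have hA : ∀ l n, (δ.orbit ρ (δ.act (A := poly A) Polynomial.X (U.map (polyC A) g)) p l).coeff n =
      Polynomial.C ((δ.orbit ρ g p l).coeff n) * (Polynomial.X : Polynomial A) ^ n := by
    intro l n
    rw [coeff_orbit_act, orbit_map, Polynomial.coeff_map]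
    rfl
  have hB : ∀ l n, (δ.orbit ρ (U.map (polyC A) h) l q).coeff n =
      Polynomial.C ((δ.orbit ρ h l q).coeff n) := by
    intro l n
    rw [orbit_map, Polynomial.coeff_map]
    rfl
  rw [orbit_mul, Matrix.mul_apply, Polynomial.finsetSum_coeff] at h1
  have h2 := congrArg (fun P : Polynomial A => P.coeff i) h1
  simp only [Polynomial.coeff_zero] at h2
  rw [← h2]
  refine Eq.trans ?_ (Polynomial.finsetSum_coeff _ _ _).symm
  refine Finset.sum_congr rfl fun l _ => ?_
  rw [Polynomial.coeff_mul]
  refine Eq.trans ?_ (Polynomial.finsetSum_coeff _ _ _).symm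
  rw [Finset.sum_eq_single (i, d)]
  · rw [hA, hB]
    refine Eq.trans ?_ (Polynomial.coeff_mul_C _ _ _).symm
    rw [Polynomial.coeff_C_mul, Polynomial.coeff_X_pow, if_pos rfl, mul_one]
  · intro x hx hne
    have hxi : i ≠ x.1 := by
      intro hxi
      rw [Finset.HasAntidiagonal.mem_antidiagonal] at hx
      exact hne (Prod.ext hxi.symm (by simp only; omega))
    rw [hA, hB]
    refine (Polynomial.coeff_mul_C _ _ _).trans ?_
    rw [Polynomial.coeff_C_mul, Polynomial.coeff_X_pow, if_neg hxi, mul_zero, zero_mul]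
  · intro hne
    exact absurd (by simp) hne

/-- A representable group functor with a contraction is unipotent: in a representation, the
vectors in the image of the coefficients of top degree along the contraction are fixed. -/
theorem isUnipotent (δ : Contraction U) {R : CommAlgCat.{u} k} (hR : U.IsRepresentedBy R) :
    U.IsUnipotent := by
  refine isUnipotent_of_exists_fixed fun κ _ _ _ ρ => ?_
  obtain ⟨x, hx⟩ := hR.exists_universal
  obtain ⟨d, hd, hd'⟩ : ∃ d, (∀ p q, (δ.orbit ρ x p q).natDegree ≤ d) ∧
      (d ≠ 0 → ∃ p q, (δ.orbit ρ x p q).coeff d ≠ 0) := by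
    obtain ⟨pq, -, hpq⟩ := Finset.exists_max_image Finset.univ
      (fun pq : κ × κ => (δ.orbit ρ x pq.1 pq.2).natDegree) Finset.univ_nonempty
    refine ⟨_, fun p q => hpq (p, q) (Finset.mem_univ _), fun h0 => ⟨pq.1, pq.2, fun h => h0 ?_⟩⟩
    have := Polynomial.leadingCoeff_eq_zero.mp h
    rw [this, Polynomial.natDegree_zero]
  have hdA : ∀ (A : CommAlgCat.{u} k) (g : U.obj A) (p q : κ), (δ.orbit ρ g p q).natDegree ≤ d := by
    intro A g p q
    obtain ⟨f, rfl⟩ := (hx A).2 g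
    simp only
    rw [orbit_map]
    exact Polynomial.natDegree_map_le.trans (hd p q)
  have hsum : ∀ (A : CommAlgCat.{u} k) (g : U.obj A) (p q : κ), glMat (ρ.app A g) p q =
      ∑ i ∈ Finset.range (d + 1), (δ.orbit ρ g p q).coeff i := by
    intro A g p q
    rw [← eval_one_orbit δ, Polynomial.eval_eq_sum_range' (Nat.lt_succ_of_le (hdA A g p q))]
    simp
  by_cases h0 : d = 0
  · refine ⟨fun _ => 1, fun h => one_ne_zero (congrFun h (Classical.arbitrary κ)), fun A g => ?_⟩
    have h1 : glMat (ρ.app A g) = 1 := by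
      ext p q
      rw [hsum, h0, zero_add, Finset.sum_range_one, coeff_zero_orbit]
    rw [h1, Matrix.one_mulVec]
  · obtain ⟨p₀, q, hpq⟩ := hd' h0
    obtain ⟨φ, hφ⟩ : ∃ φ : Module.Dual k R, φ ((δ.orbit ρ x p₀ q).coeff d) ≠ 0 := by
      by_contra hcon
      push Not at hcon
      exact hpq ((Module.forall_dual_apply_eq_zero_iff k _).mp hcon)
    refine ⟨fun l => φ ((δ.orbit ρ x l q).coeff d), fun h => hφ (congrFun h p₀), fun A g => ?_⟩
    let C : CommAlgCat.{u} k := CommAlgCat.of k (A ⊗[k] R)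
    let f₁ : A ⟶ C := CommAlgCat.ofHom Algebra.TensorProduct.includeLeft
    let f₂ : R ⟶ C := CommAlgCat.ofHom Algebra.TensorProduct.includeRight
    let ψ : A ⊗[k] R →ₗ[k] A := (_root_.TensorProduct.rid k A).toLinearMap ∘ₗ φ.lTensor A
    have key : ∀ i, i ≠ 0 → ∀ p, ∑ l, (δ.orbit ρ g p l).coeff i *
        algebraMap k A (φ ((δ.orbit ρ x l q).coeff d)) = 0 := by
      intro i hi p
      have h1 := δ.sum_coeff_mul_coeff_eq_zero ρ hdA (U.map f₁ g) (U.map f₂ x) hi p q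
      simp only [orbit_map, Polynomial.coeff_map] at h1
      have h2 : ∀ l, ((f₁.hom : A →+* C) ((δ.orbit ρ g p l).coeff i) *
          (f₂.hom : R →+* C) ((δ.orbit ρ x l q).coeff d)) =
          (δ.orbit ρ g p l).coeff i ⊗ₜ[k] (δ.orbit ρ x l q).coeff d := by
        intro l
        change (_ ⊗ₜ[k] (1 : R)) * ((1 : A) ⊗ₜ[k] _) = _
        rw [Algebra.TensorProduct.tmul_mul_tmul, one_mul, mul_one]
      simp only [h2] at h1
      have h3 := congrArg ψ h1
      rw [map_zero, map_sum] at h3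
      rw [← h3]
      refine Finset.sum_congr rfl fun l _ => ?_
      simp [ψ, Algebra.smul_def, mul_comm]
    funext p
    simp only [Matrix.mulVec, dotProduct, hsum, Finset.sum_mul]
    rw [Finset.sum_comm, Finset.sum_eq_single 0]
    · simp only [coeff_zero_orbit, Matrix.one_apply, ite_mul, one_mul, zero_mul,
        Finset.sum_ite_eq, Finset.mem_univ, if_true]
    · intro i _ hi
      exact key i hi p
    · simp

end Contraction

end GroupFunctor

/-! ### Pattern subgroups of the general linear group -/

/-- By the Cayley-Hamilton theorem, the inverse of a matrix is a polynomial in the matrix. -/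
theorem Matrix.right_inverse_mem_of_mem {R : Type*} [CommRing R] {n : Type*} [Fintype n]
    [DecidableEq n] {M N : Matrix n n R} (h : M * N = 1) {S : Subalgebra R (Matrix n n R)}
    (hM : M ∈ S) : N ∈ S := by
  have hN : N * M = 1 := mul_eq_one_comm.mp h
  have hdet : IsUnit M.det := Matrix.isUnit_det_of_right_inverse h
  have hc : IsUnit (M.charpoly.coeff 0) := by
    rw [Matrix.det_eq_sign_charpoly_coeff] at hdet
    exact isUnit_of_mul_isUnit_right hdet
  obtain ⟨u, hu⟩ := hc
  have h1 := M.aeval_self_charpoly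
  rw [← Polynomial.divX_mul_X_add M.charpoly, map_add, map_mul, Polynomial.aeval_X,
    Polynomial.aeval_C, ← hu] at h1
  have h2 := congrArg (fun Z => Z * N) h1
  simp only [add_mul, mul_assoc, h, mul_one, zero_mul] at h2
  have h3 : (u : R) • N = -Polynomial.aeval M M.charpoly.divX := by
    rw [Algebra.smul_def]
    exact eq_neg_of_add_eq_zero_right h2
  have h4 : N = (↑u⁻¹ : R) • -Polynomial.aeval M M.charpoly.divX := by
    rw [← h3, smul_smul, Units.inv_mul, one_smul]
  rw [h4]
  exact S.smul_mem (S.neg_mem (Algebra.adjoin_le (Set.singleton_subset_iff.mpr hM)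
    (Polynomial.aeval_mem_adjoin_singleton R M))) _

section BlockDiag

variable {ι : Type}

/-- The equivalence relation attached to a preorder. -/
abbrev symRel (r : ι → ι → Prop) : ι → ι → Prop := fun i j => r i j ∧ r j i

open scoped Classical in
/-- The block diagonal part of a matrix, with respect to the equivalence relation attached to a
preorder. -/
def blockDiag {A : Type*} [CommRing A] (r : ι → ι → Prop) (M : Matrix ι ι A) : Matrix ι ι A :=
  Matrix.of fun i j => if symRel r i j then M i j else 0

theorem blockDiag_of_symRel {A : Type*} [CommRing A] {r : ι → ι → Prop} {M : Matrix ι ι A} {i j : ι}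
    (h : symRel r i j) : blockDiag r M i j = M i j := if_pos h

theorem blockDiag_of_not_symRel {A : Type*} [CommRing A] {r : ι → ι → Prop} {M : Matrix ι ι A}
    {i j : ι} (h : ¬ symRel r i j) : blockDiag r M i j = 0 := if_neg h

end BlockDiag

section Pattern

variable {ι : Type} [Fintype ι] [DecidableEq ι]

/-- The algebra of matrices whose entries vanish outside a preorder. -/
def patternAlg (A : Type*) [CommRing A] (r : ι → ι → Prop) [IsPreorder ι r] :
    Subalgebra A (Matrix ι ι A) where
  carrier := {M | ∀ i j, ¬ r i j → M i j = 0}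
  mul_mem' {M N} hM hN i j hij := by
    rw [Matrix.mul_apply]
    refine Finset.sum_eq_zero fun l _ => ?_
    by_cases h : r i l
    · rw [hN l j fun h' => hij (_root_.trans h h'), mul_zero]
    · rw [hM i l h, zero_mul]
  add_mem' {M N} hM hN i j hij := by rw [Matrix.add_apply, hM i j hij, hN i j hij, add_zero]
  algebraMap_mem' a i j hij := by
    rw [Matrix.algebraMap_matrix_apply, if_neg]
    rintro rfl
    exact hij (refl i)

theorem mem_patternAlg {A : Type*} [CommRing A] {r : ι → ι → Prop} [IsPreorder ι r]
    {M : Matrix ι ι A} : M ∈ patternAlg A r ↔ ∀ i j, ¬ r i j → M i j = 0 := Iff.rfl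

/-- The subgroup of invertible matrices whose entries vanish outside a preorder. -/
def patternGroup (k : Type u) [Field k] (r : ι → ι → Prop) [IsPreorder ι r] :
    SubgroupFunctor (glFunctor k ι) where
  obj A :=
    { carrier := {g | glMat g ∈ patternAlg A r}
      one_mem' := (patternAlg A r).one_mem
      mul_mem' := fun hg hh => (patternAlg A r).mul_mem hg hh
      inv_mem' := fun {g} hg =>
        (Matrix.right_inverse_mem_of_mem (glMat_mul_inv g) hg : glMat g⁻¹ ∈ patternAlg A r) }
  map_mem {A B} f g hg i j hij := by
    rw [glMat_map, hg i j hij, map_zero]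

variable {k : Type u} [Field k] {r : ι → ι → Prop} [IsPreorder ι r]

theorem mem_patternGroup {A : CommAlgCat.{u} k} {g : (glFunctor k ι).obj A} :
    g ∈ (patternGroup k r).obj A ↔ ∀ i j, ¬ r i j → glMat g i j = 0 := Iff.rfl

theorem patternGroup_mono {r' : ι → ι → Prop} [IsPreorder ι r'] (h : ∀ i j, r i j → r' i j) :
    patternGroup k r ≤ patternGroup k r' :=
  fun _ _ hg i j hij => hg i j fun h' => hij (h i j h')

theorem glMat_sub_one_apply_eq_zero_iff {A : CommAlgCat.{u} k} {g : (glFunctor k ι).obj A}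
    {i j : ι} : functionalExt A (Matrix.entryLinearMap k k i j) (glMat g - 1) = 0 ↔
      glMat g i j = (1 : Matrix ι ι A) i j := by
  rw [functionalExt_entry, Matrix.sub_apply, sub_eq_zero]

theorem patternGroup_isLinear : (patternGroup k r).IsLinear := by
  refine ⟨{f | ∃ i j, ¬ r i j ∧ f = Matrix.entryLinearMap k k i j}, fun A g => ?_⟩
  rw [mem_patternGroup]
  constructor
  · rintro h _ ⟨i, j, hij, rfl⟩
    rw [glMat_sub_one_apply_eq_zero_iff, h i j hij, Matrix.one_apply_ne]
    rintro rfl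
    exact hij (refl i)
  · intro h i j hij
    have := glMat_sub_one_apply_eq_zero_iff.mp (h _ ⟨i, j, hij, rfl⟩)
    rw [this, Matrix.one_apply_ne]
    rintro rfl
    exact hij (refl i)

instance : IsPreorder ι (symRel r) where
  refl i := ⟨refl i, refl i⟩
  trans _ _ _ h h' := ⟨_root_.trans h.1 h'.1, _root_.trans h'.2 h.2⟩

theorem blockDiag_mem {A : Type*} [CommRing A] (M : Matrix ι ι A) :
    blockDiag r M ∈ patternAlg A (symRel r) := fun _ _ h => blockDiag_of_not_symRel h

theorem blockDiag_eq_self {A : Type*} [CommRing A] {M : Matrix ι ι A}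
    (hM : M ∈ patternAlg A (symRel r)) : blockDiag r M = M := by
  ext i j
  by_cases h : symRel r i j
  · exact blockDiag_of_symRel h
  · rw [blockDiag_of_not_symRel h, hM i j h]

theorem blockDiag_one {A : Type*} [CommRing A] : blockDiag r (1 : Matrix ι ι A) = 1 :=
  blockDiag_eq_self (patternAlg A (symRel r)).one_mem

theorem blockDiag_mul {A : Type*} [CommRing A] {M N : Matrix ι ι A} (hM : M ∈ patternAlg A r)
    (hN : N ∈ patternAlg A r) : blockDiag r (M * N) = blockDiag r M * blockDiag r N := by
  ext i j
  by_cases h : symRel r i j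
  · rw [blockDiag_of_symRel h, Matrix.mul_apply, Matrix.mul_apply]
    refine Finset.sum_congr rfl fun l _ => ?_
    by_cases hil : r i l
    · by_cases hlj : r l j
      · rw [blockDiag_of_symRel ⟨hil, _root_.trans hlj h.2⟩,
          blockDiag_of_symRel ⟨hlj, _root_.trans h.2 hil⟩]
      · rw [hN l j hlj, blockDiag_of_not_symRel fun h' => hlj h'.1, mul_zero, mul_zero]
    · rw [hM i l hil, blockDiag_of_not_symRel fun h' => hil h'.1, zero_mul, zero_mul]
  · rw [blockDiag_of_not_symRel h]
    exact ((patternAlg A (symRel r)).mul_mem (blockDiag_mem M) (blockDiag_mem N) i j h).symm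

/-- The block unipotent subgroup of a pattern subgroup: the matrices with trivial block diagonal
part. -/
def blockUnipotent (k : Type u) [Field k] (r : ι → ι → Prop) [IsPreorder ι r] :
    SubgroupFunctor (glFunctor k ι) where
  obj A :=
    { carrier := {g | glMat g ∈ patternAlg A r ∧ blockDiag r (glMat g) = 1}
      one_mem' := ⟨(patternAlg A r).one_mem, blockDiag_one⟩
      mul_mem' := fun hg hh => ⟨(patternAlg A r).mul_mem hg.1 hh.1, by
        rw [glMat_mul, blockDiag_mul hg.1 hh.1, hg.2, hh.2, one_mul]⟩
      inv_mem' := fun {g} hg => by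
        have h1 : glMat g⁻¹ ∈ patternAlg A r :=
          Matrix.right_inverse_mem_of_mem (glMat_mul_inv g) hg.1
        refine ⟨h1, ?_⟩
        have h2 := congrArg (blockDiag r) (glMat_mul_inv g)
        rwa [blockDiag_mul hg.1 h1, hg.2, one_mul, blockDiag_one] at h2 }
  map_mem {A B} f g hg := by
    refine ⟨fun i j hij => by rw [glMat_map, hg.1 i j hij, map_zero], ?_⟩
    ext i j
    by_cases h : symRel r i j
    · have h1 := congrFun (congrFun hg.2 i) j
      rw [blockDiag_of_symRel h] at h1
      rw [blockDiag_of_symRel h, glMat_map, h1]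
      rw [Matrix.one_apply, Matrix.one_apply]
      split_ifs <;> simp
    · rw [blockDiag_of_not_symRel h, Matrix.one_apply_ne]
      rintro rfl
      exact h ⟨refl i, refl i⟩

theorem mem_blockUnipotent {A : CommAlgCat.{u} k} {g : (glFunctor k ι).obj A} :
    g ∈ (blockUnipotent k r).obj A ↔
      glMat g ∈ patternAlg A r ∧ blockDiag r (glMat g) = 1 := Iff.rfl

theorem mem_blockUnipotent_iff {A : CommAlgCat.{u} k} {g : (glFunctor k ι).obj A} :
    g ∈ (blockUnipotent k r).obj A ↔
      ∀ i j, ¬ (r i j ∧ ¬ r j i) → glMat g i j = (1 : Matrix ι ι A) i j := by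
  rw [mem_blockUnipotent]
  constructor
  · rintro ⟨h1, h2⟩ i j hij
    by_cases h : r i j
    · rw [← h2, blockDiag_of_symRel]
      exact ⟨h, not_not.mp fun h' => hij ⟨h, h'⟩⟩
    · rw [h1 i j h, Matrix.one_apply_ne]
      rintro rfl
      exact h (refl i)
  · intro h
    refine ⟨fun i j hij => ?_, ?_⟩
    · rw [h i j fun h' => hij h'.1, Matrix.one_apply_ne]
      rintro rfl
      exact hij (refl i)
    · ext i j
      by_cases hij : symRel r i j
      · rw [blockDiag_of_symRel hij, h i j fun h' => h'.2 hij.2]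
      · rw [blockDiag_of_not_symRel hij, Matrix.one_apply_ne]
        rintro rfl
        exact hij ⟨refl i, refl i⟩

theorem blockUnipotent_le : blockUnipotent k r ≤ patternGroup k r := fun _ _ hg => hg.1

theorem blockUnipotent_isLinear : (blockUnipotent k r).IsLinear := by
  refine ⟨{f | ∃ i j, ¬ (r i j ∧ ¬ r j i) ∧ f = Matrix.entryLinearMap k k i j}, fun A g => ?_⟩
  rw [mem_blockUnipotent_iff]
  constructor
  · rintro h _ ⟨i, j, hij, rfl⟩
    rw [glMat_sub_one_apply_eq_zero_iff, h i j hij]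
  · intro h i j hij
    exact glMat_sub_one_apply_eq_zero_iff.mp (h _ ⟨i, j, hij, rfl⟩)

/-- The Levi decomposition of a pattern subgroup. -/
theorem patternGroup_levi_decomposition {A : CommAlgCat.{u} k} {g : (glFunctor k ι).obj A}
    (hg : g ∈ (patternGroup k r).obj A) :
    ∃ m ∈ (patternGroup k (symRel r)).obj A, ∃ v ∈ (blockUnipotent k r).obj A, m * v = g := by
  have hg' : glMat g⁻¹ ∈ patternAlg A r := ((patternGroup k r).obj A).inv_mem hg
  have h1 : blockDiag r (glMat g) * blockDiag r (glMat g⁻¹) = 1 := by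
    rw [← blockDiag_mul hg hg', glMat_mul_inv, blockDiag_one]
  let m : (glFunctor k ι).obj A :=
    glMk (blockDiag r (glMat g)) (Matrix.isUnit_det_of_right_inverse h1)
  have hm : m ∈ (patternGroup k (symRel r)).obj A := blockDiag_mem (glMat g)
  have hm' : m ∈ (patternGroup k r).obj A := patternGroup_mono (fun _ _ h => h.1) A hm
  have hmi : glMat m⁻¹ = blockDiag r (glMat g⁻¹) := by
    have h2 : glMat m⁻¹ * glMat m = 1 := glMat_inv_mul m
    have h3 : glMat m = blockDiag r (glMat g) := rfl
    rw [h3] at h2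
    exact left_inv_eq_right_inv h2 h1
  have hmi' : glMat m⁻¹ ∈ patternAlg A r := ((patternGroup k r).obj A).inv_mem hm'
  refine ⟨m, hm, m⁻¹ * g, ⟨(patternAlg A r).mul_mem hmi' hg, ?_⟩, by rw [mul_inv_cancel_left]⟩
  rw [glMat_mul, blockDiag_mul hmi' hg, hmi, blockDiag_eq_self (blockDiag_mem _)]
  exact mul_eq_one_comm.mp h1

theorem patternGroup_inf_blockUnipotent {A : CommAlgCat.{u} k} {g : (glFunctor k ι).obj A}
    (hg : g ∈ (patternGroup k (symRel r)).obj A) (hg' : g ∈ (blockUnipotent k r).obj A) :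
    g = 1 := by
  apply glMat_injective
  rw [glMat_one, ← hg'.2, blockDiag_eq_self hg]

theorem blockUnipotent_conj_mem {A : CommAlgCat.{u} k} {g h : (glFunctor k ι).obj A}
    (hg : g ∈ (blockUnipotent k r).obj A) (hh : h ∈ (patternGroup k r).obj A) :
    h * g * h⁻¹ ∈ (blockUnipotent k r).obj A := by
  have hh' : glMat h⁻¹ ∈ patternAlg A r := ((patternGroup k r).obj A).inv_mem hh
  refine ⟨(patternAlg A r).mul_mem ((patternAlg A r).mul_mem hh hg.1) hh', ?_⟩
  rw [glMat_mul, glMat_mul, blockDiag_mul ((patternAlg A r).mul_mem hh hg.1) hh',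
    blockDiag_mul hh hg.1, hg.2, mul_one, ← blockDiag_mul hh hh', glMat_mul_inv, blockDiag_one]

/-- The diagonal block of an index in a matrix. -/
abbrev blockAt {A : Type*} (r : ι → ι → Prop) (i₀ : ι) (M : Matrix ι ι A) :
    Matrix {i // symRel r i i₀} {i // symRel r i i₀} A := M.submatrix Subtype.val Subtype.val

theorem blockAt_mul {A : Type*} [CommRing A] {M N : Matrix ι ι A}
    (hM : M ∈ patternAlg A r) (hN : N ∈ patternAlg A r) (i₀ : ι)
    [DecidablePred fun i => symRel r i i₀] :
    blockAt r i₀ (M * N) = blockAt r i₀ M * blockAt r i₀ N := by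
  ext i j
  simp only [Matrix.submatrix_apply, Matrix.mul_apply]
  rw [← Finset.sum_subtype (Finset.univ.filter fun i => symRel r i i₀) (by simp)
    (fun l => M i l * N l j), Finset.sum_filter_of_ne]
  intro l _ hne
  have h1 : r i l := by
    by_contra h
    exact hne (by rw [hM _ _ h, zero_mul])
  have h2 : r l j := by
    by_contra h
    exact hne (by rw [hN _ _ h, mul_zero])
  exact ⟨_root_.trans h2 j.2.1, _root_.trans i.2.2 h1⟩

/-- The action of a pattern subgroup on the block of an index. -/
def blockRep (k : Type u) [Field k] (r : ι → ι → Prop) [IsPreorder ι r] (i₀ : ι)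
    [DecidablePred fun i => symRel r i i₀] :
    (patternGroup k r).toFunctor ⟶ glFunctor k {i // symRel r i i₀} where
  app A := GrpCat.ofHom <| Units.map
      { toFun := fun M : patternAlg A r => blockAt r i₀ M.1
        map_one' := by
          ext i j
          simp [Matrix.one_apply, Subtype.ext_iff]
        map_mul' := fun M N => blockAt_mul M.2 N.2 i₀ } |>.comp
      { toFun := fun g => (⟨⟨glMat g.1, g.2⟩, ⟨glMat g⁻¹.1, g⁻¹.2⟩, Subtype.ext (glMat_mul_inv g.1),
            Subtype.ext (glMat_inv_mul g.1)⟩ : (patternAlg A r)ˣ)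
        map_one' := Units.ext rfl
        map_mul' := fun g h => Units.ext rfl }
  naturality {A B} f := rfl

end Pattern

/-! ### The unipotent radical of a pattern subgroup -/

section PatternRadical

open GroupFunctor SubgroupFunctor

variable {ι : Type} [Fintype ι] [DecidableEq ι] {k : Type u} [Field k]
  {r : ι → ι → Prop} [IsPreorder ι r]

theorem glMat_blockRep (i₀ : ι) [DecidablePred fun i => symRel r i i₀] {A : CommAlgCat.{u} k}
    (g : (patternGroup k r).toFunctor.obj A) :
    glMat ((blockRep k r i₀).app A g) = blockAt r i₀ (glMat g.1) := rfl

theorem blockRep_surjective (i₀ : ι) [DecidablePred fun i => symRel r i i₀]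
    (A : CommAlgCat.{u} k) : Function.Surjective ((blockRep k r i₀).app A) := by
  intro h
  -- extend a matrix by the identity outside the block
  let φ : Matrix {i // symRel r i i₀} {i // symRel r i i₀} A → Matrix ι ι A := fun M =>
    Matrix.reindex (Equiv.sumCompl fun i => symRel r i i₀) (Equiv.sumCompl fun i => symRel r i i₀)
      (Matrix.fromBlocks M 0 0 1)
  have hφ : φ (glMat h) * φ (glMat h⁻¹) = 1 := by
    simp only [φ, Matrix.reindex_apply]
    rw [Matrix.submatrix_mul_equiv, Matrix.fromBlocks_multiply]
    simp [glMat_mul_inv]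
  have hsub : blockAt r i₀ (φ (glMat h)) = glMat h := by
    ext i j
    simp [φ, Matrix.submatrix_apply]
  refine ⟨⟨glMk (φ (glMat h)) (Matrix.isUnit_det_of_right_inverse hφ), ?_⟩, glMat_injective hsub⟩
  intro i j hij
  rw [glMat_glMk]
  have hne : i ≠ j := by
    rintro rfl
    exact hij (refl i)
  by_cases hi : symRel r i i₀ <;> by_cases hj : symRel r j i₀
  · exact absurd (_root_.trans hi.1 hj.2) hij
  · simp only [φ, Matrix.reindex_apply, Matrix.submatrix_apply]
    rw [Equiv.sumCompl_symm_apply_of_pos (p := fun i => symRel r i i₀) hi,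
      Equiv.sumCompl_symm_apply_of_neg (p := fun i => symRel r i i₀) hj]
    rfl
  · simp only [φ, Matrix.reindex_apply, Matrix.submatrix_apply]
    rw [Equiv.sumCompl_symm_apply_of_neg (p := fun i => symRel r i i₀) hi,
      Equiv.sumCompl_symm_apply_of_pos (p := fun i => symRel r i i₀) hj]
    rfl
  · simp [φ, hi, hj, hne]

/-- Each diagonal block is a surjective representation of the pattern group, so that the fixed
vectors of a normal subgroup are stable under a full general linear group; a unipotent normal
subgroup therefore acts trivially on the blocks. -/
theorem mem_blockUnipotent_of_isUnipotent {U : SubgroupFunctor (patternGroup k r).toFunctor}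
    (hn : U.IsNormal) (hu : U.toFunctor.IsUnipotent) :
    U ≤ SubgroupFunctor.comap (patternGroup k r).subtype (blockUnipotent k r) := by
  classical
  intro A g hg
  refine ⟨g.2, ?_⟩
  ext i j
  by_cases h : symRel r i j
  · have h1 := hn.map_eq_one_of_isUnipotent hu (blockRep k r j) (blockRep_surjective j _) A hg
    have h2 := congrArg glMat h1
    rw [glMat_blockRep, glMat_one] at h2
    have h3 := congrFun (congrFun h2 ⟨i, h⟩) ⟨j, refl j, refl j⟩
    rw [blockDiag_of_symRel h]
    refine h3.trans ?_
    simp [Matrix.one_apply]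
  · rw [blockDiag_of_not_symRel h, Matrix.one_apply_ne]
    rintro rfl
    exact h ⟨refl i, refl i⟩

end PatternRadical

section Grading

open GroupFunctor SubgroupFunctor

variable {ι : Type} [Fintype ι] [DecidableEq ι]

/-- The preorder given by a labelling of the indices. -/
abbrev labelRel (c : ι → ℕ) : ι → ι → Prop := fun i j => c i ≤ c j

instance (c : ι → ℕ) : IsPreorder ι (labelRel c) where
  refl _ := le_refl _
  trans _ _ _ h h' := le_trans h h'

/-- Scaling of the entries of a matrix above the block diagonal: for a unit `a`, conjugation by a
diagonal matrix with entries powers of `a`. -/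
def scaleMat {A : Type*} [CommRing A] (c : ι → ℕ) (a : A) (M : Matrix ι ι A) : Matrix ι ι A :=
  Matrix.of fun i j => a ^ (c j - c i) * M i j

theorem scaleMat_apply {ι : Type} {A : Type*} [CommRing A] (c : ι → ℕ) (a : A) (M : Matrix ι ι A)
    (i j : ι) : scaleMat c a M i j = a ^ (c j - c i) * M i j := rfl

theorem scaleMat_mul {A : Type*} [CommRing A] {c : ι → ℕ} (a : A) {M N : Matrix ι ι A}
    (hM : M ∈ patternAlg A (labelRel c)) (hN : N ∈ patternAlg A (labelRel c)) :
    scaleMat c a (M * N) = scaleMat c a M * scaleMat c a N := by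
  ext i j
  rw [scaleMat_apply, Matrix.mul_apply, Matrix.mul_apply, Finset.mul_sum]
  refine Finset.sum_congr rfl fun l _ => ?_
  rw [scaleMat_apply, scaleMat_apply]
  by_cases hil : c i ≤ c l
  · by_cases hlj : c l ≤ c j
    · have : c j - c i = (c l - c i) + (c j - c l) := by omega
      rw [this, pow_add]
      ring
    · rw [hN l j hlj]
      ring
  · rw [hM i l hil]
    ring

theorem scaleMat_one {ι : Type} [DecidableEq ι] {A : Type*} [CommRing A] (c : ι → ℕ) (a : A) :
    scaleMat c a (1 : Matrix ι ι A) = 1 := by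
  ext i j
  rw [scaleMat_apply]
  by_cases h : i = j
  · subst h
    simp
  · simp [h]

variable {k : Type u} [Field k] {c : ι → ℕ}

/-- The contraction of the block unipotent group by scaling. -/
def blockUnipotentContraction (k : Type u) [Field k] (c : ι → ℕ) :
    Contraction (blockUnipotent k (labelRel c)).toFunctor where
  act {A} a g :=
    ⟨(⟨scaleMat c a (glMat g.1), scaleMat c a (glMat g⁻¹.1),
      by rw [← scaleMat_mul a g.2.1 g⁻¹.2.1]
         exact (congrArg (scaleMat c a) (glMat_mul_inv g.1)).trans (scaleMat_one c a),
      by rw [← scaleMat_mul a g⁻¹.2.1 g.2.1]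
         exact (congrArg (scaleMat c a) (glMat_inv_mul g.1)).trans (scaleMat_one c a)⟩ :
        (Matrix ι ι A)ˣ), by
      refine mem_blockUnipotent_iff.mpr fun i j hij => ?_
      have h := mem_blockUnipotent_iff.mp g.2 i j hij
      refine (scaleMat_apply c a (glMat g.1) i j).trans ?_
      rw [h]
      exact congrFun (congrFun (scaleMat_one c a) i) j⟩
  act_mul_right a g h := Subtype.ext (Units.ext (scaleMat_mul a g.2.1 h.2.1))
  map_act {A B} f a g := by
    refine Subtype.ext (Units.ext (Matrix.ext fun i j => ?_))
    change f.hom (a ^ (c j - c i) * glMat g.1 i j) = (f.hom a) ^ (c j - c i) * f.hom (glMat g.1 i j)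
    rw [map_mul, map_pow]
  act_one g := by
    refine Subtype.ext (Units.ext (Matrix.ext fun i j => ?_))
    change 1 ^ (c j - c i) * glMat g.1 i j = glMat g.1 i j
    rw [one_pow, one_mul]
  act_zero {A} g := by
    refine Subtype.ext (Units.ext (Matrix.ext fun i j => ?_))
    change 0 ^ (c j - c i) * glMat g.1 i j = (1 : Matrix ι ι A) i j
    by_cases h : c i < c j
    · rw [zero_pow (by omega), zero_mul, Matrix.one_apply_ne]
      rintro rfl
      exact lt_irrefl _ h
    · rw [mem_blockUnipotent_iff.mp g.2 i j fun h' => h'.2 (not_lt.mp h),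
        Nat.sub_eq_zero_of_le (not_lt.mp h), pow_zero, one_mul]
  act_act a b g := by
    refine Subtype.ext (Units.ext (Matrix.ext fun i j => ?_))
    change a ^ (c j - c i) * (b ^ (c j - c i) * glMat g.1 i j) =
      (a * b) ^ (c j - c i) * glMat g.1 i j
    rw [mul_pow, mul_assoc]

/-- Conjugation by the diagonal matrices with entries `a ^ c i` contracts the group to the identity
as `a` tends to `0`. -/
theorem blockUnipotent_isUnipotent : (blockUnipotent k (labelRel c)).toFunctor.IsUnipotent := by
  obtain ⟨R, -, -, hR⟩ := (blockUnipotent_isLinear (k := k) (r := labelRel c)).isSmoothConnected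
  exact (blockUnipotentContraction k c).isUnipotent hR

/-- The unipotent radical of the group of block upper triangular matrices. -/
theorem blockUnipotent_isUnipotentRadical :
    (SubgroupFunctor.comap (patternGroup k (labelRel c)).subtype
      (blockUnipotent k (labelRel c))).IsUnipotentRadical := by
  have e : (SubgroupFunctor.comap (patternGroup k (labelRel c)).subtype
      (blockUnipotent k (labelRel c))).toFunctor ≅ (blockUnipotent k (labelRel c)).toFunctor :=
    comapIso _ (fun A => Subtype.val_injective) _
      fun A g hg => mem_range.mpr ⟨⟨g, blockUnipotent_le A hg⟩, rfl⟩
  refine ⟨⟨blockUnipotent_isLinear.isClosed.comap _,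
    blockUnipotent_isLinear.isSmoothConnected.of_iso e.symm,
    blockUnipotent_isUnipotent.of_iso e.symm, fun A => ⟨fun g hg h => ?_⟩⟩,
    fun U hU => mem_blockUnipotent_of_isUnipotent hU.2.2.2 hU.2.2.1⟩
  exact blockUnipotent_conj_mem hg h.2

end Grading

section Reductive

open GroupFunctor SubgroupFunctor

variable {ι : Type} [Fintype ι] [DecidableEq ι] {k : Type u} [Field k]
  {r : ι → ι → Prop} [IsPreorder ι r]

/-- A group of block diagonal matrices has no nontrivial normal unipotent subgroup. -/
theorem eq_bot_of_isUnipotentNormal (hr : ∀ i j, r i j → r j i)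
    {U : SubgroupFunctor (patternGroup k r).toFunctor} (hU : U.IsUnipotentNormal) : U = ⊥ := by
  ext A g
  constructor
  · intro hg
    have h := mem_blockUnipotent_of_isUnipotent hU.2.2.2 hU.2.2.1 A hg
    refine Subtype.ext (glMat_injective (Matrix.ext fun i j => ?_))
    exact mem_blockUnipotent_iff.mp h i j fun h' => h'.2 (hr i j h'.1)
  · intro hg
    rw [Subgroup.mem_bot.mp hg]
    exact (U.obj A).one_mem

end Reductive

/-! ### The Borel subgroup of upper triangular matrices -/

open scoped commutatorElement

section Strip

variable {A : Type*} [CommRing A] {n : ℕ}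

/-- Matrices supported on the entries `(i, j)` with `i + m ≤ j`. -/
def IsStrip (m : ℕ) (M : Matrix (Fin n) (Fin n) A) : Prop :=
  ∀ i j : Fin n, (j : ℕ) < i + m → M i j = 0

theorem IsStrip.mul {a b : ℕ} {M N : Matrix (Fin n) (Fin n) A} (hM : IsStrip a M)
    (hN : IsStrip b N) : IsStrip (a + b) (M * N) := by
  intro i j hij
  rw [Matrix.mul_apply]
  refine Finset.sum_eq_zero fun l _ => ?_
  by_cases h : (l : ℕ) < i + a
  · rw [hM i l h, zero_mul]
  · rw [hN l j (by omega), mul_zero]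

theorem IsStrip.mono {a b : ℕ} (h : a ≤ b) {M : Matrix (Fin n) (Fin n) A} (hM : IsStrip b M) :
    IsStrip a M := fun i j hij => hM i j (by omega)

theorem IsStrip.add {a : ℕ} {M N : Matrix (Fin n) (Fin n) A} (hM : IsStrip a M)
    (hN : IsStrip a N) : IsStrip a (M + N) := fun i j hij => by
  rw [Matrix.add_apply, hM i j hij, hN i j hij, add_zero]

theorem IsStrip.sub {a : ℕ} {M N : Matrix (Fin n) (Fin n) A} (hM : IsStrip a M)
    (hN : IsStrip a N) : IsStrip a (M - N) := fun i j hij => by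
  rw [Matrix.sub_apply, hM i j hij, hN i j hij, sub_zero]

theorem IsStrip.one : IsStrip 0 (1 : Matrix (Fin n) (Fin n) A) := fun i j hij => by
  rw [Matrix.one_apply_ne]
  rintro rfl
  omega

theorem IsStrip.of_sub_one {a : ℕ} {M : Matrix (Fin n) (Fin n) A} (hM : IsStrip a (M - 1)) :
    IsStrip 0 M := by
  have := (hM.mono a.zero_le).add IsStrip.one
  rwa [sub_add_cancel] at this

theorem isStrip_zero_iff {M : Matrix (Fin n) (Fin n) A} :
    IsStrip 0 M ↔ M ∈ patternAlg A (fun i j : Fin n => i ≤ j) := by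
  rw [mem_patternAlg]
  constructor
  · intro h i j hij
    exact h i j (by simpa using hij)
  · intro h i j hij
    exact h i j (by simpa using hij)

/-- The commutator of two upper triangular matrices lies one step deeper. -/
theorem IsStrip.commutator {m : ℕ} {M N : Matrix (Fin n) (Fin n) A} (hM : IsStrip m (M - 1))
    (hN : IsStrip m (N - 1)) : IsStrip (m + 1) (M * N - N * M) := by
  rcases m.eq_zero_or_pos with rfl | hm
  · have hM0 := hM.of_sub_one
    have hN0 := hN.of_sub_one
    have hdiag : ∀ {X Y : Matrix (Fin n) (Fin n) A}, IsStrip 0 X → IsStrip 0 Y → ∀ i,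
        (X * Y) i i = X i i * Y i i := by
      intro X Y hX hY i
      rw [Matrix.mul_apply, Finset.sum_eq_single i]
      · intro l _ hl
        rcases lt_or_gt_of_ne hl with h | h
        · rw [hX i l (by simpa using h), zero_mul]
        · rw [hY l i (by simpa using h), mul_zero]
      · simp
    intro i j hij
    rcases Nat.lt_or_eq_of_le (show (j : ℕ) ≤ i by omega) with h | h
    · exact ((hM0.mul hN0).sub (hN0.mul hM0)) i j h
    · obtain rfl := Fin.ext h
      rw [Matrix.sub_apply, hdiag hM0 hN0, hdiag hN0 hM0, mul_comm, sub_self]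
  · have h : M * N - N * M = (M - 1) * (N - 1) - (N - 1) * (M - 1) := by noncomm_ring
    rw [h]
    exact ((hM.mul hN).sub (hN.mul hM)).mono (by omega)

/-- The group of matrices `g` for which `g - 1` is supported on the entries `(i, j)` with
`i + m ≤ j`. -/
def stripGroup (A : Type*) [CommRing A] (n m : ℕ) : Subgroup (Matrix (Fin n) (Fin n) A)ˣ where
  carrier := {g | IsStrip m (g.1 - 1)}
  one_mem' := fun i j _ => by simp
  mul_mem' {g h} hg hh := by
    have h1 : (g * h).1 - 1 = (g.1 - 1) * h.1 + (h.1 - 1) := by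
      rw [Units.val_mul]; noncomm_ring
    change IsStrip m _
    rw [h1]
    exact IsStrip.add (IsStrip.mul hg (IsStrip.of_sub_one hh)) hh
  inv_mem' {g} hg := by
    have h0 : IsStrip 0 (g⁻¹).1 := isStrip_zero_iff.mpr
      (Matrix.right_inverse_mem_of_mem g.mul_inv (isStrip_zero_iff.mp (IsStrip.of_sub_one hg)))
    have h1 : (g⁻¹).1 - 1 = 0 - (g⁻¹).1 * (g.1 - 1) := by
      rw [mul_sub, Units.inv_mul]; noncomm_ring
    change IsStrip m _
    rw [h1]
    have := IsStrip.mul h0 hg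
    rw [zero_add] at this
    exact IsStrip.sub (fun _ _ _ => rfl) this

/-- The commutator of two matrices in the `m`-th strip group is controlled by `g h - h g`, which
lies one strip further up. -/
theorem stripGroup_commutator_le (m : ℕ) :
    ⁅stripGroup A n m, stripGroup A n m⁆ ≤ stripGroup A n (m + 1) := by
  rw [Subgroup.commutator_le]
  intro g hg h hh
  have h1 : (⁅g, h⁆ : (Matrix (Fin n) (Fin n) A)ˣ).1 - 1 =
      (g.1 * h.1 - h.1 * g.1) * ((h * g)⁻¹).1 := by
    have e : (⁅g, h⁆ : (Matrix (Fin n) (Fin n) A)ˣ) = g * h * (h * g)⁻¹ := by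
      rw [commutatorElement_def]; group
    rw [e, sub_mul, show h.1 * g.1 = (h * g).1 from rfl, Units.mul_inv]
    rfl
  have h2 : IsStrip 0 ((h * g)⁻¹).1 :=
    IsStrip.of_sub_one ((stripGroup A n m).inv_mem ((stripGroup A n m).mul_mem hh hg))
  change IsStrip (m + 1) _
  rw [h1]
  exact (IsStrip.commutator hg hh).mul h2

/-- Invertible upper triangular matrices form a solvable group. -/
theorem stripGroup_isSolvable : Group.IsSolvable (stripGroup A n 0) := by
  rw [Group.isSolvable_def]
  refine ⟨n, ?_⟩
  have key : ∀ m, (derivedSeries (stripGroup A n 0) m).map (stripGroup A n 0).subtype ≤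
      stripGroup A n m := by
    intro m
    induction m with
    | zero =>
      rintro _ ⟨g, -, rfl⟩
      exact g.2
    | succ m ih =>
      rw [derivedSeries_succ, Subgroup.map_commutator]
      exact (Subgroup.commutator_mono ih ih).trans (stripGroup_commutator_le m)
  rw [eq_bot_iff]
  intro g hg
  have h1 := key n ⟨g, hg, rfl⟩
  refine Subgroup.mem_bot.mpr (Subtype.ext (Units.ext (sub_eq_zero.mp ?_)))
  ext i j
  exact h1 i j (by omega)

end Strip

section NotSolvable

variable {K : Type*} [Field K]

/-- Upper elementary matrices of size two. -/
def upperElem (t : K) : (Matrix (Fin 2) (Fin 2) K)ˣ :=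
  ⟨!![1, t; 0, 1], !![1, -t; 0, 1], by simp [Matrix.one_fin_two], by simp [Matrix.one_fin_two]⟩

/-- Lower elementary matrices of size two. -/
def lowerElem (t : K) : (Matrix (Fin 2) (Fin 2) K)ˣ :=
  ⟨!![1, 0; t, 1], !![1, 0; -t, 1], by simp [Matrix.one_fin_two], by simp [Matrix.one_fin_two]⟩

open scoped Classical in
/-- Elementary matrices are commutators of elementary matrices with diagonal matrices, and the
latter are products of elementary matrices. -/
theorem mem_commutator_of_elementary {D : Subgroup (Matrix (Fin 2) (Fin 2) K)ˣ} [Infinite K]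
    (hx : ∀ t, upperElem t ∈ D) (hy : ∀ t, lowerElem t ∈ D) (t : K) :
    upperElem t ∈ ⁅D, D⁆ ∧ lowerElem t ∈ ⁅D, D⁆ := by
  obtain ⟨a, ha⟩ := Infinite.exists_notMem_finset ({0, 1, -1} : Finset K)
  simp only [Finset.mem_insert, Finset.mem_singleton, not_or] at ha
  obtain ⟨ha0, ha1, ha2⟩ := ha
  have hne : a ^ 2 - 1 ≠ 0 := by
    intro h
    have : (a - 1) * (a + 1) = 0 := by linear_combination h
    rcases mul_eq_zero.mp this with h | h
    · exact ha1 (sub_eq_zero.mp h)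
    · exact ha2 (eq_neg_of_add_eq_zero_left h)
  -- the diagonal matrix with entries `a` and `a⁻¹` is a product of elementary matrices
  let w : K → (Matrix (Fin 2) (Fin 2) K)ˣ := fun b => upperElem b * lowerElem (-b⁻¹) * upperElem b
  have hw : ∀ b, w b ∈ D := fun b => D.mul_mem (D.mul_mem (hx _) (hy _)) (hx _)
  have hd : w a * w (-1) ∈ D := D.mul_mem (hw _) (hw _)
  have hdv : (w a * w (-1)).1 = !![a, 0; 0, a⁻¹] := by
    simp only [w, upperElem, lowerElem, Units.val_mul]
    ext i j
    fin_cases i <;> fin_cases j <;> simp [Matrix.mul_apply, Fin.sum_univ_two, ha0]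
  constructor
  · have h1 : (⁅w a * w (-1), upperElem (t / (a ^ 2 - 1))⁆ : (Matrix (Fin 2) (Fin 2) K)ˣ) =
        upperElem t := by
      rw [commutatorElement_def, mul_inv_eq_iff_eq_mul, mul_inv_eq_iff_eq_mul]
      refine Units.ext ?_
      simp only [Units.val_mul (w a * w (-1)), Units.val_mul _ (w a * w (-1)), hdv]
      simp only [upperElem, Units.val_mul]
      ext i j
      fin_cases i <;> fin_cases j <;> simp [Matrix.mul_apply, Fin.sum_univ_two]
      field_simp
      ring
    rw [← h1]
    exact Subgroup.commutator_mem_commutator hd (hx _)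
  · have h1 : (⁅w a * w (-1), lowerElem (-(t * a ^ 2) / (a ^ 2 - 1))⁆ :
        (Matrix (Fin 2) (Fin 2) K)ˣ) = lowerElem t := by
      rw [commutatorElement_def, mul_inv_eq_iff_eq_mul, mul_inv_eq_iff_eq_mul]
      refine Units.ext ?_
      simp only [Units.val_mul (w a * w (-1)), Units.val_mul _ (w a * w (-1)), hdv]
      simp only [lowerElem, Units.val_mul]
      ext i j
      fin_cases i <;> fin_cases j <;> simp [Matrix.mul_apply, Fin.sum_univ_two]
      field_simp
      ring
    rw [← h1]
    exact Subgroup.commutator_mem_commutator hd (hy _)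

/-- The derived series never loses the elementary matrices. -/
theorem not_isSolvable_of_elementary {D : Subgroup (Matrix (Fin 2) (Fin 2) K)ˣ} [Infinite K]
    (hx : ∀ t, upperElem t ∈ D) (hy : ∀ t, lowerElem t ∈ D) : ¬ Group.IsSolvable D := by
  intro h
  obtain ⟨m, hm⟩ := (Group.isSolvable_def _).mp h
  have key : ∀ m, (∀ t, upperElem t ∈ (derivedSeries D m).map D.subtype) ∧
      ∀ t, lowerElem t ∈ (derivedSeries D m).map D.subtype := by
    intro m
    induction m with
    | zero => exact ⟨fun t => ⟨⟨_, hx t⟩, trivial, rfl⟩, fun t => ⟨⟨_, hy t⟩, trivial, rfl⟩⟩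
    | succ m ih =>
      rw [derivedSeries_succ, Subgroup.map_commutator]
      exact ⟨fun t => (mem_commutator_of_elementary ih.1 ih.2 t).1,
        fun t => (mem_commutator_of_elementary ih.1 ih.2 t).2⟩
  have h1 := (key m).1 1
  rw [hm, Subgroup.map_bot, Subgroup.mem_bot] at h1
  have h2 := congrArg (fun g : (Matrix (Fin 2) (Fin 2) K)ˣ => g.1 0 1) h1
  simp [upperElem] at h2

/-- The homomorphism from invertible matrices of size two to those of size `n` attached to a
two-dimensional direct summand. -/
def embedTwo {n : ℕ} (P : Matrix (Fin n) (Fin 2) K) (Q : Matrix (Fin 2) (Fin n) K)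
    (h : Q * P = 1) : Matrix (Fin 2) (Fin 2) K →* Matrix (Fin n) (Fin n) K where
  toFun s := 1 + P * (s - 1) * Q
  map_one' := by simp
  map_mul' s t := by
    have e : P * (s - 1) * Q * (P * (t - 1) * Q) = P * ((s - 1) * (t - 1)) * Q := by
      calc P * (s - 1) * Q * (P * (t - 1) * Q) = P * (s - 1) * (Q * P) * (t - 1) * Q := by
            simp only [Matrix.mul_assoc]
        _ = _ := by rw [h, Matrix.mul_one]; simp only [Matrix.mul_assoc]
    have e2 : s * t - 1 = (s - 1) + (t - 1) + (s - 1) * (t - 1) := by noncomm_ring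
    rw [add_mul, mul_add, mul_add, e, e2]
    simp only [Matrix.mul_add, Matrix.add_mul, one_mul, mul_one]
    abel

theorem embedTwo_injective {n : ℕ} (P : Matrix (Fin n) (Fin 2) K) (Q : Matrix (Fin 2) (Fin n) K)
    (h : Q * P = 1) : Function.Injective (embedTwo P Q h) := by
  intro s t hst
  have h1 : P * (s - 1) * Q = P * (t - 1) * Q := add_left_cancel hst
  have h2 := congrArg (fun Z => Q * Z * P) h1
  have h3 : ∀ z : Matrix (Fin 2) (Fin 2) K, Q * (P * z * Q) * P = z := by
    intro z
    calc Q * (P * z * Q) * P = (Q * P) * z * (Q * P) := by simp only [Matrix.mul_assoc]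
      _ = z := by rw [h, Matrix.one_mul, Matrix.mul_one]
  simp only [h3] at h2
  exact sub_left_injective h2

/-- A solvable group of matrices containing all upper triangular matrices consists of upper
triangular matrices: otherwise a conjugate of an upper transvection and another upper transvection
generate a copy of `SL₂`. -/
theorem isUpperTriangular_of_isSolvable {n : ℕ} [Infinite K]
    {S : Subgroup (Matrix (Fin n) (Fin n) K)ˣ} (hS : Group.IsSolvable S)
    (hB : ∀ g : (Matrix (Fin n) (Fin n) K)ˣ,
      g.1 ∈ patternAlg K (fun i j : Fin n => i ≤ j) → g ∈ S)
    {g : (Matrix (Fin n) (Fin n) K)ˣ} (hg : g ∈ S) :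
    g.1 ∈ patternAlg K (fun i j : Fin n => i ≤ j) := by
  intro i j hij
  by_contra hgij
  rw [not_le] at hij
  obtain ⟨l, m, hl, hm, hlm⟩ : ∃ l m : Fin n, j < l ∧ m < i ∧ (g⁻¹).1 l m ≠ 0 := by
    by_contra hcon
    push Not at hcon
    -- otherwise `g` preserves the span of the first `i` basis vectors
    let r : Fin n → Fin n → Prop := fun a b => b < i → a < i
    have : IsPreorder (Fin n) r :=
      { refl := fun _ => id
        trans := fun _ _ _ h h' => h ∘ h' }
    have h1 : (g⁻¹).1 ∈ patternAlg K r := by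
      intro a b hab
      have hab' : b < i ∧ ¬ a < i := by simpa [r] using hab
      exact hcon a b (lt_of_lt_of_le hij (not_lt.mp hab'.2)) hab'.1
    exact hgij (Matrix.right_inverse_mem_of_mem g.inv_mul h1 i j fun h => lt_irrefl _ (h hij))
  let w : Fin n → K := fun a => g.1 a j
  let φ : Fin n → K := fun b => (g⁻¹).1 l b
  have hφw : ∑ b, φ b * w b = 0 := by
    have := congrFun (congrFun g.inv_mul l) j
    rwa [Matrix.one_apply_ne hl.ne'] at this
  let P : Matrix (Fin n) (Fin 2) K :=
    Matrix.of fun a s => if s = 0 then w a else (Pi.single m 1 : Fin n → K) a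
  let Q : Matrix (Fin 2) (Fin n) K :=
    Matrix.of fun s b => if s = 0 then (w i)⁻¹ * (Pi.single i 1 : Fin n → K) b else (φ m)⁻¹ * φ b
  have hwi : w i ≠ 0 := hgij
  have hφm : φ m ≠ 0 := hlm
  have hQP : Q * P = 1 := by
    ext s t
    fin_cases s <;> fin_cases t
    · simp [Q, P, Matrix.mul_apply, Pi.single_apply, hwi]
    · simp [Q, P, Matrix.mul_apply, Pi.single_apply]
      exact fun h => absurd h hm.ne
    · simp [Q, P, Matrix.mul_apply, mul_assoc, ← Finset.mul_sum, hφw]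
    · simp [Q, P, Matrix.mul_apply, Pi.single_apply, hφm]
  have hsol : Group.IsSolvable (S.comap (Units.map (embedTwo P Q hQP))) := by
    let f : S.comap (Units.map (embedTwo P Q hQP)) →* S :=
      ((Units.map (embedTwo P Q hQP)).comp (Subgroup.subtype _)).codRestrict S fun x => x.2
    refine Group.isSolvable_of_isSolvable_injective (f := f) fun x y hxy => ?_
    exact Subtype.ext (Units.map_injective (embedTwo_injective P Q hQP) (congrArg Subtype.val hxy))
  refine not_isSolvable_of_elementary (fun t => ?_) (fun t => ?_) hsol
  · -- conjugates by `g` of upper transvections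
    have hdet : IsUnit (Matrix.transvection j l (t * (φ m)⁻¹)).det := by
      rw [Matrix.det_transvection_of_ne _ _ hl.ne]
      exact isUnit_one
    obtain ⟨v, hv⟩ := (Matrix.isUnit_iff_isUnit_det _).mpr hdet
    have hvS : v ∈ S := hB v fun a b hab => by
      rw [hv, Matrix.transvection, Matrix.add_apply,
        Matrix.one_apply_ne (by rintro rfl; exact hab le_rfl),
        Matrix.single_apply, if_neg, add_zero]
      rintro ⟨rfl, rfl⟩
      exact hab hl.le
    have hconj : g * v * g⁻¹ = Units.map (embedTwo P Q hQP) (upperElem t) := by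
      refine Units.ext ?_
      rw [Units.val_mul, Units.val_mul, hv, Matrix.transvection, mul_add, add_mul, mul_one,
        Units.mul_inv]
      change _ = 1 + P * ((upperElem t).1 - 1) * Q
      congr 1
      ext a b
      have hs : (upperElem t).1 - 1 = !![0, t; 0, 0] := by
        ext a b
        fin_cases a <;> fin_cases b <;> simp [upperElem]
      have e1 : (P * !![0, t; 0, 0] * Q) a b = w a * t * ((φ m)⁻¹ * φ b) := by
        simp [Matrix.mul_apply, Fin.sum_univ_two, P, Q]
      have e2 : (g.1 * Matrix.single j l (t * (φ m)⁻¹) * (g⁻¹).1) a b =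
          w a * (t * (φ m)⁻¹) * φ b := by
        rw [Matrix.mul_apply, Finset.sum_eq_single l]
        · rw [Matrix.mul_single_apply_same]
        · intro b' _ hb'
          rw [Matrix.mul_single_apply_of_ne (hbj := hb'), zero_mul]
        · simp
      rw [hs, e1, e2]
      ring
    change Units.map (embedTwo P Q hQP) (upperElem t) ∈ S
    rw [← hconj]
    exact S.mul_mem (S.mul_mem hg hvS) (S.inv_mem hg)
  · have : Units.map (embedTwo P Q hQP) (lowerElem t) ∈ S := by
      refine hB _ ?_
      intro a b hab
      have hs : (lowerElem t).1 - 1 = !![0, 0; t, 0] := by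
        ext a b
        fin_cases a <;> fin_cases b <;> simp [lowerElem]
      have e1 : (P * !![0, 0; t, 0] * Q) a b =
          (Pi.single m 1 : Fin n → K) a * t * ((w i)⁻¹ * (Pi.single i 1 : Fin n → K) b) := by
        simp [Matrix.mul_apply, Fin.sum_univ_two, P, Q]
      have hne : a ≠ b := by rintro rfl; exact hab le_rfl
      change (1 + P * ((lowerElem t).1 - 1) * Q : Matrix (Fin n) (Fin n) K) a b = 0
      rw [hs, Matrix.add_apply, Matrix.one_apply_ne hne, zero_add, e1, Pi.single_apply,
        Pi.single_apply]
      split_ifs with h1 h2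
      · subst h1 h2
        exact absurd hm.le hab
      all_goals simp
    exact this

end NotSolvable

/-! ### Borel subgroups, split tori and Levi subgroups of the general linear group -/

section Borel

open GroupFunctor SubgroupFunctor

/-- On a reduced algebra of finite type over an algebraically closed field, a function vanishing at
all rational points is zero. -/
theorem eq_zero_of_forall_algHom_apply_eq_zero {K R : Type*} [Field K] [IsAlgClosed K] [CommRing R]
    [Algebra K R] [Algebra.FiniteType K R] [IsReduced R] {x : R} (h : ∀ f : R →ₐ[K] K, f x = 0) :
    x = 0 := by
  have : IsJacobsonRing R := isJacobsonRing_of_finiteType (A := K)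
  have hx : x ∈ (⊥ : Ideal R).jacobson := by
    rw [Ideal.jacobson, Submodule.mem_sInf]
    rintro m ⟨-, hm⟩
    let := Ideal.Quotient.field m
    have : Module.Finite K (R ⧸ m) := finite_of_finite_type_of_isJacobsonRing K (R ⧸ m)
    have hb : Function.Bijective (algebraMap K (R ⧸ m)) :=
      IsAlgClosed.algebraMap_bijective_of_isIntegral
    let e : (R ⧸ m) ≃ₐ[K] K := (AlgEquiv.ofBijective (Algebra.ofId K (R ⧸ m)) hb).symm
    have := h (e.toAlgHom.comp (Ideal.Quotient.mkₐ K m))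
    have h2 : e (Ideal.Quotient.mk m x) = 0 := this
    exact Ideal.Quotient.eq_zero_iff_mem.mp ((map_eq_zero_iff e e.injective).mp h2)
  rw [← Ideal.radical_eq_jacobson] at hx
  obtain ⟨n, hn⟩ := hx
  exact IsNilpotent.eq_zero ⟨n, (Submodule.mem_bot R).mp hn⟩

variable {K : Type u} [Field K] [IsAlgClosed K] {n : ℕ}

/-- The upper triangular matrices form a Borel subgroup of the general linear group. -/
theorem patternGroup_le_isBorel :
    (patternGroup K (fun i j : Fin n => i ≤ j)).IsBorel := by
  have hlin : (patternGroup K (fun i j : Fin n => i ≤ j)).IsLinear := patternGroup_isLinear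
  refine ⟨⟨hlin.isClosed, hlin.isSmoothConnected, ?_⟩, ?_⟩
  · have := stripGroup_isSolvable (A := K) (n := n)
    let S : Subgroup (Matrix (Fin n) (Fin n) K)ˣ :=
      (patternGroup K (fun i j : Fin n => i ≤ j)).obj (CommAlgCat.of K K)
    have hS : S ≤ stripGroup K n 0 := fun g hg =>
      (isStrip_zero_iff.mpr (mem_patternAlg.mpr (mem_patternGroup.mp hg))).sub IsStrip.one
    exact Group.isSolvable_of_isSolvable_injective (Subgroup.inclusion_injective hS)
  · intro B hB hle A g hg
    have hK : ∀ h ∈ B.obj (CommAlgCat.of K K), ∀ i j : Fin n, ¬ i ≤ j → glMat h i j = 0 := by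
      intro h hh
      refine mem_patternAlg.mp (isUpperTriangular_of_isSolvable (S := B.obj (CommAlgCat.of K K))
        (g := h) hB.2.2 (fun g hg => ?_) hh)
      exact hle (CommAlgCat.of K K) (mem_patternGroup.mpr (mem_patternAlg.mp hg))
    obtain ⟨R, hsm, -, hrep⟩ := hB.2.1
    obtain ⟨x, hx⟩ := hrep.exists_universal
    -- the entries below the diagonal vanish on rational points, and the coordinate ring is reduced
    have hred : IsReduced R := Algebra.Smooth.isReduced K R
    obtain ⟨f, hf⟩ := (hx A).2 ⟨g, hg⟩
    rw [mem_patternGroup]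
    intro i j hij
    have hx0 : glMat x.1 i j = 0 := by
      refine eq_zero_of_forall_algHom_apply_eq_zero (K := K) fun φ => ?_
      have := hK _ (B.toFunctor.map (CommAlgCat.ofHom φ : R ⟶ CommAlgCat.of K K) x).2 i j hij
      exact this
    have h1 : glMat g i j = f.hom (glMat x.1 i j) := by
      have : g = (B.toFunctor.map f x).1 := congrArg Subtype.val hf.symm
      rw [this]
      rfl
    rw [h1, hx0, map_zero]

end Borel

section SplitTorus

open GroupFunctor SubgroupFunctor

variable (k : Type u) [Field k] (n : ℕ)

/-- The split torus as the group of diagonal matrices. -/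
def diagonalHom : splitTorus k n ⟶ (patternGroup k (fun i j : Fin n => i = j)).toFunctor where
  app A := GrpCat.ofHom
    { toFun := fun d => ⟨(⟨Matrix.diagonal fun i => (d i : A), Matrix.diagonal fun i => (d⁻¹ i : A),
          by rw [Matrix.diagonal_mul_diagonal, ← Matrix.diagonal_one]; congr 1; ext i; simp,
          by rw [Matrix.diagonal_mul_diagonal, ← Matrix.diagonal_one]; congr 1; ext i; simp⟩ :
          Matrix.GeneralLinearGroup (Fin n) A), fun i j hij => Matrix.diagonal_apply_ne _ hij⟩
      map_one' := Subtype.ext (Units.ext (Matrix.diagonal_one))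
      map_mul' := fun d e => Subtype.ext (Units.ext (Matrix.diagonal_mul_diagonal _ _).symm) }
  naturality A B f := by
    refine GrpCat.hom_ext (MonoidHom.ext fun d => Subtype.ext (glMat_injective ?_))
    ext i j
    by_cases h : i = j
    · subst h
      exact (Matrix.diagonal_apply_eq _ _).trans
        (congrArg f.hom (Matrix.diagonal_apply_eq (fun i => ((d : Fin n → Aˣ) i : A)) i)).symm
    · refine (Matrix.diagonal_apply_ne _ h).trans
        (Eq.trans (map_zero f.hom).symm (congrArg f.hom (Matrix.diagonal_apply_ne _ h).symm))

theorem diagonalHom_bijective (A : CommAlgCat.{u} k) :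
    Function.Bijective ((diagonalHom k n).app A) := by
  constructor
  · intro d e hde
    refine funext fun i => Units.ext ?_
    have h1 := congrFun (congrFun (congrArg (fun g => glMat g.1) hde) i) i
    exact (Matrix.diagonal_apply_eq (fun i => ((d : Fin n → Aˣ) i : A)) i).symm.trans
      (h1.trans (Matrix.diagonal_apply_eq (fun i => ((e : Fin n → Aˣ) i : A)) i))
  · intro g
    have hg := mem_patternGroup.mp g.2
    have hg' := mem_patternGroup.mp (g⁻¹).2
    have key : ∀ (x y : (patternGroup k (fun i j : Fin n => i = j)).toFunctor.obj A),
        x * y = 1 → ∀ i, glMat x.1 i i * glMat y.1 i i = 1 := by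
      intro x y hxy i
      have hx := mem_patternGroup.mp x.2
      have h1 := congrFun (congrFun (congrArg (fun g => glMat g.1) hxy) i) i
      change (glMat x.1 * glMat y.1) i i = (1 : Matrix (Fin n) (Fin n) A) i i at h1
      rw [Matrix.mul_apply, Matrix.one_apply_eq, Finset.sum_eq_single i] at h1
      · exact h1
      · intro j _ hj
        rw [hx i j hj.symm, zero_mul]
      · simp
    refine ⟨fun i => ⟨glMat g.1 i i, glMat (g⁻¹).1 i i, key _ _ (mul_inv_cancel g) i,
      key _ _ (inv_mul_cancel g) i⟩, Subtype.ext (glMat_injective ?_)⟩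
    ext i j
    by_cases h : i = j
    · subst h
      exact Matrix.diagonal_apply_eq _ _
    · exact (Matrix.diagonal_apply_ne _ h).trans (hg i j h).symm

theorem patternGroup_eq_isSplitTorus :
    (patternGroup k (fun i j : Fin n => i = j)).toFunctor.IsSplitTorus :=
  ⟨n, ⟨(isoOfBijective _ (diagonalHom_bijective k n)).symm⟩⟩

variable {k n} in
/-- A diagonal matrix with distinct invertible entries has only diagonal matrices in its
centralizer; so a split torus containing the diagonal torus is equal to it. -/
theorem patternGroup_isSplit {r : Fin n → Fin n → Prop} [IsPreorder (Fin n) r] :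
    (patternGroup k r).toFunctor.IsSplit := by
  have hr : ∀ (K : Type u) [Field K],
      (comap (patternGroup K r).subtype
        (patternGroup K (fun i j : Fin n => i = j))).IsSplitSubtorus := fun K _ =>
    ⟨patternGroup_isLinear.isClosed.comap _, (patternGroup_eq_isSplitTorus K n).of_iso
      (comapIso _ (fun A => Subtype.val_injective) _ fun A g hg =>
        (mem_range (φ := (patternGroup K r).subtype)).mpr
          ⟨⟨g, patternGroup_mono (fun i j h => h ▸ refl i) A hg⟩, rfl⟩).symm⟩
  refine ⟨comap (patternGroup k r).subtype (patternGroup k (fun i j : Fin n => i = j)), hr k,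
    hr (AlgebraicClosure k), ?_⟩
  intro T hT hle A g hg
  obtain ⟨n', ⟨e⟩⟩ := hT.2
  have hcomm : ∀ x y : T.toFunctor.obj A, x * y = y * x := by
    intro x y
    apply (iso_hom_bijective e A).1
    rw [map_mul, map_mul]
    exact mul_comm (G := Fin n' → (A : Type u)ˣ) _ _
  let K := AlgebraicClosure k
  have : Infinite Kˣ := unitsEquivNeZero.infinite_iff.mpr
    (Set.finite_singleton (0 : K)).infinite_compl.to_subtype
  let g' : (patternGroup K r).toFunctor.obj A := g
  let d : Fin n → Kˣ := fun i => Infinite.natEmbedding Kˣ i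
  have hd : Function.Injective d := fun i j h =>
    Fin.ext ((Infinite.natEmbedding Kˣ).injective h)
  let t : (patternGroup K (fun i j : Fin n => i = j)).toFunctor.obj A :=
    (diagonalHom K n).app A fun i => Units.map (algebraMap K A : K →* A) (d i)
  have htr : t.1 ∈ (patternGroup K r).obj A := patternGroup_mono (fun i j h => h ▸ refl i) A t.2
  have htT : (⟨t.1, htr⟩ : (patternGroup K r).toFunctor.obj A) ∈ T.obj A := hle A t.2
  have h1 := congrArg (fun x => glMat (x.1 : (patternGroup K r).toFunctor.obj A).1)
    (hcomm ⟨g, hg⟩ ⟨_, htT⟩)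
  have h2 : glMat g'.1 * Matrix.diagonal (fun i => algebraMap K A (d i)) =
    Matrix.diagonal (fun i => algebraMap K A (d i)) * glMat g'.1 := h1
  refine mem_patternGroup.mpr fun i j hij => ?_
  change glMat g'.1 i j = 0
  have h3 := congrFun (congrFun h2 i) j
  rw [Matrix.mul_diagonal, Matrix.diagonal_mul] at h3
  have hu : IsUnit (algebraMap K A ((d j : K) - d i)) :=
    (IsUnit.mk0 _ (sub_ne_zero.mpr fun h => hij (hd (Units.ext h)).symm)).map _
  refine (hu.mul_right_eq_zero).mp ?_
  rw [map_sub, sub_mul, sub_eq_zero, mul_comm]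
  exact h3

end SplitTorus

section Levi

open GroupFunctor SubgroupFunctor

variable {k : Type u} [Field k] {n : ℕ}

/-- The block diagonal matrices are a Levi factor of the block upper triangular matrices. -/
theorem patternGroup_isLevi {c : Fin n → ℕ} (hc : Monotone c) :
    (patternGroup k (symRel (labelRel c))).IsLevi := by
  refine ⟨patternGroup_isLinear.isClosed, patternGroup k (labelRel c),
    ⟨patternGroup_isLinear.isClosed, patternGroup_isLinear.isSmoothConnected.isSmooth,
      patternGroup (AlgebraicClosure k) (fun i j : Fin n => i ≤ j), patternGroup_le_isBorel,
      patternGroup_mono (k := AlgebraicClosure k) (r' := labelRel c) fun i j h => hc h⟩,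
    patternGroup_mono fun i j h => h.1,
    comap (patternGroup (AlgebraicClosure k) (labelRel c)).subtype
      (blockUnipotent (AlgebraicClosure k) (labelRel c)), blockUnipotent_isUnipotentRadical,
    fun A => ?_⟩
  refine Subgroup.isComplement'_of_disjoint_and_mul_eq_univ ?_ ?_
  · rw [Subgroup.disjoint_def]
    intro x hx hx'
    exact Subtype.ext (patternGroup_inf_blockUnipotent (k := AlgebraicClosure k) hx hx')
  · refine Set.eq_univ_of_forall fun x => ?_
    obtain ⟨m, hm, v, hv, h⟩ := patternGroup_levi_decomposition (k := AlgebraicClosure k) x.2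
    exact Set.mem_mul.mpr ⟨⟨m, patternGroup_mono (fun i j h => h.1) A hm⟩, hm,
      ⟨v, blockUnipotent_le A hv⟩, hv, Subtype.ext h⟩

end Levi

/-! ### Diagonalization and centralizers -/

section Diagonalization

open Polynomial

/-- Lagrange interpolation writes every vector as a sum of eigenvectors of an endomorphism that is
annihilated by a split separable polynomial. -/
theorem Module.End.span_eigenvectors_eq_top {L W : Type*} [Field L] [AddCommGroup W] [Module L W]
    (f : Module.End L W) {p : L[X]} (hp : p.Splits) (hsep : p.Separable) (hf : aeval f p = 0) :
    Submodule.span L {v : W | ∃ a : L, f v = a • v} = ⊤ := by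
  classical
  set s := p.roots.toFinset with hs
  have hnodal : aeval f (Lagrange.nodal s id) = 0 := by
    have h1 : p = C p.leadingCoeff * Lagrange.nodal s id := by
      conv_lhs => rw [hp.eq_prod_roots]
      rw [Lagrange.nodal_eq, Finset.prod_multiset_map_count]
      congr 1
      refine Finset.prod_congr rfl fun a ha => ?_
      rw [Multiset.count_eq_one_of_mem (nodup_roots hsep) (Multiset.mem_toFinset.mp ha), pow_one]
      rfl
    rw [h1, map_mul, aeval_C] at hf
    have h2 : p.leadingCoeff ≠ 0 := leadingCoeff_ne_zero.mpr hsep.ne_zero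
    rw [← Algebra.smul_def] at hf
    exact (smul_eq_zero_iff_right h2).mp hf
  rw [eq_top_iff]
  intro v _
  rcases s.eq_empty_or_nonempty with h0 | h0
  · rw [h0, Lagrange.nodal_empty, map_one] at hnodal
    have : v = 0 := by
      have := LinearMap.congr_fun hnodal v
      simpa using this
    rw [this]
    exact zero_mem _
  · have h1 := congrArg (fun q => aeval f q v)
      (Lagrange.sum_basis (v := (id : L → L)) Function.injective_id.injOn h0)
    simp only [map_sum, map_one, Module.End.one_apply, LinearMap.sum_apply] at h1
    rw [← h1]
    refine Submodule.sum_mem _ fun a ha => Submodule.subset_span ⟨a, ?_⟩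
    have hdvd : Lagrange.nodal s id ∣ (X - C a) * Lagrange.basis s id a := by
      rw [Lagrange.nodal_eq_mul_nodal_erase ha]
      refine mul_dvd_mul_left _ (Finset.prod_dvd_prod_of_dvd _ _ fun b _ => ?_)
      exact Dvd.intro_left _ rfl
    obtain ⟨q, hq⟩ := hdvd
    have h2 := congrArg (fun q => aeval f q v) hq
    simp only [map_mul, hnodal, zero_mul, LinearMap.zero_apply, map_sub, aeval_X, aeval_C,
      Module.End.mul_apply, LinearMap.sub_apply, Module.algebraMap_end_apply] at h2
    exact sub_eq_zero.mp h2

/-- A matrix annihilated by a split separable polynomial is diagonalizable; the eigenvalues can be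
ordered so that equal ones are consecutive. -/
theorem Matrix.exists_diagonalization {L : Type*} [Field L] {n : ℕ} (M : Matrix (Fin n) (Fin n) L)
    {p : L[X]} (hp : p.Splits) (hsep : p.Separable) (hM : aeval M p = 0) :
    ∃ (P Q : Matrix (Fin n) (Fin n) L) (d : Fin n → L) (c : Fin n → ℕ), P * Q = 1 ∧ Q * P = 1 ∧
      Monotone c ∧ (∀ i j, d i = d j ↔ c i = c j) ∧ Q * M * P = Matrix.diagonal d := by
  classical
  have hspan := Module.End.span_eigenvectors_eq_top (Matrix.toLin' M) hp hsep (by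
    have h := aeval_algHom_apply (Matrix.toLinAlgEquiv' (R := L) (n := Fin n)) M p
    rw [hM, map_zero] at h
    exact h)
  let b₀ := Module.Basis.ofSpan hspan.ge
  have hfin : Finite _ := Module.Finite.finite_basis b₀
  have := Fintype.ofFinite
    ((linearIndepOn_empty L id).extend (Set.empty_subset {v | ∃ a : L, Matrix.toLin' M v = a • v}))
  have hcard := Module.finrank_eq_card_basis b₀
  rw [Module.finrank_fin_fun] at hcard
  let b₁ := b₀.reindex (Fintype.equivFinOfCardEq hcard.symm)
  have hb₁ : ∀ i, ∃ a : L, Matrix.toLin' M (b₁ i) = a • b₁ i := fun i =>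
    Module.Basis.ofSpan_subset hspan.ge ⟨(Fintype.equivFinOfCardEq hcard.symm).symm i, by
      rw [Module.Basis.reindex_apply]⟩
  choose d₁ hd₁ using hb₁
  obtain ⟨φ, hφ⟩ : ∃ φ : Set.range d₁ → ℕ, Function.Injective φ :=
    ⟨_, Fin.val_injective.comp (Finite.equivFin (Set.range d₁)).injective⟩
  let c₁ : Fin n → ℕ := fun i => φ ⟨d₁ i, i, rfl⟩
  let σ := Tuple.sort c₁
  let b : Fin n → Fin n → L := fun i => b₁ (σ i)
  have hb : ∀ i, M.mulVec (b i) = d₁ (σ i) • b i := fun i => hd₁ (σ i)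
  let b₂ := b₁.reindex σ.symm
  have hb₂ : ∀ i, b₂ i = b i := fun i => by rw [Module.Basis.reindex_apply]; rfl
  let P : Matrix (Fin n) (Fin n) L := (Pi.basisFun L (Fin n)).toMatrix b₂
  let Q : Matrix (Fin n) (Fin n) L := b₂.toMatrix (Pi.basisFun L (Fin n))
  have hPQ : P * Q = 1 := Module.Basis.toMatrix_mul_toMatrix_flip _ _
  have hQP : Q * P = 1 := Module.Basis.toMatrix_mul_toMatrix_flip _ _
  refine ⟨P, Q, d₁ ∘ σ, c₁ ∘ σ, hPQ, hQP, Tuple.monotone_sort c₁, fun i j => ?_, ?_⟩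
  · change d₁ (σ i) = d₁ (σ j) ↔ φ _ = φ _
    exact (Subtype.mk_eq_mk (p := (· ∈ Set.range d₁))).symm.trans hφ.eq_iff.symm
  · have h : M * P = P * Matrix.diagonal (d₁ ∘ σ) := by
      ext i j
      rw [Matrix.mul_diagonal]
      have h1 := congrFun (hb j) i
      have h2 : ∀ i, P i j = b j i := fun i => by
        rw [← hb₂]; rfl
      rw [h2, mul_comm]
      refine Eq.trans ?_ h1
      rw [Matrix.mul_apply, Matrix.mulVec, dotProduct]
      exact Finset.sum_congr rfl fun l _ => by rw [h2]
    rw [Matrix.mul_assoc, h, ← Matrix.mul_assoc, hQP, Matrix.one_mul]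

end Diagonalization

section Centralizer

open GroupFunctor SubgroupFunctor

variable {k : Type u} [Field k] {ι : Type} [Fintype ι] [DecidableEq ι]

/-- The centralizer of a matrix in the general linear group. -/
def matrixCentralizer (M : Matrix ι ι k) : SubgroupFunctor (glFunctor k ι) where
  obj A :=
    { carrier := {g | Commute (glMat g) (M.map (algebraMap k A))}
      one_mem' := Commute.one_left _
      mul_mem' := fun {g h} hg hh => Commute.mul_left hg hh
      inv_mem' := fun {g} hg => by
        have : ((show (Matrix ι ι A)ˣ from g)⁻¹).1 * M.map (algebraMap k A) =
          M.map (algebraMap k A) * ((show (Matrix ι ι A)ˣ from g)⁻¹).1 :=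
          (Commute.units_inv_left (u := (show (Matrix ι ι A)ˣ from g)) hg).eq
        exact this }
  map_mem {A B} f g hg := by
    have h := congrArg (fun N : Matrix ι ι A => N.map f.hom) (show _ * _ = _ * _ from hg)
    simp only [Matrix.map_mul] at h
    have h1 : (M.map (algebraMap k A)).map f.hom = M.map (algebraMap k B) := by
      ext i j
      exact f.hom.commutes _
    rw [h1] at h
    exact h

theorem mem_matrixCentralizer {M : Matrix ι ι k} {A : CommAlgCat.{u} k}
    {g : (glFunctor k ι).obj A} : g ∈ (matrixCentralizer M).obj A ↔
      glMat g * M.map (algebraMap k A) = M.map (algebraMap k A) * glMat g := Iff.rfl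

theorem matrixCentralizer_isLinear (M : Matrix ι ι k) : (matrixCentralizer M).IsLinear := by
  refine ⟨Set.range fun p : ι × ι => (Matrix.entryLinearMap k k p.1 p.2) ∘ₗ
    (LinearMap.mulRight k M - LinearMap.mulLeft k M), fun A g => ?_⟩
  have key : ∀ (i j : ι) (Y : Matrix ι ι A),
      functionalExt A ((Matrix.entryLinearMap k k i j) ∘ₗ
        (LinearMap.mulRight k M - LinearMap.mulLeft k M)) Y =
      (Y * M.map (algebraMap k A) - M.map (algebraMap k A) * Y) i j := by
    intro i j Y
    have : functionalExt A ((Matrix.entryLinearMap k k i j) ∘ₗ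
        (LinearMap.mulRight k M - LinearMap.mulLeft k M)) =
        (Matrix.entryLinearMap A A i j) ∘ₗ (LinearMap.mulRight A (M.map (algebraMap k A)) -
          LinearMap.mulLeft A (M.map (algebraMap k A))) := by
      refine Matrix.ext_linearMap _ fun a b => LinearMap.ext_ring ?_
      have h1 : (Matrix.single a b (1 : A)) =
          (Matrix.single a b (1 : k)).map (algebraMap k A) := by
        rw [Matrix.map_single _ _ _ (algebraMap k A), map_one]
      simp only [LinearMap.comp_apply, Matrix.singleLinearMap_apply]
      rw [h1, functionalExt_map]
      simp only [LinearMap.comp_apply, LinearMap.sub_apply, LinearMap.mulRight_apply,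
        LinearMap.mulLeft_apply, Matrix.entryLinearMap_apply, ← Matrix.map_mul,
        Matrix.map_apply, map_sub]
    rw [this]
    rfl
  rw [mem_matrixCentralizer, Set.forall_mem_range]
  simp only [key]
  constructor
  · intro h p
    rw [sub_mul, mul_sub, h]
    simp
  · intro h
    have h2 : (glMat g - 1) * M.map (algebraMap k A) - M.map (algebraMap k A) * (glMat g - 1) = 0 :=
      Matrix.ext fun i j => h (i, j)
    rw [sub_mul, mul_sub, one_mul, mul_one, sub_sub_sub_cancel_right] at h2
    exact sub_eq_zero.mp h2

theorem matrixCentralizer_baseChange (M : Matrix ι ι k) (L : Type u) [Field L] [Algebra k L] :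
    (matrixCentralizer M).baseChange L = matrixCentralizer (M.map (algebraMap k L)) := by
  ext A g
  exact Iff.rfl

/-- Conjugation by an invertible matrix `P`, with inverse `Q`: `g ↦ Q g P`. -/
def conjHom {P Q : Matrix ι ι k} (hPQ : P * Q = 1) (hQP : Q * P = 1) :
    glFunctor k ι ⟶ glFunctor k ι where
  app A := GrpCat.ofHom (MulAut.conj (Matrix.GeneralLinearGroup.map (algebraMap k A)
    (⟨Q, P, hQP, hPQ⟩ : Matrix.GeneralLinearGroup ι k))).toMonoidHom
  naturality A B f := by
    refine GrpCat.hom_ext (MonoidHom.ext fun g => ?_)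
    have h : Matrix.GeneralLinearGroup.map (algebraMap k B)
        (⟨Q, P, hQP, hPQ⟩ : Matrix.GeneralLinearGroup ι k) =
        Matrix.GeneralLinearGroup.map f.hom.toRingHom
          (Matrix.GeneralLinearGroup.map (algebraMap k A)
          (⟨Q, P, hQP, hPQ⟩ : Matrix.GeneralLinearGroup ι k)) := by
      refine Units.ext (Matrix.ext fun i j => ?_)
      exact (f.hom.commutes _).symm
    let γ : Matrix.GeneralLinearGroup ι A := g
    change MulAut.conj _ (Matrix.GeneralLinearGroup.map f.hom.toRingHom γ) =
      Matrix.GeneralLinearGroup.map f.hom.toRingHom (MulAut.conj _ γ)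
    rw [MulAut.conj_apply, MulAut.conj_apply, map_mul, map_mul, map_inv, h]

/-- Conjugation by an invertible matrix as an automorphism of the general linear group. -/
def conjIso {P Q : Matrix ι ι k} (hPQ : P * Q = 1) (hQP : Q * P = 1) :
    glFunctor k ι ≅ glFunctor k ι :=
  isoOfBijective (conjHom hPQ hQP) fun A => (MulAut.conj (Matrix.GeneralLinearGroup.map
    (algebraMap k A) (⟨Q, P, hQP, hPQ⟩ : Matrix.GeneralLinearGroup ι k))).bijective

/-- The centralizer of a diagonalizable matrix is conjugate to a group of block diagonal
matrices. -/
theorem matrixCentralizer_eq_comap {n : ℕ} {M P Q : Matrix (Fin n) (Fin n) k} {d : Fin n → k}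
    {c : Fin n → ℕ} (hPQ : P * Q = 1) (hQP : Q * P = 1) (hd : ∀ i j, d i = d j ↔ c i = c j)
    (hM : Q * M * P = Matrix.diagonal d) :
    matrixCentralizer M = comap (conjIso hPQ hQP).hom (patternGroup k (symRel (labelRel c))) := by
  ext A g
  let φ : Matrix (Fin n) (Fin n) k →+* Matrix (Fin n) (Fin n) A := (algebraMap k A).mapMatrix
  have h1 : φ P * φ Q = 1 := by rw [← map_mul, hPQ, map_one]
  have h2 : φ Q * φ P = 1 := by rw [← map_mul, hQP, map_one]
  have h3 : φ Q * φ M * φ P = Matrix.diagonal fun i => algebraMap k A (d i) := by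
    rw [← map_mul, ← map_mul, hM]
    exact Matrix.diagonal_map (map_zero _)
  have h5 : glMat g * φ M = φ M * glMat g ↔ (φ Q * glMat g * φ P) * (φ Q * φ M * φ P) =
      (φ Q * φ M * φ P) * (φ Q * glMat g * φ P) := by
    have e : ∀ X Y : Matrix (Fin n) (Fin n) A, (φ Q * X * φ P) * (φ Q * Y * φ P) =
        φ Q * (X * Y) * φ P := by
      intro X Y
      calc (φ Q * X * φ P) * (φ Q * Y * φ P) = φ Q * X * (φ P * φ Q) * Y * φ P := by
            simp only [Matrix.mul_assoc]
        _ = _ := by rw [h1, Matrix.mul_one]; simp only [Matrix.mul_assoc]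
    rw [e, e]
    refine ⟨fun h => by rw [h], fun h => ?_⟩
    have := congrArg (fun Z => φ P * Z * φ Q) h
    have e2 : ∀ Z, φ P * (φ Q * Z * φ P) * φ Q = Z := by
      intro Z
      calc φ P * (φ Q * Z * φ P) * φ Q = (φ P * φ Q) * Z * (φ P * φ Q) := by
            simp only [Matrix.mul_assoc]
        _ = Z := by rw [h1, Matrix.mul_one, Matrix.one_mul]
    simpa only [e2] using this
  rw [mem_matrixCentralizer, mem_comap, mem_patternGroup]
  change glMat g * φ M = φ M * glMat g ↔ ∀ i j, ¬ symRel (labelRel c) i j →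
    (φ Q * glMat g * φ P) i j = 0
  rw [h5, h3, ← Matrix.ext_iff]
  refine forall_congr' fun i => forall_congr' fun j => ?_
  rw [Matrix.mul_diagonal, Matrix.diagonal_mul, mul_comm, ← sub_eq_zero, ← sub_mul, ← map_sub]
  have hlab : symRel (labelRel c) i j ↔ d i = d j := by
    rw [hd]
    exact ⟨fun h => le_antisymm h.1 h.2, fun h => ⟨h.le, h.ge⟩⟩
  rw [hlab]
  by_cases hij : d i = d j
  · simp [hij]
  · have hu : IsUnit (algebraMap k A (d j - d i)) :=
      (IsUnit.mk0 _ (sub_ne_zero.mpr fun h => hij h.symm)).map _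
    rw [hu.mul_right_eq_zero]
    simp [hij]

end Centralizer

/-! ### The restriction of scalars inside the general linear group -/

section RangeResAut

open GroupFunctor SubgroupFunctor

variable {F K : Type u} [Field F] [Field K] [Algebra F K]
  {V : Type u} [AddCommGroup V] [Module K V] [Module F V] [IsScalarTower F K V]

theorem resEquiv_tmul_smul {A : Type u} [CommRing A] [Algebra F A] (e : K) (a : A)
    (x : (K ⊗[F] A) ⊗[K] V) : resEquiv F K V A ((e ⊗ₜ[F] a) • x) =
      a • (Algebra.lsmul F F V e : V →ₗ[F] V).baseChange A (resEquiv F K V A x) := by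
  induction x with
  | zero => simp
  | add x y hx hy => simp only [smul_add, map_add, hx, hy]
  | tmul y v =>
    induction y with
    | zero => simp
    | add y z hy hz => simp only [add_tmul, smul_add, map_add, hy, hz]
    | tmul e' b => simp [TensorProduct.smul_tmul', mul_smul]

/-- The image of `Res_{K/F} Aut_K(V)` in `Aut_F(V)` is the centralizer of `K`. -/
theorem mem_range_resAutToAut {A : CommAlgCat.{u} F} {g : (autFunctor F V).obj A} :
    g ∈ (range (resAutToAut F K V)).obj A ↔ ∀ e : K, Commute
      (show LinearMap.GeneralLinearGroup A (A ⊗[F] V) from g).1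
      ((Algebra.lsmul F F V e : V →ₗ[F] V).baseChange A) := by
  constructor
  · intro hg e
    obtain ⟨h, rfl⟩ := mem_range.mp hg
    refine LinearMap.ext fun x => ?_
    obtain ⟨y, rfl⟩ := (resEquiv F K V A).surjective x
    have h0 : ∀ z, (show LinearMap.GeneralLinearGroup A (A ⊗[F] V) from
        (resAutToAut F K V).app A h).1 (resEquiv F K V A z) = resEquiv F K V A
        ((show LinearMap.GeneralLinearGroup (K ⊗[F] A) ((K ⊗[F] A) ⊗[K] V) from h).1 z) := fun z =>
      congrArg (fun w => resEquiv F K V A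
        ((show LinearMap.GeneralLinearGroup (K ⊗[F] A) ((K ⊗[F] A) ⊗[K] V) from h).1 w))
        (AddEquiv.symm_apply_apply _ z)
    have h1 := fun z => resEquiv_tmul_smul (F := F) (V := V) e (1 : A) z
    simp only [one_smul] at h1
    rw [Module.End.mul_apply, Module.End.mul_apply, ← h1, h0, h0, ← h1, map_smul]
  · intro hg
    let lift : ∀ g : Module.End A (A ⊗[F] V),
        (∀ e : K, Commute g ((Algebra.lsmul F F V e : V →ₗ[F] V).baseChange A)) →
        Module.End (K ⊗[F] A) ((K ⊗[F] A) ⊗[K] V) := fun g hg =>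
      { toFun := fun x => (resEquiv F K V A).symm (g (resEquiv F K V A x))
        map_add' := fun x y => by simp
        map_smul' := fun s x => by
          rw [RingHom.id_apply, AddEquiv.symm_apply_eq]
          induction s with
          | zero => simp
          | add s t hs ht => simp only [add_smul, map_add, hs, ht]
          | tmul e a =>
            rw [resEquiv_tmul_smul, resEquiv_tmul_smul, AddEquiv.apply_symm_apply, map_smul]
            exact congrArg (a • ·) (LinearMap.congr_fun (hg e) _) }
    have hlift : ∀ (g g' : Module.End A (A ⊗[F] V)) hg hg', g * g' = 1 →
        lift g hg * lift g' hg' = 1 := by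
      intro g g' hg hg' h
      refine LinearMap.ext fun x => ?_
      change (resEquiv F K V A).symm (g (resEquiv F K V A ((resEquiv F K V A).symm
        (g' (resEquiv F K V A x))))) = x
      rw [AddEquiv.apply_symm_apply, AddEquiv.symm_apply_eq]
      exact LinearMap.congr_fun h _
    let γ : LinearMap.GeneralLinearGroup A (A ⊗[F] V) := g
    have hg' : ∀ e : K, Commute (γ⁻¹).1 ((Algebra.lsmul F F V e : V →ₗ[F] V).baseChange A) :=
      fun e => Commute.units_inv_left (hg e)
    let h : LinearMap.GeneralLinearGroup (K ⊗[F] A) ((K ⊗[F] A) ⊗[K] V) :=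
      ⟨lift γ.1 hg, lift (γ⁻¹).1 hg', hlift _ _ hg hg' γ.mul_inv, hlift _ _ hg' hg γ.inv_mul⟩
    refine mem_range.mpr ⟨h, Units.ext (LinearMap.ext fun x => ?_)⟩
    change resEquiv F K V A ((resEquiv F K V A).symm (γ.1 (resEquiv F K V A
      ((resEquiv F K V A).symm x)))) = γ.1 x
    rw [AddEquiv.apply_symm_apply, AddEquiv.apply_symm_apply]

variable (F V) in
theorem range_resAutToAut_self : range (resAutToAut F F V) = ⊤ := by
  ext A g
  refine iff_of_true (mem_range_resAutToAut.mpr fun e => ?_) trivial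
  refine LinearMap.ext fun x => ?_
  have h : ∀ y : A ⊗[F] V, (Algebra.lsmul F F V e : V →ₗ[F] V).baseChange A y =
      algebraMap F A e • y := by
    intro y
    induction y with
    | zero => simp
    | add x y hx hy => rw [map_add, hx, hy, smul_add]
    | tmul a v => simp [TensorProduct.smul_tmul']
  rw [Module.End.mul_apply, Module.End.mul_apply, h, h, map_smul]

variable (F V) in
theorem range_resAutToAut_mono {K' : Type u} [Field K'] [Algebra F K'] [Algebra K K']
    [IsScalarTower F K K'] [Module K' V] [IsScalarTower F K' V] [IsScalarTower K K' V] :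
    range (resAutToAut F K' V) ≤ range (resAutToAut F K V) := by
  intro A g hg
  refine mem_range_resAutToAut.mpr fun e => ?_
  have h : (Algebra.lsmul F F V e : V →ₗ[F] V) = Algebra.lsmul F F V (algebraMap K K' e) :=
    LinearMap.ext fun v => (algebraMap_smul K' e v).symm
  rw [h]
  exact mem_range_resAutToAut.mp hg _

/-- The centralizer of `K = F(α)` is the centralizer of the matrix of multiplication by `α`. -/
theorem range_resAutToAut_eq_comap {n : ℕ} (b : Module.Basis (Fin n) F V) {α : K}
    (hα : Algebra.adjoin F {α} = ⊤) : range (resAutToAut F K V) =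
      comap (autGlIso b).hom (matrixCentralizer
        (LinearMap.toMatrixAlgEquiv b (Algebra.lsmul F F V α))) := by
  ext A g
  let γ : LinearMap.GeneralLinearGroup A (A ⊗[F] V) := g
  have h1 : (∀ e : K, Commute γ.1 ((Algebra.lsmul F F V e : V →ₗ[F] V).baseChange A)) ↔
      Commute γ.1 ((Algebra.lsmul F F V α : V →ₗ[F] V).baseChange A) := by
    refine ⟨fun h => h α, fun h e => ?_⟩
    have he : e ∈ Algebra.adjoin F {α} := hα ▸ Algebra.mem_top
    induction he using Algebra.adjoin_induction with
    | mem x hx =>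
      rw [Set.mem_singleton_iff.mp hx]
      exact h
    | algebraMap r =>
      have : (Algebra.lsmul F F V (algebraMap F K r) : V →ₗ[F] V).baseChange A =
          algebraMap A (Module.End A (A ⊗[F] V)) (algebraMap F A r) := by
        refine LinearMap.ext fun y => ?_
        induction y with
        | zero => simp
        | add x y hx hy => rw [map_add, hx, hy, map_add]
        | tmul a v => simp [TensorProduct.smul_tmul']
      rw [this]
      exact (Algebra.commutes _ _).symm
    | add x y _ _ hx hy =>
      rw [map_add, LinearMap.baseChange_add]
      exact hx.add_right hy
    | mul x y _ _ hx hy =>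
      rw [map_mul, Module.End.mul_eq_comp, LinearMap.baseChange_comp]
      exact hx.mul_right hy
  rw [mem_range_resAutToAut, mem_comap]
  refine h1.trans ?_
  change _ ↔ glMat ((autToGl b).app A g) * _ = _ * glMat ((autToGl b).app A g)
  have h2 : (LinearMap.toMatrixAlgEquiv b (Algebra.lsmul F F V α)).map (algebraMap F A) =
      LinearMap.toMatrixAlgEquiv (Algebra.TensorProduct.basis A b)
        ((Algebra.lsmul F F V α : V →ₗ[F] V).baseChange A) :=
    (LinearMap.toMatrix_baseChange A (Algebra.lsmul F F V α : V →ₗ[F] V) b b).symm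
  rw [h2, glMat_autToGl, ← map_mul, ← map_mul, EmbeddingLike.apply_eq_iff_eq]
  exact Iff.rfl

variable (F K V) in
/-- After extension of scalars to a field which splits the minimal polynomial of a generator of
`K`, the group `Res_{K/F} Aut_K(V)` becomes a group of block diagonal matrices. -/
theorem exists_iso_baseChange_range_resAutToAut [FiniteDimensional F K] [Algebra.IsSeparable F K]
    [FiniteDimensional F V] (L : Type u) [Field L] [Algebra F L]
    (hL : ∀ x : K, ((minpoly F x).map (algebraMap F L)).Splits) :
    ∃ (c : Fin (Module.finrank F V) → ℕ)
      (e : (autFunctor F V).baseChange L ≅ glFunctor L (Fin (Module.finrank F V))), Monotone c ∧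
      (range (resAutToAut F K V)).baseChange L =
        comap e.hom (patternGroup L (symRel (labelRel c))) := by
  obtain ⟨α, hα⟩ := Field.exists_primitive_element F K
  have hα' : Algebra.adjoin F {α} = ⊤ :=
    Algebra.adjoin_eq_top_of_primitive_element (.of_finite F α) hα
  let b := Module.finBasis F V
  let M := LinearMap.toMatrixAlgEquiv b (Algebra.lsmul F F V α)
  have hM : Polynomial.aeval (M.map (algebraMap F L)) ((minpoly F α).map (algebraMap F L)) = 0 := by
    rw [Polynomial.aeval_map_algebraMap]
    have h1 : Polynomial.aeval M (minpoly F α) = 0 := by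
      have := Polynomial.aeval_algHom_apply ((LinearMap.toMatrixAlgEquiv b).toAlgHom.comp
        (Algebra.lsmul F F V)) α (minpoly F α)
      rw [minpoly.aeval, map_zero] at this
      exact this
    have h2 := Polynomial.aeval_algHom_apply ((Algebra.ofId F L).mapMatrix) M (minpoly F α)
    rw [h1, map_zero] at h2
    exact h2
  obtain ⟨P, Q, d, c, hPQ, hQP, hc, hd, hD⟩
    := Matrix.exists_diagonalization (M.map (algebraMap F L))
    (hL α) (Polynomial.Separable.map (Algebra.IsSeparable.isSeparable F α)) hM
  refine ⟨c, baseChangeIso (autGlIso b) L ≪≫ conjIso hPQ hQP, hc, ?_⟩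
  rw [range_resAutToAut_eq_comap b hα', comap_baseChange, matrixCentralizer_baseChange,
    matrixCentralizer_eq_comap hPQ hQP hd hD]
  rfl

variable (F K V) in
/-- The image is the centralizer of multiplication by a primitive element, which is cut out by
linear equations; over an algebraic closure it is a group of block diagonal matrices. -/
theorem range_resAutToAut_isClosed_isReductive [FiniteDimensional F K] [Algebra.IsSeparable F K]
    [FiniteDimensional F V] : (range (resAutToAut F K V)).IsClosed ∧
      (range (resAutToAut F K V)).toFunctor.IsReductive := by
  obtain ⟨α, hα⟩ := Field.exists_primitive_element F K
  have hα' : Algebra.adjoin F {α} = ⊤ :=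
    Algebra.adjoin_eq_top_of_primitive_element (.of_finite F α) hα
  have hS := range_resAutToAut_eq_comap (Module.finBasis F V) hα'
  refine ⟨hS ▸ (matrixCentralizer_isLinear _).isClosed.comap _, ?_, ?_⟩
  · rw [hS]
    exact (matrixCentralizer_isLinear _).isSmoothConnected.of_iso (comapIso' _ _).symm
  · intro U hU
    obtain ⟨c, e, -, he⟩ := exists_iso_baseChange_range_resAutToAut F K V (AlgebraicClosure F)
      fun x => IsAlgClosed.splits _
    let e' : (range (resAutToAut F K V)).toFunctor.baseChange (AlgebraicClosure F) ≅
        (patternGroup (AlgebraicClosure F) (symRel (labelRel c))).toFunctor :=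
      (eqToIso (congrArg SubgroupFunctor.toFunctor he)) ≪≫ comapIso' e _
    have h1 := eq_bot_of_isUnipotentNormal (fun i j h => ⟨h.2, h.1⟩) (hU.comap_iso e'.symm)
    rw [← comap_hom_comap_inv e' U]
    exact (congrArg (comap e'.hom) h1).trans (comap_bot e')

variable (F K V) in
/-- Over a field that splits all minimal polynomials, multiplication by a primitive element becomes
diagonalizable, and its centralizer becomes a group of block diagonal matrices. -/
theorem range_resAutToAut_isLevi_isSplit [FiniteDimensional F K] [Algebra.IsSeparable F K]
    [FiniteDimensional F V] (L : Type u) [Field L] [Algebra F L]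
    (hL : ∀ x : K, ((minpoly F x).map (algebraMap F L)).Splits) :
    ((range (resAutToAut F K V)).baseChange L).IsLevi ∧
      ((range (resAutToAut F K V)).toFunctor.baseChange L).IsSplit := by
  obtain ⟨c, e, hc, he⟩ := exists_iso_baseChange_range_resAutToAut F K V L hL
  refine ⟨he ▸ (patternGroup_isLevi hc).comap_iso e, ?_⟩
  exact patternGroup_isSplit.of_iso
    ((eqToIso (congrArg SubgroupFunctor.toFunctor he)) ≪≫ comapIso' e _)

end RangeResAut

/-! ### Wild inertia -/

section WildInertia

open scoped Pointwise

variable {C G : Type*} [CommRing C] [Group G] [MulSemiringAction G C]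

theorem smul_mem_pow_of_mem_inertia {P : Ideal C} {σ : G} (hσ : σ ∈ P.inertia G) (n : ℕ) :
    ∀ {x : C}, x ∈ P ^ n → σ • x ∈ P ^ n := by
  have h1 : ∀ x ∈ P, σ • x ∈ P := fun x hx => by
    have := P.add_mem (hσ x) hx
    rwa [sub_add_cancel] at this
  induction n with
  | zero => simp
  | succ n ih =>
    intro x hx
    rw [pow_succ] at hx ⊢
    induction hx using Submodule.mul_induction_on' with
    | mem_mul_mem a ha b hb => rw [smul_mul']; exact Ideal.mul_mem_mul (ih ha) (h1 b hb)
    | add a _ b _ ha hb => rw [smul_add]; exact add_mem ha hb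

variable (G) in
/-- The wild inertia group of `P`: the automorphisms that act trivially on the residue ring
`C / P` and on the cotangent space `P / P²`. -/
def wildInertia (P : Ideal C) : Subgroup G where
  carrier := {σ | σ ∈ P.inertia G ∧ ∀ x ∈ P, σ • x - x ∈ P ^ 2}
  one_mem' := ⟨one_mem _, fun x _ => by simp⟩
  mul_mem' {σ τ} hσ hτ := ⟨mul_mem hσ.1 hτ.1, fun x hx => by
    have h1 : (σ * τ) • x - x = σ • (τ • x - x) + (σ • x - x) := by
      rw [mul_smul, smul_sub, sub_add_sub_cancel]
    rw [h1]
    exact add_mem (smul_mem_pow_of_mem_inertia hσ.1 2 (hτ.2 x hx)) (hσ.2 x hx)⟩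
  inv_mem' {σ} hσ := ⟨inv_mem hσ.1, fun x hx => by
    have h1 : σ⁻¹ • x - x = -(σ⁻¹ • (σ • x - x)) := by
      rw [smul_sub, inv_smul_smul, neg_sub]
    rw [h1]
    exact neg_mem (smul_mem_pow_of_mem_inertia (inv_mem hσ.1) 2 (hσ.2 x hx))⟩

theorem mem_wildInertia {P : Ideal C} {σ : G} : σ ∈ wildInertia G P ↔
    (∀ x, σ • x - x ∈ P) ∧ ∀ x ∈ P, σ • x - x ∈ P ^ 2 := Iff.rfl

theorem wildInertia_le (P : Ideal C) : wildInertia G P ≤ P.inertia G := fun _ h => h.1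

/-- Wild inertia acts trivially on all the quotients `P ^ n / P ^ (n + 1)`. -/
theorem smul_sub_mem_pow_of_mem_wildInertia {P : Ideal C} {σ : G} (hσ : σ ∈ wildInertia G P)
    (n : ℕ) : ∀ {x : C}, x ∈ P ^ n → σ • x - x ∈ P ^ (n + 1) := by
  induction n with
  | zero => intro x _; rw [zero_add, pow_one]; exact hσ.1 x
  | succ n ih =>
    intro x hx
    rw [pow_succ] at hx
    induction hx using Submodule.mul_induction_on' with
    | mem_mul_mem a ha b hb =>
      have h1 : σ • (a * b) - a * b = (σ • a - a) * σ • b + a * (σ • b - b) := by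
        rw [smul_mul']; ring
      rw [h1]
      refine add_mem ?_ ?_
      · have hb' : σ • b ∈ P ^ 1 :=
          smul_mem_pow_of_mem_inertia hσ.1 1 (by rwa [pow_one])
        have := Ideal.mul_mem_mul (ih ha) hb'
        rwa [← pow_add] at this
      · have := Ideal.mul_mem_mul ha (hσ.2 b hb)
        rwa [← pow_add] at this
    | add a _ b _ ha hb =>
      rw [smul_add, add_sub_add_comm]
      exact add_mem ha hb

/-- An element of the wild inertia group whose order is prime to the residue characteristic is
trivial: if it moves `x` by an element of `P ^ n`, then its `m`-th power moves `x` by `m` times that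
element modulo `P ^ (n + 1)`. -/
theorem eq_one_of_mem_wildInertia [IsDomain C] [IsNoetherianRing C] [FaithfulSMul G C]
    {P : Ideal C} [hP : P.IsPrime] {p m : ℕ} (hp : (p : C) ∈ P) (hm : m.Coprime p) {σ : G}
    (hσ : σ ∈ wildInertia G P) (h : σ ^ m = 1) : σ = 1 := by
  have key : ∀ n x, σ • x - x ∈ P ^ (n + 1) := by
    intro n
    induction n with
    | zero => intro x; rw [zero_add, pow_one]; exact hσ.1 x
    | succ n ih =>
      intro x
      have h1 : ∀ j : ℕ, σ ^ j • x - x - j * (σ • x - x) ∈ P ^ (n + 1 + 1) := by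
        intro j
        induction j with
        | zero => simp
        | succ j ihj =>
          have e : σ ^ (j + 1) • x - x - (j + 1 : ℕ) * (σ • x - x) =
              (σ • (σ ^ j • x - x) - (σ ^ j • x - x)) + (σ ^ j • x - x - j * (σ • x - x)) := by
            rw [pow_succ', mul_smul, smul_sub]; push_cast; ring
          rw [e]
          refine add_mem (smul_sub_mem_pow_of_mem_wildInertia hσ (n + 1) ?_) ihj
          have h2 := add_mem (Ideal.pow_le_pow_right (n + 1).le_succ ihj)
            ((P ^ (n + 1)).mul_mem_left (j : C) (ih x))
          rwa [sub_add_cancel] at h2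
      have h2 := h1 m
      rw [h, one_smul, sub_self, zero_sub, neg_mem_iff] at h2
      have h3 : IsUnit (Ideal.Quotient.mk (P ^ (n + 1 + 1)) (m : C)) := by
        have hcop : IsCoprime (Ideal.span {(m : C)}) (P ^ (n + 1 + 1)) := by
          have h4 : IsCoprime (m : C) (p : C) := by
            have := (Nat.isCoprime_iff_coprime.mpr hm).map (Int.castRingHom C)
            simpa using this
          refine IsCoprime.pow_right ?_
          refine (Ideal.isCoprime_iff_exists).mpr ?_
          obtain ⟨a, b, hab⟩ := h4
          exact ⟨a * m, Ideal.mem_span_singleton'.mpr ⟨a, rfl⟩, b * p, P.mul_mem_left _ hp, hab⟩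
        obtain ⟨y, hy, z, hz, hyz⟩ := (Ideal.isCoprime_iff_exists).mp hcop
        obtain ⟨a, rfl⟩ := Ideal.mem_span_singleton'.mp hy
        refine IsUnit.of_mul_eq_one (Ideal.Quotient.mk _ a) ?_
        rw [← map_mul, mul_comm, ← map_one (Ideal.Quotient.mk _),
          Ideal.Quotient.mk_eq_mk_iff_sub_mem,
          ← hyz, sub_add_cancel_left, neg_mem_iff]
        exact hz
      rw [← Ideal.Quotient.eq_zero_iff_mem, map_mul, h3.mul_right_eq_zero,
        Ideal.Quotient.eq_zero_iff_mem] at h2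
      exact h2
  refine eq_of_smul_eq_smul (α := C) fun x => ?_
  rw [one_smul, ← sub_eq_zero, ← Submodule.mem_bot C,
    ← Ideal.iInf_pow_eq_bot_of_isDomain P hP.ne_top,
    Submodule.mem_iInf]
  exact fun n => Ideal.pow_le_pow_right n.le_succ (key n x)

/-- An element of order prime to `p` that acts trivially on `P / P²` acts trivially on the whole
`P`-adic filtration. -/
theorem wildInertia_isPGroup [IsDomain C] [IsNoetherianRing C] [FaithfulSMul G C] [Finite G]
    {P : Ideal C} [hP : P.IsPrime] {p : ℕ} [Fact p.Prime] (hp : (p : C) ∈ P) :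
    IsPGroup p (wildInertia G P) := by
  rintro ⟨σ, hσ⟩
  obtain ⟨a, m, hm, h⟩ := Nat.exists_eq_pow_mul_and_not_dvd (orderOf_pos σ).ne' p
    (Fact.out : p.Prime).ne_one
  refine ⟨a, Subtype.ext ?_⟩
  refine eq_one_of_mem_wildInertia (m := m) hp
    ((Nat.Prime.coprime_iff_not_dvd Fact.out).mpr hm).symm (pow_mem hσ (p ^ a)) ?_
  change (σ ^ p ^ a) ^ m = 1
  rw [← pow_mul, ← h, pow_orderOf_eq_one]

/-- An element of order `p` of the inertia group is wild, since the residue field contains no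
nontrivial `p`-th roots of unity. -/
theorem mem_wildInertia_of_pow_eq_one [IsDedekindDomain C] {P : Ideal C} [hP : P.IsPrime]
    (hP0 : P ≠ ⊥) {p : ℕ} [hpp : Fact p.Prime] (hp : (p : C) ∈ P) {σ : G}
    (hσ : σ ∈ P.inertia G) (h : σ ^ p = 1) : σ ∈ wildInertia G P := by
  obtain ⟨π, hπ, hπ2⟩ := Ideal.exists_mem_pow_notMem_pow_succ P hP0 hP.ne_top 1
  have hexp : ∀ x ∈ P, ∃ d, ∃ e ∈ P ^ 2, π * d + e = x := fun x hx =>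
    Ideal.exists_mul_add_mem_pow_succ hP0 π x hπ hπ2 (by rwa [pow_one])
  have hsq : ∀ {x}, x ∈ P ^ 2 → σ • x ∈ P ^ 2 := smul_mem_pow_of_mem_inertia hσ 2
  have hmul : ∀ {a b}, a ∈ P → b ∈ P → a * b ∈ P ^ 2 := fun ha hb => by
    rw [pow_two]; exact Ideal.mul_mem_mul ha hb
  rw [pow_one] at hπ
  have hσπ : σ • π ∈ P := by
    have := smul_mem_pow_of_mem_inertia hσ 1 (x := π) (by rwa [pow_one])
    rwa [pow_one] at this
  obtain ⟨u, e, he, hu⟩ := hexp _ hσπ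
  -- `σ` multiplies the uniformizer `π` by `u` modulo `P ^ 2`, and `u ^ p ≡ 1` forces `u ≡ 1`
  have hpow : ∀ j : ℕ, σ ^ j • π - u ^ j * π ∈ P ^ 2 := by
    intro j
    induction j with
    | zero => simp
    | succ j ih =>
      have e1 : σ ^ (j + 1) • π - u ^ (j + 1) * π = σ • (σ ^ j • π - u ^ j * π) +
          (σ • u ^ j - u ^ j) * (σ • π) + u ^ j * (σ • π - π * u) := by
        rw [pow_succ', mul_smul, smul_sub, smul_mul']; ring
      rw [e1]
      refine add_mem (add_mem (hsq ih) (hmul (hσ _) hσπ)) (Ideal.mul_mem_left _ _ ?_)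
      rw [← hu, add_sub_cancel_left]
      exact he
  have hup : u ^ p - 1 ∈ P := by
    have h1 := hpow p
    rw [h, one_smul, ← neg_mem_iff, neg_sub, ← sub_one_mul] at h1
    exact (Ideal.IsPrime.mul_mem_pow P h1).resolve_right hπ2
  have hu1 : u - 1 ∈ P := by
    have hchar : CharP (C ⧸ P) p := by
      refine (CharP.charP_iff_prime_eq_zero hpp.out).mpr ?_
      rw [← map_natCast (Ideal.Quotient.mk P)]
      exact Ideal.Quotient.eq_zero_iff_mem.mpr hp
    rw [← Ideal.Quotient.eq_zero_iff_mem] at hup ⊢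
    rw [map_sub, map_pow, map_one] at hup
    rw [map_sub, map_one]
    refine eq_zero_of_pow_eq_zero (n := p) ?_
    rw [sub_pow_char, one_pow, hup]
  refine mem_wildInertia.mpr ⟨hσ, fun x hx => ?_⟩
  obtain ⟨d, e', he', rfl⟩ := hexp x hx
  have e2 : σ • (π * d + e') - (π * d + e') = σ • π * (σ • d - d) + d * (π * (u - 1)) +
      d * (σ • π - π * u) + (σ • e' - e') := by
    rw [smul_add, smul_mul']; ring
  rw [e2]
  refine add_mem (add_mem (add_mem (hmul hσπ (hσ _)) (Ideal.mul_mem_left _ _ (hmul hπ hu1)))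
    (Ideal.mul_mem_left _ _ ?_)) (sub_mem (hsq he') he')
  rw [← hu, add_sub_cancel_left]
  exact he

theorem conj_mem_wildInertia {P : Ideal C} {σ : G} (hσ : σ ∈ wildInertia G P) (τ : G) :
    τ * σ * τ⁻¹ ∈ wildInertia G (τ • P) := by
  have h1 : ∀ x : C, (τ * σ * τ⁻¹) • x - x = τ • (σ • (τ⁻¹ • x) - τ⁻¹ • x) := fun x => by
    rw [smul_sub, smul_inv_smul, mul_smul, mul_smul]
  refine mem_wildInertia.mpr ⟨fun x => ?_, fun x hx => ?_⟩
  · rw [h1]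
    exact Ideal.smul_mem_pointwise_smul _ _ _ (hσ.1 _)
  · have h2 : (τ • P) ^ 2 = τ • P ^ 2 := by
      rw [Ideal.pointwise_smul_def, Ideal.pointwise_smul_def, Ideal.map_pow]
    rw [h1, h2]
    exact Ideal.smul_mem_pointwise_smul _ _ _
      (hσ.2 _ (Ideal.mem_pointwise_smul_iff_inv_smul_mem.mp hx))

/-- A normal `p`-subgroup is contained in every subgroup of index prime to `p`. -/
theorem IsPGroup.le_of_not_dvd_index {I : Type*} [Group I] {p : ℕ} [Fact p.Prime] {W K : Subgroup I}
    [hW : W.Normal] (hWp : IsPGroup p W) (hK : ¬ p ∣ K.index) : W ≤ K := by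
  obtain ⟨x, hx⟩ := hWp.nonempty_fixed_point_of_prime_not_dvd_card (I ⧸ K) hK
  obtain ⟨g, rfl⟩ := QuotientGroup.mk_surjective x
  intro w hw
  have h1 := hx ⟨g * w * g⁻¹, hW.conj_mem w hw g⟩
  have h2 : ((g * w * g⁻¹ * g : I) : I ⧸ K) = (g : I ⧸ K) := h1
  rw [eq_comm, QuotientGroup.eq] at h2
  have e : g⁻¹ * (g * w * g⁻¹ * g) = w := by group
  rwa [e] at h2

/-- If `H` contains no nontrivial normal subgroup and its intersections with the inertia groups have
index prime to the residue characteristic, then the orders of the inertia groups are prime to the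
residue characteristic: the wild inertia groups lie in `H` and are permuted by conjugation. -/
theorem not_dvd_card_inertia [IsDedekindDomain C] [FaithfulSMul G C] [Finite G] {p : ℕ}
    [hpp : Fact p.Prime] (hp : ∀ P : Ideal C, P.IsPrime → P ≠ ⊥ → (p : C) ∈ P) {H : Subgroup G}
    (hH : H.normalCore = ⊥)
    (hrel : ∀ P : Ideal C, P.IsPrime → P ≠ ⊥ → ¬ p ∣ H.relIndex (P.inertia G))
    {P : Ideal C} (hP : P.IsPrime) (hP0 : P ≠ ⊥) : ¬ p ∣ Nat.card (P.inertia G) := by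
  have hWH : ∀ P : Ideal C, P.IsPrime → P ≠ ⊥ → wildInertia G P ≤ H := by
    intro P hP hP0
    have hn : ((wildInertia G P).subgroupOf (P.inertia G)).Normal := by
      refine ⟨fun σ hσ τ => ?_⟩
      have h1 : (τ : G) • P = P := P.inertia_le_stabilizer τ.2
      have h2 := conj_mem_wildInertia (Subgroup.mem_subgroupOf.mp hσ) (τ : G)
      rw [h1] at h2
      exact h2
    have h1 : IsPGroup p ((wildInertia G P).subgroupOf (P.inertia G)) :=
      (wildInertia_isPGroup (hp P hP hP0)).of_equiv
        (Subgroup.subgroupOfEquivOfLe (wildInertia_le P)).symm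
    have h2 := h1.le_of_not_dvd_index (K := H.subgroupOf (P.inertia G)) (hrel P hP hP0)
    exact fun σ hσ => Subgroup.mem_subgroupOf.mp (h2 (x := ⟨σ, hσ.1⟩) hσ)
  intro hdvd
  obtain ⟨σ, hσ⟩ := exists_prime_orderOf_dvd_card' p hdvd
  have hσp : (σ : G) ^ p = 1 := by
    have := pow_orderOf_eq_one σ
    rw [hσ] at this
    exact congrArg Subtype.val this
  have hw := mem_wildInertia_of_pow_eq_one hP0 (hp P hP hP0) σ.2 hσp
  have hcore : (σ : G) ∈ H.normalCore := fun τ =>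
    hWH (τ • P) (Ideal.IsPrime.smul τ) (fun h => hP0 (by
      have := congrArg (fun J => τ⁻¹ • J) h
      simpa using this)) (conj_mem_wildInertia hw τ)
  rw [hH, Subgroup.mem_bot] at hcore
  have : σ = 1 := Subtype.ext hcore
  rw [this, orderOf_one] at hσ
  exact hpp.out.ne_one hσ.symm

end WildInertia

/-! ### Tame ramification in Galois closures -/

section GaloisClosureTame

/-- A group of automorphisms that fixes `E` contains no nontrivial normal subgroup of the Galois
group of the normal closure of `E`. -/
theorem normalCore_fixingSubgroup_eq_bot {F E M : Type*} [Field F] [Field E] [Field M] [Algebra F E]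
    [Algebra F M] [Algebra E M] [IsScalarTower F E M] [FiniteDimensional F M] [IsGalois F M]
    [IsNormalClosure F E M] :
    (fixingSubgroup Gal(M/F) (Set.range (algebraMap E M))).normalCore = ⊥ := by
  rw [eq_bot_iff]
  intro σ hσ
  have h1 : ∀ (x : E) (y : M), y ∈ (minpoly F x).rootSet M → σ y = y := by
    intro x y hy
    rw [← minpoly.algebraMap_eq (algebraMap E M).injective x] at hy
    have hc : IsConjRoot F (algebraMap E M x) y := by
      rw [isConjRoot_iff_aeval_eq_zero (Algebra.IsIntegral.isIntegral _)]
      exact (Polynomial.mem_rootSet.mp hy).2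
    obtain ⟨τ, hτ⟩ := (isConjRoot_iff_exists_algEquiv).mp hc.symm
    have h2 := (mem_fixingSubgroup_iff _).mp (hσ τ⁻¹) (algebraMap E M x) ⟨x, rfl⟩
    rw [inv_inv] at h2
    have h3 : τ⁻¹ (σ (τ (algebraMap E M x))) = algebraMap E M x := h2
    have h4 := congrArg τ h3
    rw [hτ] at h4
    have h5 : ∀ z, τ (τ⁻¹ z) = z := fun z => τ.apply_symm_apply z
    rwa [h5] at h4
  rw [Subgroup.mem_bot]
  have h2 : (⊤ : IntermediateField F M) ≤
      IntermediateField.fixedField (Subgroup.zpowers σ) := by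
    rw [← IsNormalClosure.adjoin_rootSet (F := F) (K := E) (L := M)]
    refine iSup_le fun x => IntermediateField.adjoin_le_iff.mpr fun y hy => ?_
    rintro ⟨τ, hτ⟩
    have : Subgroup.zpowers σ ≤ MulAction.stabilizer Gal(M/F) y := by
      rw [Subgroup.zpowers_le]
      exact h1 x y hy
    exact this hτ
  refine AlgEquiv.ext fun y => ?_
  exact h2 (x := y) trivial ⟨σ, Subgroup.mem_zpowers σ⟩

theorem finite_residueField {B : Type*} [CommRing B] (Q : Ideal B) [Q.IsMaximal] [Finite (B ⧸ Q)] :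
    Finite Q.ResidueField :=
  Finite.of_surjective _ (Ideal.bijective_algebraMap_quotient_residueField Q).2

variable {A : Type*} [CommRing A] [IsDomain A] [IsDiscreteValuationRing A]

theorem under_eq_maximalIdeal {B : Type*} [CommRing B] [IsDomain B] [Algebra A B]
    [Algebra.IsIntegral A B] {Q : Ideal B} (hQ : Q.IsPrime) (hQ0 : Q ≠ ⊥) :
    Q.under A = IsLocalRing.maximalIdeal A := by
  have h1 : Q.under A ≠ ⊥ := Ideal.IsIntegral.comap_ne_bot A hQ0
  exact IsLocalRing.eq_maximalIdeal ((Ideal.IsPrime.under A Q).isMaximal h1)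

theorem liesOver_maximalIdeal {B : Type*} [CommRing B] [IsDomain B] [Algebra A B]
    [Algebra.IsIntegral A B] {Q : Ideal B} (hQ : Q.IsPrime) (hQ0 : Q ≠ ⊥) :
    Q.LiesOver (IsLocalRing.maximalIdeal A) := ⟨(under_eq_maximalIdeal hQ hQ0).symm⟩

theorem natCast_eq_zero_iff_dvd {B : Type*} [CommRing B] [IsDomain B] [Algebra A B]
    [Algebra.IsIntegral A B] {Q : Ideal B} (hQ : Q.IsPrime) (hQ0 : Q ≠ ⊥) (n : ℕ) :
    (n : B ⧸ Q) = 0 ↔ ringChar (IsLocalRing.ResidueField A) ∣ n := by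
  have := liesOver_maximalIdeal (A := A) hQ hQ0
  let f : IsLocalRing.ResidueField A →+* B ⧸ Q :=
    algebraMap (A ⧸ IsLocalRing.maximalIdeal A) (B ⧸ Q)
  rw [← ringChar.spec (IsLocalRing.ResidueField A), ← map_natCast f n]
  exact map_eq_zero f

theorem isTamelyRamified_iff {L : Type*} [Field L] [Algebra A L] :
    IsTamelyRamified A L ↔ ∀ P : Ideal (integralClosure A L), P.IsPrime → P ≠ ⊥ →
      ¬ ringChar (IsLocalRing.ResidueField A) ∣ P.ramificationIdx A := by
  refine forall_congr' fun P => forall_congr' fun hP => forall_congr' fun hP0 => ?_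
  rw [ne_eq, natCast_eq_zero_iff_dvd (A := A) hP hP0]

theorem finite_quotient [Finite (IsLocalRing.ResidueField A)] {B : Type*} [CommRing B] [IsDomain B]
    [Algebra A B] [Module.Finite A B] {Q : Ideal B} (hQ : Q.IsPrime) (hQ0 : Q ≠ ⊥) : Finite (B ⧸ Q) := by
  have := liesOver_maximalIdeal (A := A) hQ hQ0
  have : Finite (A ⧸ IsLocalRing.maximalIdeal A) :=
    inferInstanceAs (Finite (IsLocalRing.ResidueField A))
  exact Module.finite_of_finite (A ⧸ IsLocalRing.maximalIdeal A)

end GaloisClosureTame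

section GaloisClosureTame

variable {A : Type*} [CommRing A] [IsDomain A] [IsDiscreteValuationRing A]
  [Finite (IsLocalRing.ResidueField A)]

/-- The inertia group has order equal to the ramification index. -/
theorem card_inertia_eq_ramificationIdx {R S G : Type*} [CommRing R] [IsDomain R] [CommRing S]
    [IsDomain S] [Algebra R S] [Group G] [Finite G] [MulSemiringAction G S] [IsGaloisGroup G R S]
    [Module.Finite R S] [Module.Flat R S] (Q : Ideal R) (P : Ideal S) [P.LiesOver Q] [P.IsPrime]
    [Q.IsMaximal] [Finite (R ⧸ Q)] : Nat.card (P.inertia G) = P.ramificationIdx R := by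
  have := finite_residueField Q
  rw [Ideal.card_inertia_eq_ramificationIdxIn Q P, Ideal.ramificationIdxIn_eq_ramificationIdx Q P G]

/-- The Galois closure of a separable tamely ramified extension is tamely ramified. Here `B` is the
ring of integers of `E`. -/
theorem isTamelyRamified_of_isNormalClosure {F E M B : Type*} [Field F] [Field E] [Field M]
    [Algebra A F] [IsFractionRing A F] [Algebra F E] [Algebra F M] [Algebra E M]
    [IsScalarTower F E M] [FiniteDimensional F M] [IsGalois F M] [IsNormalClosure F E M]
    [Algebra A M] [IsScalarTower A F M] [Algebra A E] [IsScalarTower A F E]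
    [CommRing B] [Algebra A B] [Algebra B E] [IsScalarTower A B E] [IsIntegralClosure B A E]
    (hB : ∀ Q : Ideal B, Q.IsPrime → Q ≠ ⊥ →
      ¬ ringChar (IsLocalRing.ResidueField A) ∣ Q.ramificationIdx A) :
    IsTamelyRamified A M := by
  have : IsScalarTower A E M := by
    refine IsScalarTower.of_algebraMap_eq fun a => ?_
    rw [IsScalarTower.algebraMap_apply A F M, IsScalarTower.algebraMap_apply A F E,
      ← IsScalarTower.algebraMap_apply F E M]
  have : FiniteDimensional F E := FiniteDimensional.left F E M
  have : Algebra.IsSeparable F E := Algebra.isSeparable_tower_bot_of_isSeparable F E M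
  let C := integralClosure A M
  have : IsDomain B := (IsIntegralClosure.equiv A B E (integralClosure A E)).toMulEquiv.isDomain _
  have : IsDedekindDomain B := IsIntegralClosure.isDedekindDomain A F E B
  have : IsFractionRing B E := IsIntegralClosure.isFractionRing_of_finite_extension A F E B
  have : IsDedekindDomain C := IsIntegralClosure.isDedekindDomain A F M C
  have : IsFractionRing C M := IsIntegralClosure.isFractionRing_of_finite_extension A F M C
  have : Module.Finite A C := IsIntegralClosure.finite A F M C
  have : Module.Finite A B := IsIntegralClosure.finite A F E B
  let j : B →+* C := ((algebraMap E M).comp (algebraMap B E)).codRestrict C.toSubring fun x =>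
    ((IsIntegralClosure.isIntegral A E x).algebraMap (B := E)).algebraMap
  let : Algebra B C := j.toAlgebra
  let : Algebra B M := ((algebraMap E M).comp (algebraMap B E)).toAlgebra
  have : IsScalarTower B C M := IsScalarTower.of_algebraMap_eq' rfl
  have : IsScalarTower B E M := IsScalarTower.of_algebraMap_eq' rfl
  have : IsScalarTower A B M := by
    refine IsScalarTower.of_algebraMap_eq fun a => ?_
    rw [IsScalarTower.algebraMap_apply B E M, ← IsScalarTower.algebraMap_apply A B E,
      ← IsScalarTower.algebraMap_apply A E M]
  have : IsScalarTower A B C := by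
    refine IsScalarTower.of_algebraMap_eq fun a => FaithfulSMul.algebraMap_injective C M ?_
    rw [← IsScalarTower.algebraMap_apply B C M, ← IsScalarTower.algebraMap_apply A C M,
      ← IsScalarTower.algebraMap_apply A B M]
  have : Algebra.IsIntegral B C := Algebra.IsIntegral.tower_top A
  have : Module.Finite B C := Module.Finite.of_restrictScalars_finite A B C
  have : FaithfulSMul B C := (faithfulSMul_iff_algebraMap_injective B C).mpr <| by
    have : Function.Injective (algebraMap B M) :=
      (algebraMap E M).injective.comp (FaithfulSMul.algebraMap_injective B E)
    rw [IsScalarTower.algebraMap_eq B C M, RingHom.coe_comp] at this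
    exact Function.Injective.of_comp this
  have : FaithfulSMul A C := (faithfulSMul_iff_algebraMap_injective A C).mpr <| by
    have : Function.Injective (algebraMap A M) := by
      rw [IsScalarTower.algebraMap_eq A F M]
      exact (algebraMap F M).injective.comp (IsFractionRing.injective A F)
    rw [IsScalarTower.algebraMap_eq A C M, RingHom.coe_comp] at this
    exact Function.Injective.of_comp this
  have : IsGaloisGroup Gal(M/F) A C := IsGaloisGroup.of_isFractionRing _ A C F M
  let H := fixingSubgroup Gal(M/F) (Set.range (algebraMap E M))
  have : IsGaloisGroup H E M := IsGaloisGroup.of_isScalarTower Gal(M/F) F M E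
  have : IsGaloisGroup H B C := IsGaloisGroup.of_isFractionRing H B C E M
  have : FaithfulSMul Gal(M/F) C := IsGaloisGroup.faithful A
  have hpp : Fact (ringChar (IsLocalRing.ResidueField A)).Prime :=
    ⟨(CharP.char_is_prime_or_zero (IsLocalRing.ResidueField A) _).resolve_right
      (CharP.ringChar_ne_zero_of_finite _)⟩
  have hcard : ∀ P : Ideal C, P.IsPrime → P ≠ ⊥ →
      Nat.card (P.inertia Gal(M/F)) = P.ramificationIdx A := by
    intro P hP hP0
    have := liesOver_maximalIdeal (A := A) hP hP0
    have : Finite (A ⧸ IsLocalRing.maximalIdeal A) :=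
      inferInstanceAs (Finite (IsLocalRing.ResidueField A))
    exact card_inertia_eq_ramificationIdx (IsLocalRing.maximalIdeal A) P
  rw [isTamelyRamified_iff]
  intro P hP hP0
  rw [← hcard P hP hP0]
  refine not_dvd_card_inertia (fun P hP hP0 => ?_) (normalCore_fixingSubgroup_eq_bot (E := E))
    (fun P hP hP0 => ?_) hP hP0
  · rw [← Ideal.Quotient.eq_zero_iff_mem, map_natCast]
    exact (natCast_eq_zero_iff_dvd (A := A) hP hP0 _).mpr dvd_rfl
  · -- the index of `I ∩ H` in the inertia group `I` is the ramification index below `P`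
    let Q := P.under B
    have hQ : Q.IsPrime := Ideal.IsPrime.under B P
    have hQ0 : Q ≠ ⊥ := Ideal.IsIntegral.comap_ne_bot B hP0
    have : Q.IsMaximal := hQ.isMaximal hQ0
    have : Finite (B ⧸ Q) := finite_quotient (A := A) hQ hQ0
    have h1 : Nat.card (P.inertia H) = P.ramificationIdx B := card_inertia_eq_ramificationIdx Q P
    have h2 : P.ramificationIdx A = Q.ramificationIdx A * P.ramificationIdx B :=
      Ideal.ramificationIdx_tower Q P
    have h3 : Nat.card (P.inertia H) = Nat.card (H.subgroupOf (P.inertia Gal(M/F))) := by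
      refine Nat.card_congr
        { toFun := fun σ => ⟨⟨σ.1.1, σ.2⟩, σ.1.2⟩
          invFun := fun σ => ⟨⟨σ.1.1, σ.2⟩, σ.1.2⟩
          left_inv := fun _ => rfl
          right_inv := fun _ => rfl }
    have h4 := (H.subgroupOf (P.inertia Gal(M/F))).card_mul_index
    rw [← h3, hcard P hP hP0, h2, h1, mul_comm] at h4
    have h5 : H.relIndex (P.inertia Gal(M/F)) = Q.ramificationIdx A :=
      Nat.eq_of_mul_eq_mul_right (h1 ▸ Nat.card_pos) h4
    rw [h5]
    exact hB Q hQ hQ0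

end GaloisClosureTame

/-! ### Powers of a uniformizer in characteristic `p` -/

section FrobeniusSum

variable (p : ℕ) [hpp : Fact p.Prime]

/-- The additive map `(y i) ↦ ∑ w ^ i * (y i) ^ p` in characteristic `p`. -/
def frobeniusSum {R : Type*} [CommRing R] [CharP R p] (w : R) : (Fin p → R) →+ R where
  toFun y := ∑ i : Fin p, w ^ (i : ℕ) * y i ^ p
  map_zero' := by simp [hpp.out.ne_zero]
  map_add' y z := by
    simp only [Pi.add_apply, add_pow_char, mul_add, Finset.sum_add_distrib]

theorem frobeniusSum_apply {R : Type*} [CommRing R] [CharP R p] (w : R) (y : Fin p → R) :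
    frobeniusSum p w y = ∑ i : Fin p, w ^ (i : ℕ) * y i ^ p := rfl

/-- The exponent `j` may be reduced modulo `p`, because `w ^ p` is a `p`-th power. -/
theorem pow_mul_pow_mem_range_frobeniusSum {R : Type*} [CommRing R] [CharP R p] (w s : R) (j : ℕ) :
    w ^ j * s ^ p ∈ (frobeniusSum p w).range := by
  refine ⟨Pi.single ⟨j % p, Nat.mod_lt _ hpp.out.pos⟩ (w ^ (j / p) * s), ?_⟩
  rw [frobeniusSum_apply, Finset.sum_eq_single ⟨j % p, Nat.mod_lt _ hpp.out.pos⟩]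
  · rw [Pi.single_eq_same, mul_pow, ← mul_assoc, ← pow_mul, ← pow_add, Nat.mod_add_div']
  · intro i _ hi
    rw [Pi.single_eq_of_ne hi, zero_pow hpp.out.ne_zero, mul_zero]
  · simp

/-- A compact discrete valuation ring of characteristic `p` with finite residue field is generated
by the powers of a uniformizer as a module over its subring of `p`-th powers. -/
theorem range_frobeniusSum_eq_top {A : Type*} [CommRing A] [IsDomain A] [IsDiscreteValuationRing A]
    [Finite (IsLocalRing.ResidueField A)] [TopologicalSpace A] [IsTopologicalRing A]
    [CompactSpace A] [T2Space A] [CharP A p] {w : A} (hw : Irreducible w) :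
    (frobeniusSum p w).range = ⊤ := by
  have hm : IsLocalRing.maximalIdeal A = Ideal.span {w} := hw.maximalIdeal_eq
  have hchar : CharP (IsLocalRing.ResidueField A) p := by
    refine (CharP.charP_iff_prime_eq_zero hpp.out).mpr ?_
    rw [← map_natCast (IsLocalRing.residue A), CharP.cast_eq_zero, map_zero]
  -- the residue field is perfect
  have hstep : ∀ x : A, ∃ y z : A, x = y ^ p + w * z := by
    intro x
    obtain ⟨r, hr⟩ := (PerfectRing.bijective_frobenius (R := IsLocalRing.ResidueField A) (p := p)).2
      (IsLocalRing.residue A x)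
    obtain ⟨y, rfl⟩ := IsLocalRing.residue_surjective r
    replace hr : IsLocalRing.residue A x = IsLocalRing.residue A (y ^ p) := by
      rw [map_pow]; exact hr.symm
    have h1 : x - y ^ p ∈ IsLocalRing.maximalIdeal A := Ideal.Quotient.eq.mp hr
    rw [hm, Ideal.mem_span_singleton'] at h1
    obtain ⟨z, hz⟩ := h1
    exact ⟨y, z, by rw [mul_comm w, hz]; ring⟩
  have happrox : ∀ (N : ℕ) (x : A) (j : ℕ), ∃ t ∈ (frobeniusSum p w).range, ∃ z,
      w ^ j * x - t = w ^ (j + N) * z := by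
    intro N
    induction N with
    | zero => exact fun x j => ⟨0, zero_mem _, x, by simp⟩
    | succ N ih =>
      intro x j
      obtain ⟨y, z, rfl⟩ := hstep x
      obtain ⟨t, ht, z', hz'⟩ := ih z (j + 1)
      refine ⟨w ^ j * y ^ p + t, add_mem (pow_mul_pow_mem_range_frobeniusSum p w y j) ht, z', ?_⟩
      rw [← show j + 1 + N = j + (N + 1) by ring, ← hz']
      ring
  rw [eq_top_iff]
  intro x _
  -- by compactness, approximate solutions to all orders give an exact one
  let S : ℕ → Set (Fin p → A) := fun N =>
    {y | x - frobeniusSum p w y ∈ IsLocalRing.maximalIdeal A ^ N}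
  have hcont : Continuous fun y : Fin p → A => x - frobeniusSum p w y := by
    simp only [frobeniusSum_apply]
    fun_prop
  have hclosed : ∀ N, IsClosed (S N) := fun N =>
    (IsNoetherianRing.isClosed_ideal (IsLocalRing.maximalIdeal A ^ N)).preimage hcont
  obtain ⟨y, hy⟩ := (hclosed 0).isCompact.nonempty_iInter_of_sequence_nonempty_isCompact_isClosed S
    (fun N y hy => Ideal.pow_le_pow_right N.le_succ hy) (fun N => by
      obtain ⟨t, ⟨y, rfl⟩, z, hz⟩ := happrox N x 0
      refine ⟨y, ?_⟩
      change x - frobeniusSum p w y ∈ IsLocalRing.maximalIdeal A ^ N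
      rw [pow_zero, one_mul, zero_add] at hz
      rw [hz, hm, Ideal.span_singleton_pow]
      exact Ideal.mul_mem_right _ _ (Ideal.mem_span_singleton_self _)) hclosed
  refine ⟨y, ?_⟩
  have h0 : x - frobeniusSum p w y ∈ ⨅ N, IsLocalRing.maximalIdeal A ^ N :=
    (Submodule.mem_iInf _).mpr fun N => Set.mem_iInter.mp hy N
  rw [Ideal.iInf_pow_eq_bot_of_isLocalRing _ (Ideal.IsPrime.ne_top inferInstance),
    Submodule.mem_bot] at h0
  exact (sub_eq_zero.mp h0).symm

theorem range_frobeniusSum_fractionRing_eq_top {A F : Type*} [CommRing A] [IsDomain A] [Field F]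
    [Algebra A F] [IsFractionRing A F] [CharP A p] [CharP F p] {w : A}
    (h : (frobeniusSum p w).range = ⊤) : (frobeniusSum p (algebraMap A F w)).range = ⊤ := by
  rw [eq_top_iff]
  intro x _
  obtain ⟨a, b, hb, rfl⟩ := IsFractionRing.div_surjective A x
  obtain ⟨y, hy⟩ : a * b ^ (p - 1) ∈ (frobeniusSum p w).range := h ▸ AddSubgroup.mem_top _
  have hb0 : algebraMap A F b ≠ 0 := IsFractionRing.to_map_ne_zero_of_mem_nonZeroDivisors hb
  refine ⟨fun i => algebraMap A F (y i) / algebraMap A F b, ?_⟩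
  have h1 := congrArg (algebraMap A F) hy
  rw [frobeniusSum_apply, map_sum, map_mul, map_pow] at h1
  rw [frobeniusSum_apply, eq_div_iff hb0, ← mul_left_inj' (pow_ne_zero (p - 1) hb0), ← h1,
    mul_assoc, ← pow_succ', Nat.sub_add_cancel hpp.out.one_le, Finset.sum_mul]
  refine Finset.sum_congr rfl fun i _ => ?_
  rw [div_pow, mul_assoc, div_mul_cancel₀ _ (pow_ne_zero p hb0), map_mul, map_pow, map_pow]

/-- A separable extension is spanned over the base field by its `p`-th powers, so that the powers of
`w` still generate it over the subfield of `p`-th powers. -/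
theorem range_frobeniusSum_of_isSeparable {F N : Type*} [Field F] [Field N] [Algebra F N]
    [FiniteDimensional F N] [Algebra.IsSeparable F N] [CharP F p] [CharP N p] {w : F}
    (h : (frobeniusSum p w).range = ⊤) : (frobeniusSum p (algebraMap F N w)).range = ⊤ := by
  have hspan : Submodule.span F (Set.range fun x : N => x ^ p) = ⊤ := by
    have := Field.span_map_pow_expChar_pow_eq_top_of_isSeparable (F := F) (E := N) (v := id) p 1
      (by rw [Set.range_id, Submodule.span_univ])
    simpa only [pow_one, id] using this
  have hmul : ∀ (f : F) (t : N) (j : ℕ), f • (algebraMap F N w ^ j * t ^ p) ∈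
      (frobeniusSum p (algebraMap F N w)).range := by
    intro f t j
    obtain ⟨y, hy⟩ : f ∈ (frobeniusSum p w).range := h ▸ AddSubgroup.mem_top _
    rw [← hy, frobeniusSum_apply, Finset.sum_smul]
    refine sum_mem fun i _ => ?_
    have e : (w ^ (i : ℕ) * y i ^ p) • (algebraMap F N w ^ j * t ^ p) =
        algebraMap F N w ^ ((i : ℕ) + j) * (algebraMap F N (y i) * t) ^ p := by
      rw [Algebra.smul_def, map_mul, map_pow, map_pow, mul_pow, pow_add]; ring
    rw [e]
    exact pow_mul_pow_mem_range_frobeniusSum p _ _ _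
  rw [eq_top_iff]
  intro x _
  have hx : x ∈ Submodule.span F (Set.range fun x : N => x ^ p) := hspan ▸ Submodule.mem_top
  induction hx using Submodule.span_induction with
  | mem x hx =>
    obtain ⟨t, rfl⟩ := hx
    simpa using pow_mul_pow_mem_range_frobeniusSum p (algebraMap F N w) t 0
  | zero => exact zero_mem _
  | add x y _ _ hx hy => exact add_mem (hx trivial) (hy trivial)
  | smul f x _ hx =>
    obtain ⟨y, rfl⟩ := hx trivial
    rw [frobeniusSum_apply, Finset.smul_sum]
    exact sum_mem fun i _ => hmul f (y i) i

/-- If `w` generates `F` over its subfield of `p`-th powers, then `w` becomes a `p`-th power in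
every inseparable finite extension. -/
theorem exists_pow_eq_of_not_isSeparable {F K : Type*} [Field F] [Field K] [Algebra F K]
    [FiniteDimensional F K] [CharP F p] {w : F} (h : (frobeniusSum p w).range = ⊤)
    (hK : ¬ Algebra.IsSeparable F K) : ∃ y : K, y ^ p = algebraMap F K w := by
  have : CharP K p := charP_of_injective_algebraMap (algebraMap F K).injective p
  have : ExpChar K p := ExpChar.prime hpp.out
  let N := separableClosure F K
  have : CharP N p := charP_of_injective_algebraMap (algebraMap F N).injective p
  have : ExpChar N p := ExpChar.prime hpp.out
  -- an element outside the separable closure whose `p`-th power lies inside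
  obtain ⟨x, hxN, hxp⟩ : ∃ x : K, x ∉ N ∧ x ^ p ∈ N := by
    obtain ⟨x₀, hx₀⟩ : ∃ x₀ : K, x₀ ∉ N := by
      by_contra hcon
      push Not at hcon
      exact hK ((separableClosure.eq_top_iff F K).mp (eq_top_iff.mpr fun x _ => hcon x))
    have hex : ∃ n, x₀ ^ p ^ n ∈ N := by
      obtain ⟨n, y, hy⟩ := IsPurelyInseparable.pow_mem N p x₀
      exact ⟨n, hy ▸ y.2⟩
    classical
    obtain ⟨n, hn⟩ : ∃ n, Nat.find hex = n + 1 := by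
      refine Nat.exists_eq_succ_of_ne_zero fun h0 => hx₀ ?_
      have := Nat.find_spec hex
      rwa [h0, pow_zero, pow_one] at this
    refine ⟨x₀ ^ p ^ n, Nat.find_min hex (by omega), ?_⟩
    rw [← pow_mul, ← pow_succ, ← hn]
    exact Nat.find_spec hex
  let z : N := ⟨x ^ p, hxp⟩
  let k₀ : Subfield N := (frobenius N p).fieldRange
  have hpow : ∀ s : N, s ^ p ∈ k₀ := fun s => ⟨s, rfl⟩
  let W : N := algebraMap F N w
  have hNtop := range_frobeniusSum_of_isSeparable (N := N) p h
  have hspan : Submodule.span k₀ (Set.range fun i : Fin p => W ^ (i : ℕ)) = ⊤ := by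
    rw [eq_top_iff]
    intro s _
    obtain ⟨y, rfl⟩ : s ∈ (frobeniusSum p W).range := hNtop ▸ AddSubgroup.mem_top _
    rw [frobeniusSum_apply]
    refine Submodule.sum_mem _ fun i _ => ?_
    have := Submodule.smul_mem (Submodule.span k₀ (Set.range fun i : Fin p => W ^ (i : ℕ)))
      (⟨_, hpow (y i)⟩ : k₀) (Submodule.subset_span ⟨i, rfl⟩)
    rwa [Subfield.smul_def, smul_eq_mul, mul_comm] at this
  -- `N` has degree at most `p` over its subfield of `p`-th powers, and `z` already generates an
  -- extension of degree `p`; so `W` is a polynomial in `z = x ^ p` whose coefficients are `p`-th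
  -- powers
  have hfin : FiniteDimensional k₀ N :=
    ⟨Submodule.fg_def.mpr ⟨_, Set.finite_range fun i : Fin p => W ^ (i : ℕ), hspan⟩⟩
  have hrank : Module.finrank k₀ N ≤ p := by
    have := finrank_range_le_card (R := k₀) fun i : Fin p => W ^ (i : ℕ)
    rwa [Set.finrank, hspan, finrank_top, Fintype.card_fin] at this
  have hirr : Irreducible (Polynomial.X ^ p - Polynomial.C (⟨z ^ p, hpow z⟩ : k₀)) := by
    refine X_pow_sub_C_irreducible_of_prime hpp.out fun b hb => hxN ?_
    have h1 : (b : N) ^ p = z ^ p := congrArg Subtype.val hb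
    have h2 : (b : N) = z := frobenius_inj N p h1
    obtain ⟨s, hs⟩ := b.2
    have h3 : (s : K) ^ p = x ^ p := congrArg Subtype.val (hs.trans h2)
    rw [← frobenius_inj K p h3]
    exact s.2
  have hmin : minpoly k₀ z = Polynomial.X ^ p - Polynomial.C (⟨z ^ p, hpow z⟩ : k₀) := by
    refine (minpoly.eq_of_irreducible_of_monic hirr ?_
      (Polynomial.monic_X_pow_sub_C _ hpp.out.ne_zero)).symm
    rw [map_sub, map_pow, Polynomial.aeval_X, Polynomial.aeval_C]
    exact sub_self _
  have htop : IntermediateField.adjoin k₀ {z} = ⊤ := by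
    refine IntermediateField.eq_of_le_of_finrank_le le_top ?_
    rw [IntermediateField.finrank_top',
      IntermediateField.adjoin.finrank (Algebra.IsIntegral.isIntegral z),
      hmin, Polynomial.natDegree_X_pow_sub_C]
    exact hrank
  have hadj := Algebra.adjoin_eq_top_of_primitive_element (.of_finite k₀ z) htop
  have hW : W ∈ Algebra.adjoin k₀ {z} := hadj ▸ Algebra.mem_top
  have key : ∀ s ∈ Algebra.adjoin k₀ {z}, ∃ y : K, y ^ p = (s : K) := by
    intro s hs
    induction hs using Algebra.adjoin_induction with
    | mem s hs => exact ⟨x, by rw [Set.mem_singleton_iff.mp hs]⟩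
    | algebraMap r =>
      obtain ⟨s, hs⟩ := r.2
      exact ⟨s, congrArg Subtype.val hs⟩
    | add a b _ _ ha hb =>
      obtain ⟨y, hy⟩ := ha
      obtain ⟨y', hy'⟩ := hb
      exact ⟨y + y', by rw [add_pow_char, hy, hy']; rfl⟩
    | mul a b _ _ ha hb =>
      obtain ⟨y, hy⟩ := ha
      obtain ⟨y', hy'⟩ := hb
      exact ⟨y * y', by rw [mul_pow, hy, hy']; rfl⟩
  exact key W hW

end FrobeniusSum

/-! ### Tame extensions of local fields are separable -/

section TameSeparable

/-- If a uniformizer of the base becomes a `p`-th power, then `p` divides all ramification indices.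
-/
theorem dvd_ramificationIdx_of_pow_eq {A B : Type*} [CommRing A] [IsDomain A]
    [IsDiscreteValuationRing A] [CommRing B] [IsDomain B] [Algebra A B] [Algebra.IsIntegral A B]
    {w : A} (hw : Irreducible w) {y : B} (hw0 : algebraMap A B w ≠ 0) {p : ℕ} (hp : p ≠ 0)
    (hy : y ^ p = algebraMap A B w) {Q : Ideal B} (hQ : Q.IsPrime) (hQ0 : Q ≠ ⊥) :
    p ∣ Q.ramificationIdx A := by
  have := liesOver_maximalIdeal (A := A) hQ hQ0
  let S := Localization.AtPrime Q
  have hy0 : y ≠ 0 := by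
    rintro rfl
    rw [zero_pow hp] at hy
    exact hw0 hy.symm
  have h1 : (IsLocalRing.maximalIdeal A).map (algebraMap A S) =
      Ideal.span {algebraMap B S y ^ p} := by
    rw [hw.maximalIdeal_eq, Ideal.map_span, Set.image_singleton,
      IsScalarTower.algebraMap_apply A B S, ← hy, map_pow]
  have h2 : algebraMap B S y ∈ nonZeroDivisors S := by
    refine mem_nonZeroDivisors_of_ne_zero fun h => hy0 ?_
    exact (IsLocalization.injective S Q.primeCompl_le_nonZeroDivisors) (by rw [h, map_zero])
  rw [Ideal.ramificationIdx_eq (IsLocalRing.maximalIdeal A), h1]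
  change p ∣ (Ring.ord S (algebraMap B S y ^ p)).toNat
  rw [Ring.ord_pow h2, nsmul_eq_mul, ENat.toNat_mul, ENat.toNat_natCast]
  exact dvd_mul_right _ _

theorem exists_isPrime_ne_bot (A B : Type*) [CommRing A] [IsDomain A]
    [IsDiscreteValuationRing A] [CommRing B] [IsDomain B] [Algebra A B]
    [Algebra.IsIntegral A B] [FaithfulSMul A B] : ∃ Q : Ideal B, Q.IsPrime ∧ Q ≠ ⊥ := by
  obtain ⟨Q, hQ, hQm⟩ := Ideal.exists_ideal_over_maximal_of_isIntegral (S := B)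
    (IsLocalRing.maximalIdeal A) (by
      rw [(RingHom.injective_iff_ker_eq_bot _).mp (FaithfulSMul.algebraMap_injective A B)]
      exact bot_le)
  refine ⟨Q, hQ.isPrime, ?_⟩
  rintro rfl
  refine IsDiscreteValuationRing.not_a_field A (hQm.symm.trans ?_)
  exact (RingHom.injective_iff_ker_eq_bot _).mp (FaithfulSMul.algebraMap_injective A B)

/-- Tame ramification is transitive in towers. -/
theorem not_dvd_ramificationIdx_of_tower {A B B' : Type*} [CommRing A] [IsDomain A]
    [IsDiscreteValuationRing A] [Finite (IsLocalRing.ResidueField A)]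
    [CommRing B] [IsDedekindDomain B] [CommRing B'] [IsDomain B'] [Algebra A B] [Algebra B B']
    [Algebra A B'] [IsScalarTower A B B'] [Algebra.IsIntegral A B] [Algebra.IsIntegral B B']
    [FaithfulSMul B B']
    (h : ∀ P : Ideal B, P.IsPrime → P ≠ ⊥ →
      ¬ ringChar (IsLocalRing.ResidueField A) ∣ P.ramificationIdx A)
    (h' : ∀ Q : Ideal B', Q.IsPrime → Q ≠ ⊥ → ((Q.ramificationIdx B : ℕ) : B' ⧸ Q) ≠ 0) :
    ∀ Q : Ideal B', Q.IsPrime → Q ≠ ⊥ →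
      ¬ ringChar (IsLocalRing.ResidueField A) ∣ Q.ramificationIdx A := by
  have hint : Algebra.IsIntegral A B' := Algebra.IsIntegral.trans B
  have hp : Prime (ringChar (IsLocalRing.ResidueField A)) :=
    ((CharP.char_is_prime_or_zero (IsLocalRing.ResidueField A) _).resolve_right
      (CharP.ringChar_ne_zero_of_finite _)).prime
  intro Q hQ hQ0
  have h1 : Q.ramificationIdx A = (Q.under B).ramificationIdx A * Q.ramificationIdx B :=
    Ideal.ramificationIdx_tower (Q.under B) Q
  rw [h1]
  refine hp.not_dvd_mul (h _ (Ideal.IsPrime.under B Q) (Ideal.IsIntegral.comap_ne_bot B hQ0)) ?_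
  have := h' Q hQ hQ0
  rwa [ne_eq, natCast_eq_zero_iff_dvd (A := A) hQ hQ0] at this

/-- Formation of integral closures is transitive. -/
theorem isIntegralClosure_trans (A B B' K : Type*) [CommRing A] [CommRing B] [CommRing B']
    [CommRing K] [Algebra A B] [Algebra B B'] [Algebra A B'] [IsScalarTower A B B'] [Algebra A K]
    [Algebra B K] [Algebra B' K] [IsScalarTower A B K] [IsScalarTower A B' K]
    [Algebra.IsIntegral A B] [IsIntegralClosure B' B K] [Algebra.IsIntegral B B'] :
    IsIntegralClosure B' A K where
  algebraMap_injective := IsIntegralClosure.algebraMap_injective B' B K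
  isIntegral_iff {x} := by
    have hint : Algebra.IsIntegral A B' := Algebra.IsIntegral.trans B
    refine ⟨fun hx => (IsIntegralClosure.isIntegral_iff (R := B)).mp hx.tower_top, ?_⟩
    rintro ⟨y, rfl⟩
    exact (hint.isIntegral y).algebraMap

variable {F : Type u} [Field F] [ValuativeRel F] [TopologicalSpace F] [IsNonarchimedeanLocalField F]

open ValuativeRel in
/-- If a finite extension of a local field is inseparable, then the residue characteristic divides
its ramification indices, because a uniformizer becomes a `p`-th power. -/
theorem ringChar_dvd_ramificationIdx_of_not_isSeparable {K : Type u} [Field K] [Algebra F K]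
    [FiniteDimensional F K] (hK : ¬ Algebra.IsSeparable F K) {B : Type u} [CommRing B]
    [Algebra 𝒪[F] B] [Algebra B K] [IsScalarTower 𝒪[F] B K] [IsIntegralClosure B 𝒪[F] K]
    {Q : Ideal B} (hQ : Q.IsPrime) (hQ0 : Q ≠ ⊥) :
    ringChar (IsLocalRing.ResidueField 𝒪[F]) ∣ Q.ramificationIdx 𝒪[F] := by
  obtain ⟨p, hp⟩ := CharP.exists F
  rcases CharP.char_is_prime_or_zero F p with hpp | rfl
  · have : Fact p.Prime := ⟨hpp⟩
    have : CharP 𝒪[F] p :=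
      (CharP.charP_iff_prime_eq_zero hpp).mpr (Subtype.ext (CharP.cast_eq_zero F p))
    obtain ⟨w, hw⟩ := IsDiscreteValuationRing.exists_irreducible 𝒪[F]
    have : T2Space F := by
      let := IsTopologicalAddGroup.rightUniformSpace F
      have := isUniformAddGroup_of_addCommGroup (G := F)
      infer_instance
    have h1 := range_frobeniusSum_fractionRing_eq_top (F := F) p (range_frobeniusSum_eq_top p hw)
    obtain ⟨y, hy⟩ := exists_pow_eq_of_not_isSeparable p h1 hK
    have hy' : IsIntegral 𝒪[F] y := by
      refine IsIntegral.of_pow hpp.pos ?_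
      rw [hy, ← IsScalarTower.algebraMap_apply]
      exact isIntegral_algebraMap
    let y' : B := IsIntegralClosure.mk' B y hy'
    have hinj := IsIntegralClosure.algebraMap_injective B 𝒪[F] K
    have hyy : y' ^ p = algebraMap 𝒪[F] B w := hinj <| by
      rw [map_pow, IsIntegralClosure.algebraMap_mk', hy, ← IsScalarTower.algebraMap_apply,
        ← IsScalarTower.algebraMap_apply]
    have : IsDomain B := hinj.isDomain
    have : Algebra.IsIntegral 𝒪[F] B := IsIntegralClosure.isIntegral_algebra 𝒪[F] K
    have hchar : ringChar (IsLocalRing.ResidueField 𝒪[F]) = p := by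
      have h2 : CharP (IsLocalRing.ResidueField 𝒪[F]) p := by
        refine (CharP.charP_iff_prime_eq_zero hpp).mpr ?_
        rw [← map_natCast (IsLocalRing.residue 𝒪[F]), CharP.cast_eq_zero, map_zero]
      exact (ringChar.eq_iff).mpr h2
    rw [hchar]
    refine dvd_ramificationIdx_of_pow_eq hw (fun h => hw.ne_zero ?_) hpp.ne_zero hyy hQ hQ0
    have h3 : algebraMap 𝒪[F] K w = 0 := by
      rw [IsScalarTower.algebraMap_apply 𝒪[F] B K, h, map_zero]
    rw [IsScalarTower.algebraMap_apply 𝒪[F] F K, map_eq_zero] at h3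
    exact Subtype.ext h3
  · have : CharZero F := CharP.charP_to_charZero F
    exact absurd Algebra.IsAlgebraic.isSeparable_of_perfectField hK

open ValuativeRel in
theorem faithfulSMul_integer {F : Type u} [Field F] [ValuativeRel F] (K : Type u)
    [Field K] [Algebra F K] {B : Type u} [CommRing B] [Algebra 𝒪[F] B] [Algebra B K]
    [IsScalarTower 𝒪[F] B K] : FaithfulSMul 𝒪[F] B := by
  refine (faithfulSMul_iff_algebraMap_injective _ _).mpr ?_
  have h : Function.Injective (algebraMap 𝒪[F] K) := by
    rw [IsScalarTower.algebraMap_eq 𝒪[F] F K]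
    exact (algebraMap F K).injective.comp (IsFractionRing.injective 𝒪[F] F)
  rw [IsScalarTower.algebraMap_eq 𝒪[F] B K, RingHom.coe_comp] at h
  exact h.of_comp

open ValuativeRel in
/-- A finite extension of a local field with tame ramification is separable, and its normal closure
is tamely ramified. -/
theorem exists_tamelyRamified_galois_of_not_dvd {K : Type u} [Field K] [Algebra F K]
    [FiniteDimensional F K] {B : Type u} [CommRing B] [IsDomain B]
    [Algebra 𝒪[F] B] [Algebra B K] [IsScalarTower 𝒪[F] B K] [IsIntegralClosure B 𝒪[F] K]
    (hB : ∀ Q : Ideal B, Q.IsPrime → Q ≠ ⊥ →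
      ¬ ringChar (IsLocalRing.ResidueField 𝒪[F]) ∣ Q.ramificationIdx 𝒪[F]) :
    Algebra.IsSeparable F K ∧ ∃ (L : Type u) (_ : Field L) (_ : Algebra F L),
      FiniteDimensional F L ∧ IsGalois F L ∧ IsTamelyRamified 𝒪[F] L ∧
        ∀ x : K, ((minpoly F x).map (algebraMap F L)).Splits := by
  have hsep : Algebra.IsSeparable F K := by
    by_contra hcon
    have := faithfulSMul_integer (F := F) K (B := B)
    have : Algebra.IsIntegral 𝒪[F] B := IsIntegralClosure.isIntegral_algebra 𝒪[F] K
    obtain ⟨Q, hQ, hQ0⟩ := exists_isPrime_ne_bot 𝒪[F] B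
    exact hB Q hQ hQ0 (ringChar_dvd_ramificationIdx_of_not_isSeparable hcon hQ hQ0)
  have : IsSepClosure F (SeparableClosure K) :=
    ⟨inferInstance, Algebra.IsSeparable.trans F K (SeparableClosure K)⟩
  have : IsGalois F (SeparableClosure K) := IsSepClosure.isGalois
  let L := IntermediateField.normalClosure F K (SeparableClosure K)
  have : Nonempty (K →ₐ[F] SeparableClosure K) :=
    ⟨IsScalarTower.toAlgHom F K (SeparableClosure K)⟩
  have hnc : IsNormalClosure F K L := isNormalClosure_normalClosure F K (SeparableClosure K)
  have hgal : IsGalois F L := IsGalois.normalClosure F K (SeparableClosure K)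
  exact ⟨hsep, L, inferInstance, inferInstance, inferInstance, hgal,
    isTamelyRamified_of_isNormalClosure (F := F) (E := K) (B := B) hB, hnc.splits⟩

open ValuativeRel in
/-- A tamely ramified tower of extensions of a local field is separable and contained in a finite
tamely ramified Galois extension; the rings of integers are given by arbitrary models. -/
theorem exists_tamelyRamified_galois_of_tower {E E' : Type u} [Field E] [Field E'] [Algebra F E]
    [Algebra E E'] [Algebra F E'] [IsScalarTower F E E'] [FiniteDimensional F E]
    [FiniteDimensional E E'] {B B' : Type u} [CommRing B] [IsDedekindDomain B] [CommRing B']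
    [IsDomain B'] [Algebra 𝒪[F] B] [Algebra 𝒪[F] B'] [Algebra B B'] [IsScalarTower 𝒪[F] B B']
    [Algebra B E'] [Algebra B' E'] [IsScalarTower 𝒪[F] B E'] [IsScalarTower 𝒪[F] B' E']
    [IsScalarTower B B' E'] [Algebra.IsIntegral 𝒪[F] B] [FaithfulSMul B E']
    [IsIntegralClosure B' B E']
    (h : ∀ P : Ideal B, P.IsPrime → P ≠ ⊥ →
      ¬ ringChar (IsLocalRing.ResidueField 𝒪[F]) ∣ P.ramificationIdx 𝒪[F])
    (h' : ∀ Q : Ideal B', Q.IsPrime → Q ≠ ⊥ → ((Q.ramificationIdx B : ℕ) : B' ⧸ Q) ≠ 0) :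
    Algebra.IsSeparable F E' ∧ ∃ (L : Type u) (_ : Field L) (_ : Algebra F L),
      FiniteDimensional F L ∧ IsGalois F L ∧ IsTamelyRamified 𝒪[F] L ∧
        ∀ x : E', ((minpoly F x).map (algebraMap F L)).Splits := by
  have hfin : FiniteDimensional F E' := FiniteDimensional.trans F E E'
  have hint : Algebra.IsIntegral B B' := IsIntegralClosure.isIntegral_algebra B E'
  have hclosure := isIntegralClosure_trans 𝒪[F] B B' E'
  have hfaith : FaithfulSMul B B' := by
    refine (faithfulSMul_iff_algebraMap_injective _ _).mpr ?_
    have h2 := FaithfulSMul.algebraMap_injective B E'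
    rw [IsScalarTower.algebraMap_eq B B' E', RingHom.coe_comp] at h2
    exact h2.of_comp
  exact exists_tamelyRamified_galois_of_not_dvd (not_dvd_ramificationIdx_of_tower h h')

open ValuativeRel in
/-- The variant of `exists_tamelyRamified_galois_of_tower` in which the upper ring of integers is
the integral closure. -/
theorem exists_tamelyRamified_galois_of_isTamelyRamified {E E' : Type u} [Field E] [Field E']
    [Algebra F E] [Algebra E E'] [Algebra F E'] [IsScalarTower F E E'] [FiniteDimensional F E]
    [FiniteDimensional E E'] {B : Type u} [CommRing B] [IsDedekindDomain B]
    [Algebra 𝒪[F] B] [Algebra B E'] [IsScalarTower 𝒪[F] B E'] [Algebra.IsIntegral 𝒪[F] B]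
    [FaithfulSMul B E']
    (h : ∀ P : Ideal B, P.IsPrime → P ≠ ⊥ →
      ¬ ringChar (IsLocalRing.ResidueField 𝒪[F]) ∣ P.ramificationIdx 𝒪[F])
    (h' : IsTamelyRamified B E') :
    Algebra.IsSeparable F E' ∧ ∃ (L : Type u) (_ : Field L) (_ : Algebra F L),
      FiniteDimensional F L ∧ IsGalois F L ∧ IsTamelyRamified 𝒪[F] L ∧
        ∀ x : E', ((minpoly F x).map (algebraMap F L)).Splits := by
  have t1 : IsScalarTower 𝒪[F] B (integralClosure B E') :=
    IsScalarTower.of_algebraMap_eq fun a => Subtype.ext (IsScalarTower.algebraMap_apply 𝒪[F] B E' a)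
  have t2 : IsScalarTower 𝒪[F] (integralClosure B E') E' :=
    IsScalarTower.of_algebraMap_eq fun a => rfl
  exact exists_tamelyRamified_galois_of_tower (E := E) (B' := integralClosure B E') h h'

open ValuativeRel in
/-- The top field of a tower of finite tamely ramified extensions of a local field is separable over
the base, and its minimal polynomials split in a finite tamely ramified Galois extension. -/
theorem exists_tamelyRamified_galois {E E' : Type u} [Field E] [Field E'] [Algebra F E]
    [Algebra E E'] [Algebra F E'] [IsScalarTower F E E'] [FiniteDimensional F E]
    [FiniteDimensional E E'] (hE : IsTamelyRamified 𝒪[F] E)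
    (hE' : IsTamelyRamified (integralClosure 𝒪[F] E) E') :
    Algebra.IsSeparable F E' ∧ ∃ (L : Type u) (_ : Field L) (_ : Algebra F L),
      FiniteDimensional F L ∧ IsGalois F L ∧ IsTamelyRamified 𝒪[F] L ∧
        ∀ x : E', ((minpoly F x).map (algebraMap F L)).Splits := by
  have hEE' : IsScalarTower 𝒪[F] E E' := by
    refine IsScalarTower.of_algebraMap_eq fun a => ?_
    rw [IsScalarTower.algebraMap_apply 𝒪[F] F E, IsScalarTower.algebraMap_apply 𝒪[F] F E',
      ← IsScalarTower.algebraMap_apply F E E']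
  have hint : Algebra.IsIntegral 𝒪[F] (integralClosure 𝒪[F] E) := inferInstance
  have hBE' : IsScalarTower 𝒪[F] (integralClosure 𝒪[F] E) E' :=
    IsScalarTower.of_algebraMap_eq fun a => IsScalarTower.algebraMap_apply 𝒪[F] E E' a
  have hsep : Algebra.IsSeparable F E :=
    (exists_tamelyRamified_galois_of_not_dvd (isTamelyRamified_iff.mp hE)).1
  have hded : IsDedekindDomain (integralClosure 𝒪[F] E) :=
    IsIntegralClosure.isDedekindDomain 𝒪[F] F E _
  have hinj : FaithfulSMul (integralClosure 𝒪[F] E) E' :=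
    (faithfulSMul_iff_algebraMap_injective _ _).mpr fun x y h =>
      Subtype.ext ((algebraMap E E').injective h)
  have h1 := isTamelyRamified_iff.mp hE
  have h2 := exists_tamelyRamified_galois_of_isTamelyRamified (F := F) (E := E) (E' := E')
    (B := integralClosure 𝒪[F] E)
  have h3 := h2 h1
  exact h3 hE'

end TameSeparable

/-! ### The restriction of scalars of the multiplicative group -/

section UnitsFunctor

open GroupFunctor SubgroupFunctor

/-- A closed subgroup functor of an affine algebraic group is an affine algebraic group. -/
theorem SubgroupFunctor.IsClosed.isAffineAlgebraic {k : Type u} [Field k] {G : GroupFunctor k}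
    (hG : G.IsAffineAlgebraic) {S : SubgroupFunctor G} (hS : S.IsClosed) :
    S.toFunctor.IsAffineAlgebraic := by
  obtain ⟨R, hR, hrep⟩ := hG
  obtain ⟨x, hx⟩ := hrep.exists_universal
  obtain ⟨I, hI⟩ := hS R x
  let q : R ⟶ CommAlgCat.of k (R ⧸ I) := CommAlgCat.ofHom (Ideal.Quotient.mkₐ k I)
  have hq : G.map q x ∈ S.obj _ := (hI _ q).mpr fun a ha => Ideal.Quotient.eq_zero_iff_mem.mpr ha
  refine ⟨CommAlgCat.of k (R ⧸ I),
    Algebra.FiniteType.of_surjective (Ideal.Quotient.mkₐ k I) (Ideal.Quotient.mkₐ_surjective k I),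
    isRepresentedBy_of_universal (⟨G.map q x, hq⟩ : S.toFunctor.obj _) fun A => ⟨?_, ?_⟩⟩
  · intro f g hfg
    have h1 : G.map f (G.map q x) = G.map g (G.map q x) := congrArg Subtype.val hfg
    rw [← GrpCat.comp_apply, ← GrpCat.comp_apply, ← G.map_comp, ← G.map_comp] at h1
    have h2 := (hx A).1 h1
    refine CommAlgCat.hom_ext (Ideal.Quotient.algHom_ext k ?_)
    exact congrArg CommAlgCat.Hom.hom h2
  · rintro ⟨s, hs⟩
    obtain ⟨f, rfl⟩ := (hx A).2 s
    have hf := (hI A f).mp hs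
    refine ⟨CommAlgCat.ofHom (Ideal.Quotient.liftₐ I f.hom hf), Subtype.ext ?_⟩
    change G.map _ (G.map q x) = _
    rw [← GrpCat.comp_apply, ← G.map_comp]
    congr 2

variable {F : Type u} [Field F]

/-- The map `W ⊗ A → W ⊗ B` induced by `A → B`. -/
abbrev tensorMap (W : Type u) [CommRing W] [Algebra F W] {A B : Type u} [CommRing A] [Algebra F A]
    [CommRing B] [Algebra F B] (f : A →ₐ[F] B) : W ⊗[F] A →ₐ[F] W ⊗[F] B :=
  Algebra.TensorProduct.map (AlgHom.id F W) f

section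
variable {W : Type u} [CommRing W] [Algebra F W]

theorem equivFinsuppOfBasisLeft_tensorMap {ι : Type*} [DecidableEq ι] (b : Module.Basis ι F W)
    {A B : Type u}
    [CommRing A] [Algebra F A] [CommRing B] [Algebra F B] (f : A →ₐ[F] B) (z : W ⊗[F] A) (i : ι) :
    TensorProduct.equivFinsuppOfBasisLeft b (tensorMap W f z) i =
      f (TensorProduct.equivFinsuppOfBasisLeft b z i) := by
  induction z with
  | zero => simp
  | add x y hx hy => simp only [map_add, Finsupp.add_apply, hx, hy]
  | tmul w a => simp

theorem tensorMap_comp_apply {A B C : Type u} [CommRing A] [Algebra F A] [CommRing B]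
    [Algebra F B] [CommRing C] [Algebra F C] (g : B →ₐ[F] C) (f : A →ₐ[F] B) (z : W ⊗[F] A) :
    tensorMap W (g.comp f) z = tensorMap W g (tensorMap W f z) := by
  induction z with
  | zero => simp
  | add x y hx hy => simp only [map_add, hx, hy]
  | tmul w a => simp

theorem tensorMap_id_apply {A : Type u} [CommRing A] [Algebra F A] (z : W ⊗[F] A) :
    tensorMap W (AlgHom.id F A) z = z := by
  rw [tensorMap, Algebra.TensorProduct.map_id, AlgHom.id_apply]

theorem tensorMap_injective {A B : Type u} [CommRing A] [Algebra F A] [CommRing B] [Algebra F B]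
    {f : A →ₐ[F] B} (hf : Function.Injective f) : Function.Injective (tensorMap W f) :=
  Module.Flat.lTensor_preserves_injective_linearMap (M := W) f.toLinearMap hf

/-- The vanishing of an element of `W ⊗ A` is a closed condition on `Spec A`. -/
theorem exists_ideal_tensorMap_eq_zero_iff {A : Type u} [CommRing A] [Algebra F A] (z : W ⊗[F] A) :
    ∃ I : Ideal A, ∀ (B : Type u) [CommRing B] [Algebra F B] (f : A →ₐ[F] B),
      tensorMap W f z = 0 ↔ ∀ a ∈ I, f a = 0 := by
  classical
  let b := Module.Free.chooseBasis F W
  refine ⟨Ideal.span (Set.range fun i => TensorProduct.equivFinsuppOfBasisLeft b z i), ?_⟩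
  intro B _ _ f
  have h1 : (∀ a ∈ Ideal.span (Set.range fun i => TensorProduct.equivFinsuppOfBasisLeft b z i),
      f a = 0) ↔ ∀ i, f (TensorProduct.equivFinsuppOfBasisLeft b z i) = 0 := by
    constructor
    · exact fun h i => h _ (Ideal.subset_span ⟨i, rfl⟩)
    · intro h a ha
      have : Ideal.span (Set.range fun i => TensorProduct.equivFinsuppOfBasisLeft b z i) ≤
          RingHom.ker f := Ideal.span_le.mpr (by rintro _ ⟨i, rfl⟩; exact h i)
      exact this ha
  rw [h1, ← (TensorProduct.equivFinsuppOfBasisLeft b).map_eq_zero_iff, Finsupp.ext_iff]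
  simp only [equivFinsuppOfBasisLeft_tensorMap, Finsupp.zero_apply]

end

/-- The group functor `A ↦ (W ⊗ A)ˣ` of units of an algebra `W`, that is `Res_{W/F} G_m`. -/
def unitsFunctor (F W : Type u) [Field F] [CommRing W] [Algebra F W] : GroupFunctor F where
  obj A := GrpCat.of (W ⊗[F] A)ˣ
  map {A B} f := GrpCat.ofHom (Units.map (tensorMap W f.hom : W ⊗[F] A →* W ⊗[F] B))
  map_id _ := GrpCat.hom_ext (MonoidHom.ext fun c => Units.ext (tensorMap_id_apply c.1))
  map_comp f g := GrpCat.hom_ext (MonoidHom.ext fun c => Units.ext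
    (tensorMap_comp_apply g.hom f.hom c.1))

section
variable {W W' : Type u} [CommRing W] [Algebra F W] [CommRing W'] [Algebra F W']

/-- The element of `W ⊗ A` underlying a point of `unitsFunctor`. -/
def unitsVal {A : CommAlgCat.{u} F} (c : (unitsFunctor F W).obj A) : W ⊗[F] A :=
  (show (W ⊗[F] A)ˣ from c).1

theorem unitsVal_injective {A : CommAlgCat.{u} F} :
    Function.Injective (unitsVal : (unitsFunctor F W).obj A → W ⊗[F] A) := fun _ _ h => Units.ext h

@[simp] theorem unitsVal_one {A : CommAlgCat.{u} F} :
    unitsVal (1 : (unitsFunctor F W).obj A) = 1 := rfl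

@[simp] theorem unitsVal_mul {A : CommAlgCat.{u} F} (c d : (unitsFunctor F W).obj A) :
    unitsVal (c * d) = unitsVal c * unitsVal d := rfl

@[simp] theorem unitsVal_map {A B : CommAlgCat.{u} F} (f : A ⟶ B) (c : (unitsFunctor F W).obj A) :
    unitsVal ((unitsFunctor F W).map f c) = tensorMap W f.hom (unitsVal c) := rfl

theorem unitsVal_mul_inv {A : CommAlgCat.{u} F} (c : (unitsFunctor F W).obj A) :
    unitsVal c * unitsVal c⁻¹ = 1 := by rw [← unitsVal_mul, mul_inv_cancel, unitsVal_one]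

theorem isUnit_unitsVal {A : CommAlgCat.{u} F} (c : (unitsFunctor F W).obj A) :
    IsUnit (unitsVal c) := Units.isUnit (show (W ⊗[F] A)ˣ from c)

/-- A point of `unitsFunctor` from a pair of inverse elements. -/
def unitsMk {A : CommAlgCat.{u} F} (z z' : W ⊗[F] A) (h : z * z' = 1) : (unitsFunctor F W).obj A :=
  (⟨z, z', h, (mul_comm z' z).trans h⟩ : (W ⊗[F] A)ˣ)

/-- The morphism of unit groups induced by a homomorphism of algebras. -/
def unitsFunctorMap (d : W →ₐ[F] W') : unitsFunctor F W ⟶ unitsFunctor F W' where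
  app A := GrpCat.ofHom (Units.map (Algebra.TensorProduct.map d (AlgHom.id F A) : _ →* _))
  naturality {A B} f := GrpCat.hom_ext (MonoidHom.ext fun c => Units.ext (by
    change Algebra.TensorProduct.map d (AlgHom.id F B) (tensorMap W f.hom c.1) =
      tensorMap W' f.hom (Algebra.TensorProduct.map d (AlgHom.id F A) c.1)
    rw [← AlgHom.comp_apply, ← AlgHom.comp_apply]
    congr 1
    exact Algebra.TensorProduct.ext (by ext; simp) (by ext; simp)))

@[simp] theorem unitsVal_unitsFunctorMap (d : W →ₐ[F] W') {A : CommAlgCat.{u} F}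
    (c : (unitsFunctor F W).obj A) : unitsVal ((unitsFunctorMap d).app A c) =
      Algebra.TensorProduct.map d (AlgHom.id F A) (unitsVal c) := rfl

theorem unitsFunctor_isAffineAlgebraic [FiniteDimensional F W] :
    (unitsFunctor F W).IsAffineAlgebraic := by
  let b := Module.finBasis F W
  let ι := Fin (Module.finrank F W)
  let R₀ := MvPolynomial (ι ⊕ ι) F
  let e : ∀ (A : Type u) [CommRing A] [Algebra F A], (W ⊗[F] A) ≃ₗ[F] (ι →₀ A) := fun A _ _ =>
    TensorProduct.equivFinsuppOfBasisLeft b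
  -- the two generic elements of `W ⊗ R₀`
  let x : W ⊗[F] R₀ :=
    (e R₀).symm (Finsupp.equivFunOnFinite.symm fun i => MvPolynomial.X (Sum.inl i))
  let y : W ⊗[F] R₀ :=
    (e R₀).symm (Finsupp.equivFunOnFinite.symm fun i => MvPolynomial.X (Sum.inr i))
  have hx : ∀ (A : Type u) [CommRing A] [Algebra F A] (f : R₀ →ₐ[F] A) (i : ι),
      e A (tensorMap W f x) i = f (MvPolynomial.X (Sum.inl i)) := fun A _ _ f i => by
    simp only [e, x, equivFinsuppOfBasisLeft_tensorMap, LinearEquiv.apply_symm_apply]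
    rfl
  have hy : ∀ (A : Type u) [CommRing A] [Algebra F A] (f : R₀ →ₐ[F] A) (i : ι),
      e A (tensorMap W f y) i = f (MvPolynomial.X (Sum.inr i)) := fun A _ _ f i => by
    simp only [e, y, equivFinsuppOfBasisLeft_tensorMap, LinearEquiv.apply_symm_apply]
    rfl
  obtain ⟨I, hI⟩ := exists_ideal_tensorMap_eq_zero_iff (x * y - 1)
  have hI' : ∀ (A : Type u) [CommRing A] [Algebra F A] (f : R₀ →ₐ[F] A),
      tensorMap W f x * tensorMap W f y = 1 ↔ ∀ a ∈ I, f a = 0 := fun A _ _ f => by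
    rw [← hI, map_sub, map_mul, map_one, sub_eq_zero]
  let q : R₀ →ₐ[F] R₀ ⧸ I := Ideal.Quotient.mkₐ F I
  have hq := (hI' _ q).mpr fun a ha => Ideal.Quotient.eq_zero_iff_mem.mpr ha
  refine ⟨CommAlgCat.of F (R₀ ⧸ I),
    Algebra.FiniteType.of_surjective (Ideal.Quotient.mkₐ F I) (Ideal.Quotient.mkₐ_surjective F I),
    isRepresentedBy_of_universal (unitsMk (A := CommAlgCat.of F (R₀ ⧸ I)) _ _ hq) fun A => ⟨?_, ?_⟩⟩
  · intro f g hfg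
    have h1 : tensorMap W f.hom (tensorMap W q x) = tensorMap W g.hom (tensorMap W q x) :=
      congrArg unitsVal hfg
    have h2 : tensorMap W f.hom (tensorMap W q y) = tensorMap W g.hom (tensorMap W q y) :=
      congrArg (fun c => unitsVal c⁻¹) hfg
    rw [← tensorMap_comp_apply, ← tensorMap_comp_apply] at h1 h2
    refine CommAlgCat.hom_ext (Ideal.Quotient.algHom_ext F (MvPolynomial.algHom_ext ?_))
    rintro (i | i)
    · have := congrArg (fun z => e A z i) h1
      simpa only [hx] using this
    · have := congrArg (fun z => e A z i) h2
      simpa only [hy] using this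
  · intro c
    let f : R₀ →ₐ[F] A :=
      MvPolynomial.aeval (Sum.elim (e A (unitsVal c)) (e A (unitsVal c⁻¹)))
    have h1 : tensorMap W f x = unitsVal c := (e A).injective <| Finsupp.ext fun i => by
      rw [hx]
      exact MvPolynomial.aeval_X _ _
    have h2 : tensorMap W f y = unitsVal c⁻¹ := (e A).injective <| Finsupp.ext fun i => by
      rw [hy]
      exact MvPolynomial.aeval_X _ _
    have hf := (hI' A f).mp (by rw [h1, h2, unitsVal_mul_inv])
    refine ⟨CommAlgCat.ofHom (Ideal.Quotient.liftₐ I f hf), unitsVal_injective ?_⟩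
    refine Eq.trans (tensorMap_comp_apply (Ideal.Quotient.liftₐ I f hf) q x).symm (Eq.trans ?_ h1)
    congr 2

end

end UnitsFunctor

/-! ### Amitsur cocycles -/

section CocycleFunctor

open GroupFunctor SubgroupFunctor

variable (F K : Type u) [Field F] [Field K] [Algebra F K]

/-- The coface map `a ⊗ b ↦ a ⊗ b ⊗ 1`. -/
def coface₁₂ : K ⊗[F] K →ₐ[F] K ⊗[F] (K ⊗[F] K) :=
  Algebra.TensorProduct.map (AlgHom.id F K) Algebra.TensorProduct.includeLeft

/-- The coface map `a ⊗ b ↦ a ⊗ 1 ⊗ b`. -/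
def coface₁₃ : K ⊗[F] K →ₐ[F] K ⊗[F] (K ⊗[F] K) :=
  Algebra.TensorProduct.map (AlgHom.id F K) Algebra.TensorProduct.includeRight

/-- The coface map `a ⊗ b ↦ 1 ⊗ a ⊗ b`. -/
def coface₂₃ : K ⊗[F] K →ₐ[F] K ⊗[F] (K ⊗[F] K) := Algebra.TensorProduct.includeRight

variable {F K} in
/-- The extension of scalars `W ⊗ A → W' ⊗ A` of an algebra homomorphism. -/
abbrev mapTensor {W W' : Type u} [CommRing W] [Algebra F W] [CommRing W'] [Algebra F W']
    (d : W →ₐ[F] W') (A : Type u) [CommRing A] [Algebra F A] : W ⊗[F] A →ₐ[F] W' ⊗[F] A :=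
  Algebra.TensorProduct.map d (AlgHom.id F A)

variable {F K} in
theorem mapTensor_tensorMap {W W' : Type u} [CommRing W] [Algebra F W] [CommRing W'] [Algebra F W']
    (d : W →ₐ[F] W') {A B : Type u} [CommRing A] [Algebra F A] [CommRing B] [Algebra F B]
    (f : A →ₐ[F] B) (z : W ⊗[F] A) :
    mapTensor d B (tensorMap W f z) = tensorMap W' f (mapTensor d A z) := by
  induction z with
  | zero => simp
  | add x y hx hy => simp only [map_add, hx, hy]
  | tmul w a => simp

/-- Amitsur `1`-cocycles: the units `y` of `K ⊗ K ⊗ A` with `y₁₂ y₂₃ = y₁₃`. This is a model of the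
quotient of `Res_{K/F} G_m` by `G_m`. -/
def cocycles : SubgroupFunctor (unitsFunctor F (K ⊗[F] K)) where
  obj A :=
    { carrier := {y | mapTensor (coface₁₂ F K) A (unitsVal y) *
        mapTensor (coface₂₃ F K) A (unitsVal y) = mapTensor (coface₁₃ F K) A (unitsVal y)}
      one_mem' := by simp
      mul_mem' := fun {x y} hx hy => by
        simp only [Set.mem_ofPred_eq, unitsVal_mul, map_mul] at hx hy ⊢
        rw [← hx, ← hy]
        ring
      inv_mem' := fun {y} hy => by
        simp only [Set.mem_ofPred_eq] at hy ⊢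
        refine ((isUnit_unitsVal y).map (mapTensor (coface₁₃ F K) A)).mul_left_cancel ?_
        rw [← map_mul, unitsVal_mul_inv, map_one, ← hy, mul_mul_mul_comm, ← map_mul, ← map_mul,
          unitsVal_mul_inv, map_one, map_one, one_mul] }
  map_mem {A B} f y hy := by
    have h1 := congrArg (tensorMap _ f.hom) (show mapTensor (coface₁₂ F K) A (unitsVal y) *
        mapTensor (coface₂₃ F K) A (unitsVal y) = mapTensor (coface₁₃ F K) A (unitsVal y) from hy)
    rw [map_mul, ← mapTensor_tensorMap, ← mapTensor_tensorMap, ← mapTensor_tensorMap] at h1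
    exact h1

variable {F K} in
theorem mem_cocycles {A : CommAlgCat.{u} F} {y : (unitsFunctor F (K ⊗[F] K)).obj A} :
    y ∈ (cocycles F K).obj A ↔ mapTensor (coface₁₂ F K) A (unitsVal y) *
        mapTensor (coface₂₃ F K) A (unitsVal y) = mapTensor (coface₁₃ F K) A (unitsVal y) := Iff.rfl

theorem cocycles_isClosed : (cocycles F K).IsClosed := by
  intro A y
  obtain ⟨I, hI⟩ := exists_ideal_tensorMap_eq_zero_iff
    (mapTensor (coface₁₂ F K) A (unitsVal y) * mapTensor (coface₂₃ F K) A (unitsVal y) -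
      mapTensor (coface₁₃ F K) A (unitsVal y))
  refine ⟨I, fun B f => ?_⟩
  rw [← hI, mem_cocycles, unitsVal_map, map_sub, map_mul, sub_eq_zero, mapTensor_tensorMap,
    mapTensor_tensorMap, mapTensor_tensorMap]

theorem mapTensor_coface_includeLeft (A : Type u) [CommRing A] [Algebra F A] (z : K ⊗[F] A) :
    mapTensor (coface₁₂ F K) A (mapTensor Algebra.TensorProduct.includeLeft A z) =
      mapTensor (coface₁₃ F K) A (mapTensor Algebra.TensorProduct.includeLeft A z) := by
  induction z with
  | zero => simp
  | add x y hx hy => simp only [map_add, hx, hy]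
  | tmul w a => simp [coface₁₂, coface₁₃]

theorem mapTensor_coface_includeRight (A : Type u) [CommRing A] [Algebra F A] (z : K ⊗[F] A) :
    mapTensor (coface₁₃ F K) A (mapTensor Algebra.TensorProduct.includeRight A z) =
      mapTensor (coface₂₃ F K) A (mapTensor Algebra.TensorProduct.includeRight A z) := by
  induction z with
  | zero => simp
  | add x y hx hy => simp only [map_add, hx, hy]
  | tmul w a => simp [coface₂₃, coface₁₃]

theorem mapTensor_coface_middle (A : Type u) [CommRing A] [Algebra F A] (z : K ⊗[F] A) :
    mapTensor (coface₁₂ F K) A (mapTensor Algebra.TensorProduct.includeRight A z) =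
      mapTensor (coface₂₃ F K) A (mapTensor Algebra.TensorProduct.includeLeft A z) := by
  induction z with
  | zero => simp
  | add x y hx hy => simp only [map_add, hx, hy]
  | tmul w a => simp [coface₂₃, coface₁₂]

variable {F K} in
theorem coboundary_mem_cocycles {A : CommAlgCat.{u} F} (c : (unitsFunctor F K).obj A) :
    (unitsFunctorMap Algebra.TensorProduct.includeLeft).app A c *
      (unitsFunctorMap Algebra.TensorProduct.includeRight).app A c⁻¹ ∈ (cocycles F K).obj A := by
  rw [mem_cocycles]
  simp only [unitsVal_mul, unitsVal_unitsFunctorMap, map_mul, mapTensor_coface_includeLeft,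
    mapTensor_coface_includeRight, mapTensor_coface_middle]
  have key : mapTensor (coface₂₃ F K) A (mapTensor Algebra.TensorProduct.includeLeft A
      (unitsVal c⁻¹)) * mapTensor (coface₂₃ F K) A (mapTensor Algebra.TensorProduct.includeLeft A
      (unitsVal c)) = 1 := by
    rw [← map_mul, ← map_mul, mul_comm, unitsVal_mul_inv, map_one, map_one]
  linear_combination (mapTensor (coface₁₃ F K) A (mapTensor Algebra.TensorProduct.includeLeft A
    (unitsVal c)) * mapTensor (coface₂₃ F K) A (mapTensor Algebra.TensorProduct.includeRight A
    (unitsVal c⁻¹))) * key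

variable {F K} in
/-- The coboundary map on `A`-points. -/
def coboundaryHom (A : CommAlgCat.{u} F) :
    (unitsFunctor F K).obj A →* (cocycles F K).toFunctor.obj A where
  toFun c := ⟨_, coboundary_mem_cocycles c⟩
  map_one' := Subtype.ext (by
    change _ * _ = (1 : (unitsFunctor F (K ⊗[F] K)).obj A)
    rw [inv_one, map_one, map_one, mul_one])
  map_mul' c d := Subtype.ext (unitsVal_injective (by
    change unitsVal (_ * _) = unitsVal (_ * _ * (_ * _))
    rw [mul_inv_rev, map_mul, map_mul]
    simp only [unitsVal_mul]
    ring))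

/-- The map `c ↦ c₁ c₂⁻¹` from `Res_{K/F} G_m` to Amitsur cocycles. -/
def coboundary : unitsFunctor F K ⟶ (cocycles F K).toFunctor where
  app A := GrpCat.ofHom (coboundaryHom A)
  naturality {A B} f := GrpCat.hom_ext (MonoidHom.ext fun c => Subtype.ext (by
    change (unitsFunctorMap _).app B ((unitsFunctor F K).map f c) *
      (unitsFunctorMap _).app B ((unitsFunctor F K).map f c)⁻¹ =
      (unitsFunctor F (K ⊗[F] K)).map f (_ * _)
    rw [map_mul, ← map_app_apply, ← map_app_apply]
    simp only [map_inv]))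

variable {F K}

theorem unitsVal_coboundary {A : CommAlgCat.{u} F} (c : (unitsFunctor F K).obj A) :
    unitsVal ((cocycles F K).subtype.app A ((coboundary F K).app A c)) =
      mapTensor Algebra.TensorProduct.includeLeft A (unitsVal c) *
        mapTensor Algebra.TensorProduct.includeRight A (unitsVal c⁻¹) := rfl

theorem coboundary_eq_iff {A : CommAlgCat.{u} F} (c : (unitsFunctor F K).obj A)
    (y : (cocycles F K).toFunctor.obj A) : (coboundary F K).app A c = y ↔
      mapTensor Algebra.TensorProduct.includeLeft A (unitsVal c) =
        unitsVal ((cocycles F K).subtype.app A y) *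
          mapTensor Algebra.TensorProduct.includeRight A (unitsVal c) := by
  have h : (coboundary F K).app A c = y ↔
      unitsVal ((cocycles F K).subtype.app A ((coboundary F K).app A c)) =
        unitsVal ((cocycles F K).subtype.app A y) :=
    ⟨fun h => by rw [h], fun h => Subtype.ext (unitsVal_injective h)⟩
  rw [h, unitsVal_coboundary,
    ← ((isUnit_unitsVal c).map (mapTensor Algebra.TensorProduct.includeRight A)).mul_left_inj,
    mul_assoc, ← map_mul, mul_comm (unitsVal c⁻¹), unitsVal_mul_inv, map_one, mul_one]

/-- The sequence `A → K ⊗ A → K ⊗ K ⊗ A` is exact. -/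
theorem includeLeft_eq_includeRight_iff {A : Type u} [CommRing A] [Algebra F A] (z : K ⊗[F] A) :
    mapTensor (Algebra.TensorProduct.includeLeft : K →ₐ[F] K ⊗[F] K) A z =
      mapTensor Algebra.TensorProduct.includeRight A z ↔ ∃ a : A, z = 1 ⊗ₜ a := by
  have h1 := Module.Flat.rTensor_exact A (Algebra.IsEffective.of_faithfullyFlat F K)
  have h2 : (Algebra.TensorProduct.includeLeftSubRight F K).rTensor A z =
      mapTensor Algebra.TensorProduct.includeLeft A z -
        mapTensor Algebra.TensorProduct.includeRight A z := by
    induction z with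
    | zero => simp
    | add x y hx hy => simp only [map_add, hx, hy]; ring
    | tmul w a => simp [sub_tmul]
  rw [← sub_eq_zero, ← h2, h1 z]
  constructor
  · rintro ⟨x, rfl⟩
    obtain ⟨a, rfl⟩ := (TensorProduct.lid F A).symm.surjective x
    exact ⟨a, by simp⟩
  · rintro ⟨a, rfl⟩
    exact ⟨1 ⊗ₜ a, by simp⟩

/-- The kernel of the coboundary is `G_m`, by faithfully flat descent of elements along `F → K`. -/
theorem coboundary_eq_one_iff {A : CommAlgCat.{u} F} (c : (unitsFunctor F K).obj A) :
    (coboundary F K).app A c = 1 ↔ ∃ a : A, unitsVal c = 1 ⊗ₜ a := by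
  rw [coboundary_eq_iff, map_one, unitsVal_one, one_mul, includeLeft_eq_includeRight_iff]

/-- Every cocycle over `A` becomes a coboundary over `A ⊗ K`: it is the coboundary of itself, with
the second tensor factor absorbed in the base. -/
theorem exists_coboundary_eq [FiniteDimensional F K] {A : CommAlgCat.{u} F}
    (y : (cocycles F K).toFunctor.obj A) : ∃ (B : CommAlgCat.{u} F) (f : A ⟶ B)
      (c : (unitsFunctor F K).obj B), f.hom.toRingHom.FaithfullyFlat ∧
        f.hom.toRingHom.FinitePresentation ∧
        (coboundary F K).app B c = (cocycles F K).toFunctor.map f y := by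
  let α : (K ⊗[F] K) ⊗[F] A →ₐ[F] K ⊗[F] (A ⊗[F] K) :=
    (Algebra.TensorProduct.map (AlgHom.id F K) (Algebra.TensorProduct.comm F K A).toAlgHom).comp
      (Algebra.TensorProduct.assoc F F F K K A).toAlgHom
  let γ : (K ⊗[F] (K ⊗[F] K)) ⊗[F] A →ₐ[F] (K ⊗[F] K) ⊗[F] (A ⊗[F] K) :=
    ((Algebra.TensorProduct.map (AlgHom.id F (K ⊗[F] K))
      (Algebra.TensorProduct.comm F K A).toAlgHom).comp
        (Algebra.TensorProduct.assoc F F F (K ⊗[F] K) K A).toAlgHom).comp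
      (mapTensor (Algebra.TensorProduct.assoc F F F K K K).symm.toAlgHom A)
  let f : A →ₐ[F] A ⊗[F] K := Algebra.TensorProduct.includeLeft
  have h13 : ∀ z, mapTensor Algebra.TensorProduct.includeLeft (A ⊗[F] K) (α z) =
      γ (mapTensor (coface₁₃ F K) A z) := by
    have : (mapTensor Algebra.TensorProduct.includeLeft (A ⊗[F] K)).comp α =
        γ.comp (mapTensor (coface₁₃ F K) A) := by
      ext <;> simp [α, γ, coface₁₃, Algebra.TensorProduct.one_def]
    exact AlgHom.congr_fun this
  have h23 : ∀ z, mapTensor Algebra.TensorProduct.includeRight (A ⊗[F] K) (α z) =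
      γ (mapTensor (coface₂₃ F K) A z) := by
    have : (mapTensor Algebra.TensorProduct.includeRight (A ⊗[F] K)).comp α =
        γ.comp (mapTensor (coface₂₃ F K) A) := by
      ext <;> simp [α, γ, coface₂₃, Algebra.TensorProduct.one_def]
    exact AlgHom.congr_fun this
  have h12 : ∀ z, tensorMap (K ⊗[F] K) f z = γ (mapTensor (coface₁₂ F K) A z) := by
    have : tensorMap (K ⊗[F] K) f = γ.comp (mapTensor (coface₁₂ F K) A) := by
      ext <;> simp [f, γ, coface₁₂, Algebra.TensorProduct.one_def]
    exact AlgHom.congr_fun this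
  let y₀ := (cocycles F K).subtype.app A y
  refine ⟨CommAlgCat.of F (A ⊗[F] K), CommAlgCat.ofHom f, unitsMk (α (unitsVal y₀))
    (α (unitsVal y₀⁻¹)) (by rw [← map_mul, unitsVal_mul_inv, map_one]), ?_, ?_, ?_⟩
  · exact (RingHom.faithfullyFlat_algebraMap_iff (R := A) (S := A ⊗[F] K)).mpr inferInstance
  · have : Algebra.FinitePresentation F K :=
      (Algebra.FinitePresentation.of_finiteType (R := F)).mp inferInstance
    have : Algebra.FinitePresentation A (A ⊗[F] K) := Algebra.FinitePresentation.baseChange A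
    exact (RingHom.finitePresentation_algebraMap (A := A) (B := A ⊗[F] K)).mpr inferInstance
  · rw [coboundary_eq_iff]
    change mapTensor _ (A ⊗[F] K) (α (unitsVal y₀)) = tensorMap (K ⊗[F] K) f (unitsVal y₀) *
      mapTensor _ (A ⊗[F] K) (α (unitsVal y₀))
    rw [h13, h23, h12, ← map_mul]
    exact congrArg γ (mem_cocycles.mp y.2).symm

end CocycleFunctor

/-! ### Norms and descent -/

section NormRatio

open GroupFunctor SubgroupFunctor

variable {F K : Type u} [Field F] [Field K] [Algebra F K]

/-- The norm `K ⊗ A → A`. -/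
def tensorNorm (A : Type u) [CommRing A] [Algebra F A] : K ⊗[F] A →* A :=
  (Algebra.norm A).comp (Algebra.TensorProduct.comm F K A : K ⊗[F] A →* A ⊗[F] K)

theorem tensorNorm_tensorMap [FiniteDimensional F K] {A B : Type u} [CommRing A] [Algebra F A]
    [CommRing B] [Algebra F B] (f : A →ₐ[F] B) (z : K ⊗[F] A) :
    tensorNorm B (tensorMap K f z) = f (tensorNorm A z) := by
  let b := Module.finBasis F K
  have h1 : ∀ z : K ⊗[F] A, Algebra.TensorProduct.comm F K B (tensorMap K f z) =
      f.toLinearMap.rTensor K (Algebra.TensorProduct.comm F K A z) := by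
    intro z
    induction z with
    | zero => simp
    | add x y hx hy => simp only [map_add, hx, hy]
    | tmul w a => simp
  have h2 : ∀ x : A ⊗[F] K,
      Algebra.leftMulMatrix (Algebra.TensorProduct.basis B b) (f.toLinearMap.rTensor K x) =
        (Algebra.leftMulMatrix (Algebra.TensorProduct.basis A b) x).map f := by
    intro x
    ext i j
    rw [Matrix.map_apply, Algebra.leftMulMatrix_eq_repr_mul, Algebra.leftMulMatrix_eq_repr_mul,
      ← basis_repr_rTensor]
    congr 2
    rw [Algebra.TensorProduct.basis_apply, Algebra.TensorProduct.basis_apply]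
    have h3 : (1 : B) ⊗ₜ[F] b j = f.toLinearMap.rTensor K ((1 : A) ⊗ₜ b j) := by simp
    rw [h3]
    exact (map_mul (Algebra.TensorProduct.map f (AlgHom.id F K)) x (1 ⊗ₜ b j)).symm
  change Algebra.norm B (Algebra.TensorProduct.comm F K B (tensorMap K f z)) =
    f (Algebra.norm A (Algebra.TensorProduct.comm F K A z))
  rw [h1, Algebra.norm_eq_matrix_det (Algebra.TensorProduct.basis B b), h2,
    Algebra.norm_eq_matrix_det (Algebra.TensorProduct.basis A b)]
  exact (AlgHom.map_det f _).symm

theorem tensorNorm_tmul [FiniteDimensional F K] {A : Type u} [CommRing A] [Algebra F A] (k : K)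
    (a : A) : tensorNorm A (k ⊗ₜ[F] a) =
      a ^ Module.finrank F K * algebraMap F A (Algebra.norm F k) := by
  have h1 : k ⊗ₜ[F] a = 1 ⊗ₜ a * tensorMap K (Algebra.ofId F A) (k ⊗ₜ 1) := by simp
  have h2 : tensorNorm A ((1 : K) ⊗ₜ[F] a) = a ^ Module.finrank F K := by
    change Algebra.norm A (Algebra.TensorProduct.comm F K A ((1 : K) ⊗ₜ[F] a)) = _
    rw [Algebra.TensorProduct.comm_tmul]
    refine (Algebra.norm_algebraMap_of_basis
      (Algebra.TensorProduct.basis A (Module.finBasis F K)) a).trans ?_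
    rw [Fintype.card_fin]
  have h3 : tensorNorm F (k ⊗ₜ[F] (1 : F)) = Algebra.norm F k := by
    change Algebra.norm F (Algebra.TensorProduct.comm F K F (k ⊗ₜ[F] (1 : F))) = _
    rw [Algebra.TensorProduct.comm_tmul]
    exact Algebra.norm_eq_of_algEquiv (Algebra.TensorProduct.lid F K).symm k
  rw [h1, map_mul, h2, tensorNorm_tensorMap, h3, Algebra.ofId_apply]

/-- The element `cⁿ / N(c)` of `K ⊗ A`, where `n = [K : F]`. It depends only on the class of `c`
modulo `G_m` and has norm one. -/
def normRatio {A : CommAlgCat.{u} F} (c : (unitsFunctor F K).obj A) : K ⊗[F] A :=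
  unitsVal c ^ Module.finrank F K * 1 ⊗ₜ tensorNorm A (unitsVal c⁻¹)

theorem normRatio_one {A : CommAlgCat.{u} F} : normRatio (1 : (unitsFunctor F K).obj A) = 1 := by
  rw [normRatio, inv_one, unitsVal_one, one_pow, map_one, one_mul, Algebra.TensorProduct.one_def]

theorem normRatio_mul {A : CommAlgCat.{u} F} (c d : (unitsFunctor F K).obj A) :
    normRatio (c * d) = normRatio c * normRatio d := by
  have h : (1 : K) ⊗ₜ[F] (tensorNorm A (unitsVal d⁻¹) * tensorNorm A (unitsVal c⁻¹)) =
      1 ⊗ₜ tensorNorm A (unitsVal d⁻¹) * 1 ⊗ₜ tensorNorm A (unitsVal c⁻¹) := by simp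
  rw [normRatio, normRatio, normRatio, mul_inv_rev, unitsVal_mul, unitsVal_mul, map_mul, mul_pow, h]
  ring

theorem tensorNorm_inv_mul {A : CommAlgCat.{u} F} (c : (unitsFunctor F K).obj A) :
    tensorNorm A (unitsVal c) * tensorNorm A (unitsVal c⁻¹) = 1 := by
  rw [← map_mul, unitsVal_mul_inv, map_one]

/-- Faithfully flat descent for elements of `W ⊗ A`. -/
theorem exists_tensorMap_eq {W : Type u} [CommRing W] [Algebra F W] {A B : Type u} [CommRing A]
    [Algebra F A] [CommRing B] [Algebra F B] [Algebra A B] [IsScalarTower F A B]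
    [Module.FaithfullyFlat A B] (z : W ⊗[F] B)
    (h : tensorMap W ((Algebra.TensorProduct.includeLeft : B →ₐ[A] B ⊗[A] B).restrictScalars F) z =
      tensorMap W ((Algebra.TensorProduct.includeRight : B →ₐ[A] B ⊗[A] B).restrictScalars F) z) :
    ∃ w : W ⊗[F] A, tensorMap W (IsScalarTower.toAlgHom F A B) w = z := by
  have h0 : Function.Exact ((Algebra.linearMap A B).restrictScalars F)
      ((Algebra.TensorProduct.includeLeftSubRight A B).restrictScalars F) :=
    Algebra.IsEffective.of_faithfullyFlat A B
  have h1 := Module.Flat.lTensor_exact W h0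
  have h2 : ((Algebra.TensorProduct.includeLeftSubRight A B).restrictScalars F).lTensor W z =
      tensorMap W ((Algebra.TensorProduct.includeLeft : B →ₐ[A] B ⊗[A] B).restrictScalars F) z -
      tensorMap W ((Algebra.TensorProduct.includeRight : B →ₐ[A] B ⊗[A] B).restrictScalars F) z := by
    clear h
    induction z with
    | zero => simp
    | add x y hx hy => simp only [map_add, hx, hy]; ring
    | tmul w a => simp [tmul_sub]
  obtain ⟨w, hw⟩ := (h1 z).mp (by rw [h2, h, sub_self])
  refine ⟨w, ?_⟩
  rw [← hw]
  clear hw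
  induction w with
  | zero => simp
  | add x y hx hy => simp only [map_add, hx, hy]
  | tmul w a => simp

/-- If `cⁿ / N(c) = 1`, then `cⁿ` is a scalar. -/
theorem unitsVal_pow_of_normRatio_eq_one {A : CommAlgCat.{u} F} {c : (unitsFunctor F K).obj A}
    (h : normRatio c = 1) :
    unitsVal (c ^ Module.finrank F K) = 1 ⊗ₜ tensorNorm A (unitsVal c) := by
  have h1 : unitsVal (c ^ Module.finrank F K) = unitsVal c ^ Module.finrank F K := rfl
  have h2 : (1 : K) ⊗ₜ[F] tensorNorm A (unitsVal c⁻¹) * 1 ⊗ₜ tensorNorm A (unitsVal c) = 1 := by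
    rw [Algebra.TensorProduct.tmul_mul_tmul, mul_comm (tensorNorm A _), tensorNorm_inv_mul, one_mul,
      Algebra.TensorProduct.one_def]
  rw [h1, ← mul_one (unitsVal c ^ _), ← h2, ← mul_assoc]
  change normRatio c * _ = _
  rw [h, one_mul]

/-- Faithfully flat descent for elements of `W ⊗ A`, in terms of pairs of maps that agree on `A`. -/
theorem exists_tensorMap_eq_of_forall {W : Type u} [CommRing W] [Algebra F W] {A B : Type u}
    [CommRing A] [Algebra F A] [CommRing B] [Algebra F B] {f : A →ₐ[F] B}
    (hf : f.toRingHom.FaithfullyFlat) (z : W ⊗[F] B)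
    (h : ∀ (C : Type u) [CommRing C] [Algebra F C] (j j' : B →ₐ[F] C), j.comp f = j'.comp f →
      tensorMap W j z = tensorMap W j' z) : ∃ w : W ⊗[F] A, tensorMap W f w = z := by
  let := f.toRingHom.toAlgebra
  have htower : IsScalarTower F A B := IsScalarTower.of_algebraMap_eq fun r => (f.commutes r).symm
  have hff : Module.FaithfullyFlat A B := hf
  have hf' : IsScalarTower.toAlgHom F A B = f := AlgHom.ext fun _ => rfl
  rw [← hf']
  exact exists_tensorMap_eq z (h _ _ _ (AlgHom.ext fun a =>
    (Algebra.TensorProduct.includeLeft (S := A).commutes a).trans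
      (Algebra.TensorProduct.includeRight.commutes a).symm))

/-- A faithfully flat homomorphism can be pushed out along every homomorphism, and stays
injective. -/
theorem exists_pushout_injective {A B B' : Type u} [CommRing A] [Algebra F A] [CommRing B]
    [Algebra F B] [CommRing B'] [Algebra F B'] {f : A →ₐ[F] B} (hf : f.toRingHom.FaithfullyFlat)
    (g : A →ₐ[F] B') : ∃ (C : Type u) (_ : CommRing C) (_ : Algebra F C) (j : B →ₐ[F] C)
      (j' : B' →ₐ[F] C), j.comp f = j'.comp g ∧ Function.Injective j' := by
  let := f.toRingHom.toAlgebra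
  let := g.toRingHom.toAlgebra
  have htower : IsScalarTower F A B := IsScalarTower.of_algebraMap_eq fun r => (f.commutes r).symm
  have htower' : IsScalarTower F A B' := IsScalarTower.of_algebraMap_eq fun r => (g.commutes r).symm
  have hff : Module.FaithfullyFlat A B := hf
  refine ⟨B' ⊗[A] B, inferInstance, inferInstance,
    (Algebra.TensorProduct.includeRight : B →ₐ[A] B' ⊗[A] B).restrictScalars F,
    (Algebra.TensorProduct.includeLeft : B' →ₐ[A] B' ⊗[A] B).restrictScalars F, ?_,
    FaithfulSMul.algebraMap_injective B' (B' ⊗[A] B)⟩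
  exact AlgHom.ext fun a =>
    ((Algebra.TensorProduct.includeRight : B →ₐ[A] B' ⊗[A] B).commutes a).trans
    ((Algebra.TensorProduct.includeLeft : B' →ₐ[A] B' ⊗[A] B).commutes a).symm

variable [FiniteDimensional F K]

theorem tensorMap_normRatio {A B : CommAlgCat.{u} F} (f : A ⟶ B) (c : (unitsFunctor F K).obj A) :
    tensorMap K f.hom (normRatio c) = normRatio ((unitsFunctor F K).map f c) := by
  rw [normRatio, normRatio, ← map_inv, unitsVal_map, unitsVal_map, map_mul, map_pow,
    tensorNorm_tensorMap]
  simp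

theorem normRatio_eq_one {A : CommAlgCat.{u} F} {c : (unitsFunctor F K).obj A} {a : A}
    (h : unitsVal c = 1 ⊗ₜ a) : normRatio c = 1 := by
  have h1 := tensorNorm_inv_mul c
  rw [h, tensorNorm_tmul, map_one, map_one, mul_one] at h1
  rw [normRatio, h, Algebra.TensorProduct.tmul_pow, one_pow, Algebra.TensorProduct.tmul_mul_tmul,
    h1, one_mul, Algebra.TensorProduct.one_def]

theorem tensorNorm_normRatio {A : CommAlgCat.{u} F} (c : (unitsFunctor F K).obj A) :
    tensorNorm A (normRatio c) = 1 := by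
  rw [normRatio, map_mul, map_pow, tensorNorm_tmul, map_one, map_one, mul_one, ← mul_pow,
    tensorNorm_inv_mul, one_pow]

end NormRatio

/-! ### Descending the ratio of the `n`-th power and the norm -/

section Anisotropic

open GroupFunctor SubgroupFunctor

open LaurentPolynomial in
/-- The units of a ring of Laurent polynomials over a field are the nonzero monomials. -/
theorem LaurentPolynomial.exists_eq_C_mul_T {K : Type*} [Field K] {p : LaurentPolynomial K}
    (hp : IsUnit p) : ∃ (a : K) (m : ℤ), p = C a * T m := by
  obtain ⟨p', hp'⟩ := hp.exists_right_inv
  obtain ⟨n, f, hf⟩ := exists_T_pow p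
  obtain ⟨n', f', hf'⟩ := exists_T_pow p'
  have h1 : f * f' = Polynomial.X ^ (n + n') := by
    apply Polynomial.toLaurent_injective
    rw [map_mul, hf, hf', Polynomial.toLaurent_X_pow, Nat.cast_add, T_add]
    linear_combination (T (n : ℤ) * T (n' : ℤ)) * hp'
  obtain ⟨i, -, u, hu⟩ := (dvd_prime_pow Polynomial.prime_X _).mp (Dvd.intro _ h1)
  obtain ⟨a, ha, hau⟩ := Polynomial.isUnit_iff.mp (u⁻¹).isUnit
  have h2 : f = Polynomial.C a * Polynomial.X ^ i := by
    rw [hau, ← hu, mul_comm, mul_assoc, Units.mul_inv, mul_one]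
  refine ⟨a, i - n, ?_⟩
  have h3 : p = Polynomial.toLaurent f * T (-n) := by
    rw [hf, mul_T_assoc, add_neg_cancel, T_zero, mul_one]
  rw [h3, h2, Polynomial.toLaurent_C_mul_X_pow, mul_T_assoc, sub_eq_add_neg]

variable {F K : Type u} [Field F] [Field K] [Algebra F K]

open LaurentPolynomial in
theorem exists_eq_tmul_T {w : K ⊗[F] LaurentPolynomial F} (hw : IsUnit w) :
    ∃ (k : K) (m : ℤ), w = k ⊗ₜ T m := by
  let θ : K ⊗[F] LaurentPolynomial F ≃ₐ[K] LaurentPolynomial K :=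
    AddMonoidAlgebra.scalarTensorEquiv F K
  obtain ⟨k, m, h⟩ := LaurentPolynomial.exists_eq_C_mul_T (hw.map θ)
  refine ⟨k, m, ?_⟩
  rw [← θ.symm_apply_apply w, h, ← single_eq_C_mul_T]
  exact AddMonoidAlgebra.scalarTensorEquiv_symm_single m k

theorem GroupFunctor.IsAffineAlgebraic.map_injective {k : Type u} [Field k] {Q : GroupFunctor k}
    (hQ : Q.IsAffineAlgebraic) {A B : CommAlgCat.{u} k} (f : A ⟶ B)
    (hf : Function.Injective f.hom) : Function.Injective (Q.map f) := by
  obtain ⟨R, -, hrep⟩ := hQ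
  obtain ⟨x, hx⟩ := hrep.exists_universal
  intro q q' h
  obtain ⟨g, rfl⟩ := (hx A).2 q
  obtain ⟨g', rfl⟩ := (hx A).2 q'
  simp only [← GrpCat.comp_apply, ← Q.map_comp] at h
  have h1 := (hx B).1 h
  have h2 : g = g' := CommAlgCat.hom_ext (AlgHom.ext fun r => hf
    (AlgHom.congr_fun (congrArg CommAlgCat.Hom.hom h1) r))
  rw [h2]

section

variable [FiniteDimensional F K] {Q : GroupFunctor F} {π : unitsFunctor F K ⟶ Q}
  (hker : ∀ (A : CommAlgCat.{u} F) (c : (unitsFunctor F K).obj A),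
    π.app A c = 1 → ∃ a : A, unitsVal c = 1 ⊗ₜ a)

include hker in
theorem normRatio_eq_of_app_eq {A : CommAlgCat.{u} F} {c d : (unitsFunctor F K).obj A}
    (h : π.app A c = π.app A d) : normRatio c = normRatio d := by
  obtain ⟨a, ha⟩ := hker A (c * d⁻¹) (by rw [map_mul, map_inv, h, mul_inv_cancel])
  have h1 := normRatio_eq_one ha
  have h2 := normRatio_mul (c * d⁻¹) d
  rwa [inv_mul_cancel_right, h1, one_mul] at h2

include hker in
/-- Two lifts of a point of the quotient have the same image under `c ↦ cⁿ / N(c)` over every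
common extension. -/
theorem tensorMap_normRatio_eq {A B B' C : CommAlgCat.{u} F} {q : Q.obj A} {f : A ⟶ B}
    {f' : A ⟶ B'} {c : (unitsFunctor F K).obj B} {c' : (unitsFunctor F K).obj B'}
    (hc : π.app B c = Q.map f q) (hc' : π.app B' c' = Q.map f' q) {j : B ⟶ C} {j' : B' ⟶ C}
    (hj : f ≫ j = f' ≫ j') :
    tensorMap K j.hom (normRatio c) = tensorMap K j'.hom (normRatio c') := by
  rw [tensorMap_normRatio, tensorMap_normRatio]
  apply normRatio_eq_of_app_eq hker
  rw [map_app_apply, map_app_apply, hc, hc', ← GrpCat.comp_apply, ← GrpCat.comp_apply,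
    ← Q.map_comp, ← Q.map_comp, hj]

include hker in
/-- The map `c ↦ cⁿ / N(c)` descends to the quotient. -/
theorem exists_normRatio_descent
    (hsurj : ∀ (A : CommAlgCat.{u} F) (q : Q.obj A), ∃ (B : CommAlgCat.{u} F) (f : A ⟶ B)
      (c : (unitsFunctor F K).obj B), f.hom.toRingHom.FaithfullyFlat ∧ π.app B c = Q.map f q)
    {A : CommAlgCat.{u} F} (q : Q.obj A) :
    ∃ w : K ⊗[F] A, IsUnit w ∧ ∀ (B : CommAlgCat.{u} F) (f : A ⟶ B)
      (c : (unitsFunctor F K).obj B), π.app B c = Q.map f q →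
        tensorMap K f.hom w = normRatio c := by
  obtain ⟨B₀, f₀, c₀, hf₀, hc₀⟩ := hsurj A q
  have hinj := hf₀.injective
  have hdesc : ∀ (q : Q.obj A) (c : (unitsFunctor F K).obj B₀), π.app B₀ c = Q.map f₀ q →
      ∃ w : K ⊗[F] A, tensorMap K f₀.hom w = normRatio c := fun q c hc =>
    exists_tensorMap_eq_of_forall hf₀ _ fun C _ _ j j' hj =>
      tensorMap_normRatio_eq hker hc hc (C := CommAlgCat.of F C) (j := CommAlgCat.ofHom j)
        (j' := CommAlgCat.ofHom j') (CommAlgCat.hom_ext hj)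
  obtain ⟨w, hw⟩ := hdesc q c₀ hc₀
  obtain ⟨w', hw'⟩ := hdesc q⁻¹ c₀⁻¹ (by rw [map_inv, map_inv, hc₀])
  refine ⟨w, IsUnit.of_mul_eq_one w' (tensorMap_injective hinj ?_), fun B f c hc => ?_⟩
  · rw [map_mul, hw, hw', ← normRatio_mul, mul_inv_cancel, normRatio_one, map_one]
  · obtain ⟨C, _, _, j₀, j, hj, hjinj⟩ := exists_pushout_injective hf₀ f.hom
    apply tensorMap_injective (W := K) hjinj
    have h1 := tensorMap_normRatio_eq hker hc₀ hc (C := CommAlgCat.of F C)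
      (j := CommAlgCat.ofHom j₀) (j' := CommAlgCat.ofHom j) (CommAlgCat.hom_ext hj)
    refine Eq.trans ?_ h1
    change tensorMap K j (tensorMap K f.hom w) = tensorMap K j₀ (normRatio c₀)
    rw [← hw, ← tensorMap_comp_apply, ← tensorMap_comp_apply, hj]

end

end Anisotropic

/-! ### Cocharacters of the quotient -/

section Cocharacter

open GroupFunctor SubgroupFunctor

variable {F K : Type u} [Field F] [Field K] [Algebra F K]

/-- The homomorphism `F[T, T⁻¹] → A` that sends `T` to a given unit. -/
def laurentEval {A : Type u} [CommRing A] [Algebra F A] (a : Aˣ) : LaurentPolynomial F →ₐ[F] A :=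
  AddMonoidAlgebra.lift F A ℤ ((Units.coeHom A).comp (zpowersHom Aˣ a))

theorem laurentEval_T {A : Type u} [CommRing A] [Algebra F A] (a : Aˣ) :
    laurentEval (F := F) a (LaurentPolynomial.T 1) = a := by
  rw [laurentEval, LaurentPolynomial.T, AddMonoidAlgebra.lift_single]
  simp

variable (F) in
/-- The endomorphism `T ↦ Tⁿ` of `F[T, T⁻¹]`. -/
def laurentExpand (n : ℕ) : LaurentPolynomial F →ₐ[F] LaurentPolynomial F :=
  AddMonoidAlgebra.mapDomainAlgHom F F (AddMonoidHom.mulLeft (n : ℤ))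

theorem laurentExpand_T (n : ℕ) :
    laurentExpand F n (LaurentPolynomial.T 1) = LaurentPolynomial.T 1 ^ n := by
  rw [LaurentPolynomial.T_pow]
  change AddMonoidAlgebra.mapDomain _ (AddMonoidAlgebra.single 1 1) = AddMonoidAlgebra.single _ 1
  rw [AddMonoidAlgebra.mapDomain_single]
  rfl

theorem laurentExpand_injective {n : ℕ} (hn : n ≠ 0) : Function.Injective (laurentExpand F n) :=
  AddMonoidAlgebra.mapDomain_injective
    (mul_right_injective₀ (Nat.cast_ne_zero.mpr hn : (n : ℤ) ≠ 0))

/-- The universal unit. -/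
def laurentUnit (F : Type u) [Field F] : (LaurentPolynomial F)ˣ :=
  ⟨LaurentPolynomial.T 1, LaurentPolynomial.T (-1), by rw [← LaurentPolynomial.T_add]; rfl,
    by rw [← LaurentPolynomial.T_add]; rfl⟩

open LaurentPolynomial in
theorem eq_zero_of_T_pow_mul_algebraMap_eq_one {n : ℕ} (hn : n ≠ 0) {m : ℤ} {r : F}
    (h : (T m : LaurentPolynomial F) ^ n * algebraMap F _ r = 1) : m = 0 := by
  rw [T_pow, ← C_eq_algebraMap, mul_comm, ← single_eq_C_mul_T] at h
  have h1 := congrArg (fun p => AddMonoidAlgebra.coeff p 0) h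
  by_contra hm
  have h2 : (n : ℤ) * m ≠ 0 := mul_ne_zero (Nat.cast_ne_zero.mpr hn) hm
  rw [AddMonoidAlgebra.one_def] at h1
  simp only [AddMonoidAlgebra.coeff_single, Finsupp.single_eq_same] at h1
  rw [Finsupp.single_eq_of_ne h2.symm] at h1
  exact zero_ne_one h1

variable [FiniteDimensional F K] {Q : GroupFunctor F} {π : unitsFunctor F K ⟶ Q}

/-- The quotient of `Res_{K/F} G_m` by `G_m` has no nontrivial cocharacters. -/
theorem cocharacter_eq_one (hQ : Q.IsAffineAlgebraic)
    (hker : ∀ (A : CommAlgCat.{u} F) (c : (unitsFunctor F K).obj A),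
      π.app A c = 1 ↔ ∃ a : A, unitsVal c = 1 ⊗ₜ a)
    (hsurj : ∀ (A : CommAlgCat.{u} F) (q : Q.obj A), ∃ (B : CommAlgCat.{u} F) (f : A ⟶ B)
      (c : (unitsFunctor F K).obj B), f.hom.toRingHom.FaithfullyFlat ∧ π.app B c = Q.map f q)
    (χ : ∀ A : CommAlgCat.{u} F, (A : Type u)ˣ →* Q.obj A)
    (hχ : ∀ {A B : CommAlgCat.{u} F} (f : A ⟶ B) (a : (A : Type u)ˣ),
      Q.map f (χ A a) = χ B (Units.map (f.hom : (A : Type u) →* (B : Type u)) a))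
    (A : CommAlgCat.{u} F) (a : (A : Type u)ˣ) : χ A a = 1 := by
  let n := Module.finrank F K
  have hn : n ≠ 0 := Module.finrank_pos.ne'
  let L := CommAlgCat.of F (LaurentPolynomial F)
  let q : Q.obj L := χ L (laurentUnit F)
  obtain ⟨w, hw, hwq⟩ := exists_normRatio_descent (fun A c => (hker A c).mp) hsurj q
  obtain ⟨B, f, c, hf, hc⟩ := hsurj L q
  have hwc := hwq B f c hc
  have hnorm : tensorNorm L w = 1 := by
    apply hf.injective
    refine (tensorNorm_tensorMap f.hom w).symm.trans ?_
    rw [hwc, tensorNorm_normRatio, map_one]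
  -- the norm of the monomial `k T ^ m` is a constant multiple of `T ^ (n m)`
  obtain ⟨k, m, hkm⟩ := exists_eq_tmul_T hw
  have hm : m = 0 := by
    rw [hkm, tensorNorm_tmul] at hnorm
    exact eq_zero_of_T_pow_mul_algebraMap_eq_one hn hnorm
  subst hm
  rw [LaurentPolynomial.T_zero] at hkm
  -- specialize at `T = 1`
  have hk : k ⊗ₜ[F] (1 : F) = 1 := by
    have h1 := hwq (CommAlgCat.of F F) (CommAlgCat.ofHom (laurentEval 1)) 1 (by
      rw [map_one, hχ]
      have : Units.map (laurentEval (F := F) (1 : Fˣ) : LaurentPolynomial F →* F)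
          (laurentUnit F) = 1 := Units.ext (laurentEval_T (F := F) (1 : Fˣ))
      exact ((congrArg (χ (CommAlgCat.of F F)) this).trans (map_one _)).symm)
    rw [normRatio_one, hkm] at h1
    refine Eq.trans ?_ h1
    simp
  have hw1 : w = 1 := by
    have h1 : w = tensorMap K (Algebra.ofId F (LaurentPolynomial F)) (k ⊗ₜ 1) := by
      rw [hkm]; simp
    rw [h1, hk, map_one]
  have hqn : q ^ n = 1 := by
    apply hQ.map_injective f hf.injective
    rw [map_one, map_pow, ← hc, ← map_pow, hker]
    exact ⟨_, unitsVal_pow_of_normRatio_eq_one (by rw [← hwc, hw1, map_one])⟩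
  -- the `n`-th power of `q` is its image under the injective map `T ↦ T ^ n`
  have hq : q = 1 := by
    apply hQ.map_injective (CommAlgCat.ofHom (laurentExpand F n) : L ⟶ L)
      (laurentExpand_injective hn)
    rw [map_one, hχ, ← hqn, ← map_pow]
    congr 1
    exact Units.ext (laurentExpand_T n)
  have h1 := hχ (CommAlgCat.ofHom (laurentEval a) : L ⟶ A) (laurentUnit F)
  have h2 : Units.map (laurentEval (F := F) a : LaurentPolynomial F →* A) (laurentUnit F) = a :=
    Units.ext (laurentEval_T a)
  refine (congrArg (χ A) h2).symm.trans (h1.symm.trans ?_)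
  change Q.map _ q = 1
  rw [hq, map_one]

/-- A group functor without nontrivial cocharacters is anisotropic. -/
theorem GroupFunctor.isAnisotropic_of_cocharacter_eq_one {F : Type u} [Field F] {Q : GroupFunctor F}
    (h : ∀ χ : (∀ A : CommAlgCat.{u} F, (A : Type u)ˣ →* Q.obj A),
      (∀ {A B : CommAlgCat.{u} F} (f : A ⟶ B) (a : (A : Type u)ˣ),
        Q.map f (χ A a) = χ B (Units.map (f.hom : (A : Type u) →* (B : Type u)) a)) →
      ∀ A a, χ A a = 1) : Q.IsAnisotropic := by
  rintro S - ⟨r, ⟨e⟩⟩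
  have h1 : ∀ (i : Fin r) (A : CommAlgCat.{u} F) (a : (A : Type u)ˣ),
      e.inv.app A (show (splitTorus F r).obj A from Pi.mulSingle i a) = 1 := by
    intro i A a
    let χ : ∀ A : CommAlgCat.{u} F, (A : Type u)ˣ →* Q.obj A := fun A =>
      (S.subtype.app A).hom.comp ((e.inv.app A).hom.comp
        (show (A : Type u)ˣ →* (splitTorus F r).obj A from
          MonoidHom.mulSingle (fun _ => (A : Type u)ˣ) i))
    refine Subtype.ext (h χ (fun {A B} f a => ?_) A a)
    change Q.map f (S.subtype.app A (e.inv.app A _)) = S.subtype.app B (e.inv.app B _)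
    rw [← map_app_apply, ← map_app_apply]
    congr 2
    funext j
    refine Units.ext ?_
    change f.hom ((Pi.mulSingle i a : Fin r → (A : Type u)ˣ) j : A) =
      ((Pi.mulSingle i (Units.map (f.hom : (A : Type u) →* (B : Type u)) a) :
        Fin r → (B : Type u)ˣ) j : B)
    rcases eq_or_ne j i with rfl | hji
    · simp
    · simp [hji]
  ext A x
  change x ∈ S.obj A ↔ x = 1
  refine ⟨fun hx => ?_, fun hx => hx ▸ (S.obj A).one_mem⟩
  have h2 : ∀ y : (splitTorus F r).obj A, e.inv.app A y = 1 := by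
    intro y
    have h3 : y = (∏ i, (Pi.mulSingle i ((show Fin r → (A : Type u)ˣ from y) i) :
      Fin r → (A : Type u)ˣ)) := (Finset.univ_prod_mulSingle _).symm
    let ψ : (Fin r → (A : Type u)ˣ) →* S.toFunctor.obj A := (e.inv.app A).hom
    change ψ y = 1
    have hker : ∀ i, (Pi.mulSingle i ((show Fin r → (A : Type u)ˣ from y) i) :
      Fin r → (A : Type u)ˣ) ∈ ψ.ker := fun i => h1 i A _
    have := Subgroup.prod_mem ψ.ker (t := Finset.univ) fun i _ => hker i
    rw [← h3] at this
    exact this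
  let x' : S.toFunctor.obj A := ⟨x, hx⟩
  have h4 : x' = 1 := (iso_hom_inv_apply e A x').symm.trans (h2 _)
  exact congrArg Subtype.val h4

end Cocharacter

/-! ### Centers of automorphism groups -/

section CenterAut

open GroupFunctor SubgroupFunctor

/-- An automorphism of a free module that commutes with all automorphisms is a scalar. -/
theorem LinearMap.GeneralLinearGroup.exists_eq_smul_of_forall_commute {R M ι : Type*} [CommRing R]
    [AddCommGroup M] [Module R M] [Fintype ι] [DecidableEq ι] (b : Module.Basis ι R M)
    (g : LinearMap.GeneralLinearGroup R M)
    (hg : ∀ h : LinearMap.GeneralLinearGroup R M, g * h = h * g) :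
    ∃ u : Rˣ, ∀ x, g.1 x = u • x := by
  let e : LinearMap.GeneralLinearGroup R M ≃* Matrix.GeneralLinearGroup ι R :=
    Units.mapEquiv (LinearMap.toMatrixAlgEquiv b).toMulEquiv
  have h1 : e g ∈ Subgroup.center (Matrix.GeneralLinearGroup ι R) := by
    rw [Subgroup.mem_center_iff]
    intro h
    obtain ⟨h, rfl⟩ := e.surjective h
    rw [← map_mul, ← map_mul, hg]
  rw [Matrix.GeneralLinearGroup.center_eq_range_scalar] at h1
  obtain ⟨u, hu⟩ := h1
  refine ⟨u, fun x => ?_⟩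
  have h2 : LinearMap.toMatrixAlgEquiv b g.1 =
      LinearMap.toMatrixAlgEquiv b (algebraMap R (Module.End R M) u) := by
    rw [AlgEquivClass.commutes]
    exact (congrArg Units.val hu).symm
  rw [(LinearMap.toMatrixAlgEquiv b).injective h2]
  rfl

section

variable {k : Type u} [Field k] {V : Type u} [AddCommGroup V] [Module k V]

/-- The automorphism underlying a point of `autFunctor`. -/
def autVal {A : CommAlgCat.{u} k} (g : (autFunctor k V).obj A) : Module.End A (A ⊗[k] V) :=
  (show LinearMap.GeneralLinearGroup A (A ⊗[k] V) from g).1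

theorem autVal_injective {A : CommAlgCat.{u} k} :
    Function.Injective (autVal : (autFunctor k V).obj A → _) := fun _ _ h => Units.ext h

theorem autVal_mul {A : CommAlgCat.{u} k} (g h : (autFunctor k V).obj A) :
    autVal (g * h) = autVal g * autVal h := rfl

theorem autVal_map_eq_smul {A B : CommAlgCat.{u} k} (f : A ⟶ B) {g : (autFunctor k V).obj A} {a : A}
    (hg : ∀ x, autVal g x = a • x) (x : B ⊗[k] V) :
    autVal ((autFunctor k V).map f g) x = f.hom a • x := by
  have h : autVal ((autFunctor k V).map f g) = algebraMap B (Module.End B (B ⊗[k] V)) (f.hom a) := by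
    refine end_ext_rTensor f.hom fun x => ?_
    refine (endBaseChange_rTensor f.hom (autVal g) x).trans ?_
    rw [hg, rTensor_smul]
    rfl
  rw [h]
  rfl

theorem mem_center_autFunctor_of_eq_smul {A : CommAlgCat.{u} k} {g : (autFunctor k V).obj A} {a : A}
    (hg : ∀ x, autVal g x = a • x) : g ∈ (center (autFunctor k V)).obj A := by
  intro B f h
  refine autVal_injective (LinearMap.ext fun x => ?_)
  rw [autVal_mul, autVal_mul, Module.End.mul_apply, Module.End.mul_apply, autVal_map_eq_smul f hg,
    autVal_map_eq_smul f hg, map_smul]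

variable [FiniteDimensional k V]

theorem exists_eq_smul_of_forall_commute {A : CommAlgCat.{u} k} {g : (autFunctor k V).obj A}
    (hg : ∀ h, g * h = h * g) : ∃ u : (A : Type u)ˣ, ∀ x, autVal g x = u • x :=
  LinearMap.GeneralLinearGroup.exists_eq_smul_of_forall_commute
    (Algebra.TensorProduct.basis A (Module.finBasis k V))
    (show LinearMap.GeneralLinearGroup A (A ⊗[k] V) from g) hg

theorem exists_eq_smul_of_mem_center {A : CommAlgCat.{u} k} {g : (autFunctor k V).obj A}
    (hg : g ∈ (center (autFunctor k V)).obj A) :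
    ∃ u : (A : Type u)ˣ, ∀ x, autVal g x = u • x := by
  refine exists_eq_smul_of_forall_commute fun h => ?_
  have := hg A (𝟙 A) h
  rwa [(autFunctor k V).map_id] at this

end

section

variable {F K V : Type u} [Field F] [Field K] [Algebra F K] [AddCommGroup V] [Module K V]

/-- The action of `Res_{K/F} G_m` on `V` by scalars, on `A`-points. -/
def scalarHomApp (A : CommAlgCat.{u} F) : (unitsFunctor F K).obj A →* (resAut F K V).obj A :=
  Units.map (algebraMap (K ⊗[F] A) (Module.End (K ⊗[F] A) ((K ⊗[F] A) ⊗[K] V)) :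
    K ⊗[F] A →* Module.End (K ⊗[F] A) ((K ⊗[F] A) ⊗[K] V))

theorem autVal_scalarHomApp {A : CommAlgCat.{u} F} (c : (unitsFunctor F K).obj A)
    (x : (K ⊗[F] A) ⊗[K] V) :
    autVal (A := (extendAlg F K).obj A) (scalarHomApp (V := V) A c) x = unitsVal c • x := rfl

/-- The action of `Res_{K/F} G_m` on `V` by scalars. -/
def scalarHom : unitsFunctor F K ⟶ resAut F K V where
  app A := GrpCat.ofHom (scalarHomApp A)
  naturality {_ B} f := GrpCat.hom_ext (MonoidHom.ext fun c =>
    autVal_injective (A := (extendAlg F K).obj B) (LinearMap.ext fun x =>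
      (autVal_map_eq_smul (V := V) ((extendAlg F K).map f) (autVal_scalarHomApp c) x).symm))

theorem autVal_scalarHom {A : CommAlgCat.{u} F} (c : (unitsFunctor F K).obj A)
    (x : (K ⊗[F] A) ⊗[K] V) :
    autVal (A := (extendAlg F K).obj A) ((scalarHom (V := V)).app A c) x = unitsVal c • x := rfl

theorem scalarHom_mem_center {A : CommAlgCat.{u} F} (c : (unitsFunctor F K).obj A) :
    (scalarHom (V := V)).app A c ∈ (center (resAut F K V)).obj A := fun _ f h =>
  mem_center_autFunctor_of_eq_smul (A := (extendAlg F K).obj A) (autVal_scalarHom (V := V) c)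
    _ ((extendAlg F K).map f) h

variable (V) in
/-- Scalars, as a morphism to the center of `Res_{K/F} Aut_K(V)`. -/
def scalarToCenter : unitsFunctor F K ⟶ (center (resAut F K V)).toFunctor where
  app A := GrpCat.ofHom (((scalarHom (V := V)).app A).hom.codRestrict
    ((center (resAut F K V)).obj A) scalarHom_mem_center)
  naturality _ _ f := GrpCat.hom_ext (MonoidHom.ext fun c => Subtype.ext
    (map_app_apply (scalarHom (V := V)) f c))

theorem autVal_resAutToAut_scalarHom [Module F V] [IsScalarTower F K V]
    {A : CommAlgCat.{u} F} (c : (unitsFunctor F K).obj A)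
    (x : A ⊗[F] V) : autVal ((resAutToAut F K V).app A ((scalarHom (V := V)).app A c)) x =
      resEquiv F K V A (unitsVal c • (resEquiv F K V A).symm x) := rfl

variable (F K V) in
/-- The center of `Aut_F(V)` consists of scalars, and these come from central elements of
`Res_{K/F} Aut_K(V)`. -/
theorem center_autFunctor_le_map_center [Module F V] [IsScalarTower F K V] [FiniteDimensional F V] :
    center (autFunctor F V) ≤ map (resAutToAut F K V) (center (resAut F K V)) := by
  intro A z hz
  obtain ⟨u, hu⟩ := exists_eq_smul_of_mem_center hz
  let c : (unitsFunctor F K).obj A :=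
    unitsMk ((1 : K) ⊗ₜ[F] (u : A)) (1 ⊗ₜ ((u⁻¹ : (A : Type u)ˣ) : A))
    (by rw [Algebra.TensorProduct.tmul_mul_tmul, one_mul, Units.mul_inv,
      Algebra.TensorProduct.one_def])
  refine ⟨(scalarHom (V := V)).app A c, scalarHom_mem_center c,
    autVal_injective (LinearMap.ext fun x => ?_)⟩
  refine (autVal_resAutToAut_scalarHom c x).trans ?_
  change resEquiv F K V A ((1 : K) ⊗ₜ[F] (u : A) • _) = _
  rw [resEquiv_smul, AddEquiv.apply_symm_apply, hu]
  rfl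

variable [FiniteDimensional K V]

theorem eq_of_forall_smul_eq [Nontrivial V] {R : Type u} [CommRing R] [Algebra K R] {c d : R}
    (h : ∀ x : R ⊗[K] V, c • x = d • x) : c = d := by
  let b := Algebra.TensorProduct.basis R (Module.finBasis K V)
  let i : Fin (Module.finrank K V) := ⟨0, Module.finrank_pos⟩
  have h1 := congrArg (fun x => b.repr x i) (h (b i))
  simpa using h1

/-- The center of `Res_{K/F} Aut_K(V)` is `Res_{K/F} G_m`. -/
theorem scalarToCenter_bijective [Nontrivial V] (A : CommAlgCat.{u} F) :
    Function.Bijective ((scalarToCenter (F := F) (K := K) V).app A) := by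
  constructor
  · intro c d h
    refine unitsVal_injective (eq_of_forall_smul_eq (K := K) (V := V) fun x => ?_)
    have h1 := congrArg Subtype.val h
    exact congrArg (fun g => autVal (A := (extendAlg F K).obj A) g x) h1
  · rintro ⟨z, hz⟩
    obtain ⟨c, hc⟩ := exists_eq_smul_of_forall_commute (A := (extendAlg F K).obj A) (g := z)
      fun h => by
        have := hz A (𝟙 A) h
        rwa [(resAut F K V).map_id] at this
    exact ⟨c, Subtype.ext (autVal_injective (A := (extendAlg F K).obj A)
      (LinearMap.ext fun x => (hc x).symm))⟩

variable [Module F V] [IsScalarTower F K V]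

theorem resAutToAut_scalarHom_mem_center_iff [FiniteDimensional F V] [Nontrivial V]
    {A : CommAlgCat.{u} F} (c : (unitsFunctor F K).obj A) :
    (resAutToAut F K V).app A ((scalarHom (V := V)).app A c) ∈ (center (autFunctor F V)).obj A ↔
      ∃ a : A, unitsVal c = 1 ⊗ₜ a := by
  constructor
  · intro h
    obtain ⟨u, hu⟩ := exists_eq_smul_of_mem_center h
    refine ⟨u, eq_of_forall_smul_eq (K := K) (V := V) fun y => (resEquiv F K V A).injective ?_⟩
    have h1 := hu (resEquiv F K V A y)
    rw [autVal_resAutToAut_scalarHom, AddEquiv.symm_apply_apply] at h1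
    rw [h1, resEquiv_smul]
    rfl
  · rintro ⟨a, ha⟩
    refine mem_center_autFunctor_of_eq_smul (a := a) fun x => ?_
    rw [autVal_resAutToAut_scalarHom, ha, resEquiv_smul, AddEquiv.apply_symm_apply]

end

end CenterAut

/-! ### The quotient of the centers -/

section CenterQuotient

open GroupFunctor SubgroupFunctor

variable (F K V : Type u) [Field F] [Field K] [Algebra F K] [AddCommGroup V] [Module K V]

theorem center_resAut_eq_one [Subsingleton V] {A : CommAlgCat.{u} F}
    (z : (center (resAut F K V)).toFunctor.obj A) : z = 1 := by
  have : Subsingleton ((K ⊗[F] A) ⊗[K] V) := inferInstance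
  exact Subtype.ext (autVal_injective (A := (extendAlg F K).obj A) (LinearMap.ext fun x =>
    Subsingleton.elim (α := (K ⊗[F] A) ⊗[K] V) _ _))

variable [Module F V] [IsScalarTower F K V]

/-- The center of `Aut_F(V)`, as a subgroup functor of the center of `Res_{K/F} Aut_K(V)`. -/
abbrev centerInCenter : SubgroupFunctor (center (resAut F K V)).toFunctor :=
  comap ((center (resAut F K V)).subtype ≫ resAutToAut F K V) (center (autFunctor F V))

variable [FiniteDimensional K V]

variable {F K V} in
theorem app_scalarToCenter_mem_centerInCenter_iff [FiniteDimensional F V] [Nontrivial V]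
    {A : CommAlgCat.{u} F} (c : (unitsFunctor F K).obj A) :
    (scalarToCenter V).app A c ∈ (centerInCenter F K V).obj A ↔ ∃ a : A, unitsVal c = 1 ⊗ₜ a :=
  resAutToAut_scalarHom_mem_center_iff c

/-- For `V ≠ 0` the quotient of the centers is the group of Amitsur cocycles; for `V = 0` both
centers are trivial. -/
theorem exists_isQuotient_center [FiniteDimensional F V] [FiniteDimensional F K] :
    ∃ (Q : GroupFunctor F) (π : (center (resAut F K V)).toFunctor ⟶ Q),
      IsQuotient (centerInCenter F K V) π := by
  rcases subsingleton_or_nontrivial V with hV | hV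
  · refine ⟨_, 𝟙 _, ⟨CommAlgCat.of F F, inferInstance, ?_⟩, fun A g => ?_, fun A q => ?_⟩
    · refine isRepresentedBy_of_universal 1 fun A => ⟨fun f g _ => ?_, fun z => ?_⟩
      · exact CommAlgCat.hom_ext (Subsingleton.elim (α := F →ₐ[F] A) _ _)
      · exact ⟨CommAlgCat.ofHom (Algebra.ofId F A),
          (map_one _).trans (center_resAut_eq_one F K V z).symm⟩
    · rw [center_resAut_eq_one F K V g]
      simp only [map_one, true_iff]
      exact one_mem _
    · exact ⟨A, 𝟙 A, q, RingHom.FaithfullyFlat.of_bijective Function.bijective_id,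
        RingHom.FinitePresentation.id A,
        (center_resAut_eq_one F K V _).trans (center_resAut_eq_one F K V _).symm⟩
  · let σ := isoOfBijective _ (scalarToCenter_bijective (F := F) (K := K) (V := V))
    refine ⟨(cocycles F K).toFunctor, σ.inv ≫ coboundary F K,
      (cocycles_isClosed F K).isAffineAlgebraic unitsFunctor_isAffineAlgebraic,
      fun A g => ?_, fun A q => ?_⟩
    · obtain ⟨c, rfl⟩ := (iso_hom_bijective σ A).2 g
      have h1 : (σ.inv ≫ coboundary F K).app A (σ.hom.app A c) = (coboundary F K).app A c :=
        congrArg ((coboundary F K).app A) (iso_hom_inv_apply σ A c)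
      rw [h1, coboundary_eq_one_iff]
      exact (app_scalarToCenter_mem_centerInCenter_iff c).symm
    · obtain ⟨B, f, c, hf, hf', hc⟩ := exists_coboundary_eq q
      refine ⟨B, f, σ.hom.app B c, hf, hf', Eq.trans ?_ hc⟩
      exact congrArg ((coboundary F K).app B) (iso_hom_inv_apply σ B c)

variable {F K V} in
/-- Every quotient of the centers has trivial cocharacters, hence contains no nontrivial split
torus. -/
theorem isAnisotropic_of_isQuotient_center [FiniteDimensional F V] [FiniteDimensional F K]
    {Q : GroupFunctor F} {π : (center (resAut F K V)).toFunctor ⟶ Q}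
    (h : IsQuotient (centerInCenter F K V) π) : Q.IsAnisotropic := by
  obtain ⟨hQ, hker, hsurj⟩ := h
  rcases subsingleton_or_nontrivial V with hV | hV
  · have hone : ∀ (A : CommAlgCat.{u} F) (q : Q.obj A), q = 1 := by
      intro A q
      obtain ⟨B, f, z, hf, -, hz⟩ := hsurj A q
      apply hQ.map_injective f hf.injective
      rw [← hz, center_resAut_eq_one F K V z, map_one, map_one]
    intro S _ _
    ext A x
    rw [hone A x]
    exact ⟨fun _ => one_mem _, fun _ => one_mem _⟩
  · let σ := isoOfBijective _ (scalarToCenter_bijective (F := F) (K := K) (V := V))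
    refine isAnisotropic_of_cocharacter_eq_one fun χ hχ => ?_
    refine cocharacter_eq_one (K := K) (π := σ.hom ≫ π) hQ (fun A c => ?_) (fun A q => ?_) χ hχ
    · rw [← app_scalarToCenter_mem_centerInCenter_iff (V := V) c, ← hker]
      rfl
    · obtain ⟨B, f, z, hf, -, hz⟩ := hsurj A q
      obtain ⟨c, rfl⟩ := (iso_hom_bijective σ B).2 z
      exact ⟨B, f, c, hf, hz⟩

end CenterQuotient

end

theorem mainTheorem12 {F E E' V : Type u}
    [Field F] [ValuativeRel F] [TopologicalSpace F] [IsNonarchimedeanLocalField F]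
    [Field E] [Field E'] [Algebra F E] [Algebra E E'] [Algebra F E'] [IsScalarTower F E E']
    [FiniteDimensional F E] [FiniteDimensional E E']
    (hE : IsTamelyRamified (Valuation.integer (ValuativeRel.valuation F)) E)
    (hE' : IsTamelyRamified
      (integralClosure (Valuation.integer (ValuativeRel.valuation F)) E) E')
    [AddCommGroup V] [Module E' V] [Module E V] [Module F V]
    [IsScalarTower E E' V] [IsScalarTower F E' V] [IsScalarTower F E V]
    [FiniteDimensional E' V] :
    GroupFunctor.IsTameTwistedLeviSequence (autFunctor F V)
      ![SubgroupFunctor.range (resAutToAut F E' V), SubgroupFunctor.range (resAutToAut F E V), ⊤] ∧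
    SubgroupFunctor.center (autFunctor F V) ≤
      SubgroupFunctor.map (resAutToAut F E' V) (SubgroupFunctor.center (resAut F E' V)) ∧
    (∃ (Q : GroupFunctor F) (π : (SubgroupFunctor.center (resAut F E' V)).toFunctor ⟶ Q),
      GroupFunctor.IsQuotient
        (SubgroupFunctor.comap
          ((SubgroupFunctor.center (resAut F E' V)).subtype ≫ resAutToAut F E' V)
          (SubgroupFunctor.center (autFunctor F V))) π) ∧
    ∀ (Q : GroupFunctor F) (π : (SubgroupFunctor.center (resAut F E' V)).toFunctor ⟶ Q),
      GroupFunctor.IsQuotient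
        (SubgroupFunctor.comap
          ((SubgroupFunctor.center (resAut F E' V)).subtype ≫ resAutToAut F E' V)
          (SubgroupFunctor.center (autFunctor F V))) π →
      Q.IsAnisotropic := by
  have hfin : FiniteDimensional F E' := FiniteDimensional.trans F E E'
  have hfinV : FiniteDimensional F V := FiniteDimensional.trans F E' V
  obtain ⟨hsep, L, _, _, hL, hgal, htame, hsplit⟩ := exists_tamelyRamified_galois hE hE'
  have hsepE : Algebra.IsSeparable F E := Algebra.isSeparable_tower_bot_of_isSeparable F E E'
  have hsplitE : ∀ x : E, ((minpoly F x).map (algebraMap F L)).Splits := fun x => by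
    rw [← minpoly.algebraMap_eq (algebraMap E E').injective x]
    exact hsplit _
  have hsplitF : ∀ x : F, ((minpoly F x).map (algebraMap F L)).Splits := fun x => by
    rw [minpoly.eq_X_sub_C', Polynomial.map_sub, Polynomial.map_X, Polynomial.map_C]
    exact Polynomial.Splits.X_sub_C _
  have htop := range_resAutToAut_self F V
  refine ⟨⟨?_, rfl, ?_, L, _, _, hL, hgal, htame, ?_⟩, center_autFunctor_le_map_center F E' V,
    exists_isQuotient_center F E' V, fun Q π h => isAnisotropic_of_isQuotient_center h⟩
  · rw [Fin.monotone_iff_le_succ]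
    intro i
    fin_cases i
    · exact range_resAutToAut_mono F V
    · exact fun A g _ => trivial
  · intro i
    fin_cases i
    · exact range_resAutToAut_isClosed_isReductive F E' V
    · exact range_resAutToAut_isClosed_isReductive F E V
    · exact htop ▸ range_resAutToAut_isClosed_isReductive F F V
  · intro i
    fin_cases i
    · exact range_resAutToAut_isLevi_isSplit F E' V L hsplit
    · exact range_resAutToAut_isLevi_isSplit F E V L hsplitE
    · exact htop ▸ range_resAutToAut_isLevi_isSplit F F V L hsplitF
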